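/- Let $(X_n)_{n\ge1}$ be real-valued random variables on a probability space $(\Omega,\mathcal F,\mathbb P)$ that are conditionally identically distributed (c.i.d.): for all integers $n\ge1$ and $k\ge1$, $$(X_1,\dots,X_n,X_{n+1})\overset{d}{=}(X_1,\dots,X_n,X_{n+k}).$$ Let $(P_n)_{n\ge0}$ be its predictive rule: $P_0$ is the law of $X_1$ and, for $n\ge1$, $P_n$ is a regular version of the conditional distribution of $X_{n+1}$ given $(X_1,\dots,X_n)$. Write $P_n(t)=P_n((-\infty,t])$ for the predictive distribution function. Let $\tilde F$ be the random probability distribution obtained as the weak limit of the empirical distributions $\hat F_n=\frac1n\sum_{i=1}^n\delta_{X_i}$ (for a c.i.d. sequence this limit exists $\mathbb P$-a.s., which is included in the claim), and write $\tilde F(t)=\tilde F((-\infty,t])$. Let ${\bf t}=(t_1,\dots,t_k)\in\mathbb R^k$ be such that $\mathbb P(X_1\in\{t_1,\dots,t_k\})=0$. For $n\ge1$ put $\Delta_{t,n}=P_n(t)-P_{n-1}(t)$ and let $\boldsymbol\Delta_{{\bf t},n}=[\Delta_{t_1,n},\dots,\Delta_{t_k,n}]^T$. Suppose that, for $i=1,\dots,k$,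 $$E\Big(\sup_{n\ge1}\sqrt n\,|\Delta_{t_i,n}|\Big)<\infty,\qquad \sum_{n=1}^\infty n^2E(\Delta_{t_i,n}^4)<\infty,$$ and that $$E\big(n^2\boldsymbol\Delta_{{\bf t},n}\boldsymbol\Delta_{{\bf t},n}^T\mid X_1,\dots,X_{n-1}\big)\to U_{\bf t}\qquad\mathbb P\text{-a.s.}$$ for a $\mathbb P$-a.s. positive definite random matrix $U_{\bf t}$. For $n\ge1$ define $$V_{n,{\bf t}}=\frac1n\sum_{m=1}^n m^2\boldsymbol\Delta_{{\bf t},m}\boldsymbol\Delta_{{\bf t},m}^T .$$ Then $\hat F_n\to\tilde F$ weakly $\mathbb P$-a.s.; $V_{n,{\bf t}}\to U_{\bf t}$ $\mathbb P$-a.s.; and, $\mathbb P$-a.s., the regular conditional distribution given $(X_1,\dots,X_n)$ of the ($\mathbb P$-a.e. measurable) random vector $$\sqrt n\;V_{n,{\bf t}}^{-1/2}\big[\tilde F(t_1)-P_n(t_1),\dots,\tilde F(t_k)-P_n(t_k)\big]^T$$ converges weakly, as $n\to\infty$, to the $k$-dimensional standard Gaussian distribution $\mathcal N_k(0,I)$.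 Here $V^{-1/2}$ is the inverse of the symmetric positive semidefinite square root of $V$ (by convention the zero matrix when $V$ is singular, which $\mathbb P$-a.s. happens for at most finitely many $n$). -/

import Mathlib

open MeasureTheory ProbabilityTheory Filter Topology
open scoped ENNReal

noncomputable section

namespace Predictive

/-! Random sequences are indexed from `0`: the observation usually written `X_{i+1}` is `X i`,
so that `(X_1, …, X_n)` is `(X 0, …, X (n - 1))` and `X_{n+1}` is `X n`. -/

variable {Ω : Type*}

/-- The data `X_{1:n} = (X_1, …, X_n)`, the first `n` terms of the sequence. -/
def firstN (X : ℕ → Ω → ℝ) (n : ℕ) (ω : Ω) : Fin n → ℝ := fun i => X i ω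

/-- The sigma-algebra generated by `X_1, …, X_n`. -/
abbrev pastSigma (X : ℕ → Ω → ℝ) (n : ℕ) : MeasurableSpace Ω :=
  MeasurableSpace.comap (firstN X n) inferInstance

/-- Conditionally identically distributed sequences: for all `n ≥ 1` and `k ≥ 1`,
`(X_1, …, X_n, X_{n+1})` and `(X_1, …, X_n, X_{n+k})` have the same law. -/
def IsCID [MeasurableSpace Ω] (X : ℕ → Ω → ℝ) (μ : Measure Ω) : Prop :=
  ∀ n k : ℕ, 1 ≤ n → 1 ≤ k →
    IdentDistrib (fun ω => (firstN X n ω, X n ω)) (fun ω => (firstN X n ω, X (n + k - 1) ω)) μ μ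

/-- `P` is a predictive rule of `X`: for each `n ≥ 0`, the kernel `P n` is a regular version of the
conditional distribution of `X_{n+1}` given `(X_1, …, X_n)`; in particular `P 0` is the law
of `X_1`. -/
def IsPredictiveRule [MeasurableSpace Ω] (X : ℕ → Ω → ℝ) (μ : Measure Ω)
    (P : ∀ n : ℕ, Kernel (Fin n → ℝ) ℝ) : Prop :=
  ∀ n : ℕ, HasCondDistrib (X n) (firstN X n) (P n) μ

/-- The predictive distribution function `P_n(t)`, as a random variable. -/
def predCDF (X : ℕ → Ω → ℝ) (P : ∀ n : ℕ, Kernel (Fin n → ℝ) ℝ) (n : ℕ) (t : ℝ) (ω : Ω) : ℝ :=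
  (P n (firstN X n ω)).real (Set.Iic t)

/-- The predictive update `Δ_{t,n} = P_n(t) - P_{n-1}(t)`, for `n ≥ 1`
(for `n = 0` this expression is `0`). -/
def update (X : ℕ → Ω → ℝ) (P : ∀ n : ℕ, Kernel (Fin n → ℝ) ℝ) (t : ℝ) (n : ℕ) (ω : Ω) : ℝ :=
  predCDF X P n t ω - predCDF X P (n - 1) t ω

/-- The column vector of updates `Δ_{𝐭,n}` at the points `t_1, …, t_k`. -/
def updateVec {k : ℕ} (X : ℕ → Ω → ℝ) (P : ∀ n : ℕ, Kernel (Fin n → ℝ) ℝ) (t : Fin k → ℝ)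
    (n : ℕ) (ω : Ω) : Fin k → ℝ := fun i => update X P (t i) n ω

/-- `V_{n,𝐭} = (1/n) ∑_{m=1}^n m² Δ_{𝐭,m} Δ_{𝐭,m}ᵀ`, for `n ≥ 1`. -/
def V {k : ℕ} (X : ℕ → Ω → ℝ) (P : ∀ n : ℕ, Kernel (Fin n → ℝ) ℝ) (t : Fin k → ℝ)
    (n : ℕ) (ω : Ω) : Matrix (Fin k) (Fin k) ℝ :=
  (1 / (n : ℝ)) • ∑ m ∈ Finset.Icc 1 n,
    (m : ℝ) ^ 2 • Matrix.vecMulVec (updateVec X P t m ω) (updateVec X P t m ω)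

open scoped MatrixOrder in
/-- `A^{-1/2}`, for a positive definite matrix `A`: the inverse of its symmetric positive definite
square root. -/
def invSqrt {k : ℕ} (A : Matrix (Fin k) (Fin k) ℝ) : Matrix (Fin k) (Fin k) ℝ :=
  (CFC.sqrt A)⁻¹

/-- The empirical distribution `F̂_{n+1} = (1/(n+1)) ∑_{i=1}^{n+1} δ_{X_i}` of the first `n + 1`
observations. -/
def empirical (X : ℕ → Ω → ℝ) (n : ℕ) (ω : Ω) : ProbabilityMeasure ℝ :=
  ⟨((n : ℝ≥0∞) + 1)⁻¹ • ∑ i ∈ Finset.range (n + 1), Measure.dirac (X i ω), ⟨by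
    simp only [Measure.smul_apply, Measure.finsetSum_apply, measure_univ, Finset.sum_const,
      Finset.card_range, smul_eq_mul, nsmul_eq_mul, mul_one, Nat.cast_add, Nat.cast_one]
    exact ENNReal.inv_mul_cancel (by simp) (by finiteness)⟩⟩

/-- The random distribution `F̃`: the weak limit of the empirical distributions. -/
def limitDist (X : ℕ → Ω → ℝ) (ω : Ω) : ProbabilityMeasure ℝ :=
  limUnder atTop (fun n => empirical X n ω)

/-- The limit distribution function `F̃(t)`, as a random variable. -/
def limitCDF (X : ℕ → Ω → ℝ) (t : ℝ) (ω : Ω) : ℝ :=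
  (limitDist X ω : Measure ℝ).real (Set.Iic t)

/-- The random vector `√n V_{n,𝐭}^{-1/2} (F̃(t_i) - P_n(t_i))_{i=1,…,k}`. -/
def scaledError {k : ℕ} (X : ℕ → Ω → ℝ) (P : ∀ n : ℕ, Kernel (Fin n → ℝ) ℝ) (t : Fin k → ℝ)
    (n : ℕ) (ω : Ω) : EuclideanSpace ℝ (Fin k) :=
  Real.sqrt n • WithLp.toLp 2
    ((invSqrt (V X P t n ω)).mulVec fun i => limitCDF X (t i) ω - predCDF X P n (t i) ω)

/-- A regular version of the conditional law of a random vector `Y` given `X_1, …, X_n`, evaluated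
at the observed data. -/
def condLaw {k : ℕ} [MeasurableSpace Ω] (X : ℕ → Ω → ℝ) (μ : Measure Ω) [IsFiniteMeasure μ]
    (Y : Ω → EuclideanSpace ℝ (Fin k)) (n : ℕ) (ω : Ω) :
    ProbabilityMeasure (EuclideanSpace ℝ (Fin k)) :=
  ⟨condDistrib Y (firstN X n) μ (firstN X n ω), inferInstance⟩

/-- The standard Gaussian distribution `𝒩_k(0, I)`. -/
def stdNormal (k : ℕ) : ProbabilityMeasure (EuclideanSpace ℝ (Fin k)) :=
  ⟨stdGaussian (EuclideanSpace ℝ (Fin k)), inferInstance⟩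

end Predictive

end

noncomputable section

namespace Predictive

/-! ### Deterministic lemmas -/

/-! For a c.i.d. sequence the tower property makes `n ↦ P_n(t)`, `n ≥ 1`, a bounded martingale
(`condExp_predCDF_succ`), so it converges almost surely. The strong law for the martingale
differences `f (X_j) - E[f (X_j) | past]` shows that empirical means have the same limits as
predictive means. With `f` a cosine or the indicator of a neighbourhood of infinity this gives
almost sure weak convergence of the empirical distributions. A monotone approximation of the
indicator of `(-∞, t]` then identifies the limit of `P_n(t)` as `F̃(t)`.

Hence `F̃(t) - P_n(t)` is the sum of the updates after time `n`. In a direction `u`, the scaled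
error is `√n` times the sum of these updates weighted by `V_n^{-1/2} u`, which is known at time `n`.
Since `n ∑_{m>n} m⁻² → 1`, its accumulated conditional variance tends to the quadratic form of `U`
at `U^{-1/2} u`, that is, to `‖u‖²` (`quadraticForm_invSqrt`). This constant limit is what the
self-normalisation by `V_n` buys: the Gaussian limit is not a mixture. The fourth-moment condition
gives both `V_n → U`, through the strong law, and the Lyapunov condition for the array.

The core is an almost sure conditional central limit theorem (`ae_tendsto_condExp_cos_array`). If
`A` is the accumulated conditional variance of a martingale `S`, then `cos (θ + S) * exp (A / 2)` is
a martingale up to an error controlled by fourth moments (`condExp_cos_le`). Stopping keeps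
everything bounded. The conditioning sigma-algebra moves with `n`, so errors are discarded by a
dominated convergence theorem along the filtration (`ae_tendsto_condExp_zero`). Truncating the
weights and cutting the infinite sum at a suitable finite horizon (`exists_horizon`) reduces the
error to such an array. Characteristic functions on a countable dense set, together with Chebyshev
tightness, then give weak convergence outside a single null set. -/

lemma cos_add_le_taylor (x d : ℝ) {δ : ℝ} (hδ : 0 < δ) :
    Real.cos (x + d) ≤ Real.cos x - Real.sin x * d - Real.cos x / 2 * d ^ 2
      + (δ * d ^ 2 + (1 / δ + 1) * d ^ 4) := by
  have hs : |d - Real.sin d| ≤ |d| ^ 3 / 6 := Real.abs_sub_sin_le d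
  have hc : |Real.cos d - 1 + d ^ 2 / 2| ≤ d ^ 4 := by
    have h1 : Real.cos d = 1 - 2 * Real.sin (d / 2) ^ 2 := by
      have := Real.cos_two_mul (d / 2)
      rw [mul_div_cancel₀ d two_ne_zero] at this
      rw [this, Real.cos_sq']; ring
    have h2 : Real.cos d - 1 + d ^ 2 / 2
        = 2 * (d / 2 - Real.sin (d / 2)) * (d / 2 + Real.sin (d / 2)) := by rw [h1]; ring
    rw [h2, abs_mul, abs_mul, abs_two]
    have h3 := Real.abs_sub_sin_le (d / 2)
    have h4 : |d / 2 + Real.sin (d / 2)| ≤ |d| := by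
      refine (abs_add_le _ _).trans ?_
      have := Real.abs_sin_le_abs (x := d / 2)
      rw [abs_div, abs_two] at *
      linarith
    calc 2 * |d / 2 - Real.sin (d / 2)| * |d / 2 + Real.sin (d / 2)|
        ≤ 2 * (|d / 2| ^ 3 / 6) * |d| := by gcongr
      _ = |d| ^ 4 / 24 := by rw [abs_div, abs_two]; ring
      _ ≤ |d| ^ 4 := by linarith [pow_nonneg (abs_nonneg d) 4]
      _ = d ^ 4 := by rw [show (4 : ℕ) = 2 * 2 by norm_num, pow_mul, sq_abs, ← pow_mul]
  -- The cubic Taylor error is traded for second and fourth powers, the only moments controlled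
  -- later; `δ` is chosen small before `n` tends to infinity.
  have hamgm : |d| ^ 3 ≤ δ * d ^ 2 + 1 / δ * d ^ 4 := by
    have h := mul_nonneg (sq_nonneg d) (sq_nonneg (δ - |d|))
    have h2 : |d| ^ 3 = d ^ 2 * |d| := by rw [← sq_abs d]; ring
    have h3 : d ^ 4 = d ^ 2 * |d| ^ 2 := by rw [sq_abs]; ring
    have h4 : δ * (δ * d ^ 2 + 1 / δ * d ^ 4 - |d| ^ 3) =
      d ^ 2 * (δ - |d|) ^ 2 + δ * (d ^ 2 * |d|) := by
      rw [h2, h3]; field_simp; ring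
    have h5 : 0 ≤ δ * (δ * d ^ 2 + 1 / δ * d ^ 4 - |d| ^ 3) := by rw [h4]; positivity
    linarith [nonneg_of_mul_nonneg_right h5 hδ]
  rw [Real.cos_add]
  have e1 : Real.cos x * (Real.cos d - 1 + d ^ 2 / 2) ≤ d ^ 4 := by
    refine (le_abs_self _).trans ?_
    rw [abs_mul]
    exact (mul_le_of_le_one_left (abs_nonneg _) (Real.abs_cos_le_one x)).trans hc
  have e2 : Real.sin x * (d - Real.sin d) ≤ |d| ^ 3 := by
    refine (le_abs_self _).trans ?_
    rw [abs_mul]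
    refine (mul_le_of_le_one_left (abs_nonneg _) (Real.abs_sin_le_one x)).trans (hs.trans ?_)
    linarith [pow_nonneg (abs_nonneg d) 3]
  linarith

/-- Since `exp x * (1 - x) ≤ 1 ≤ exp x * (1 - x + x ^ 2)`, the compensating factor `exp x` undoes `1
- x` up to second order, for `c` of either sign. Used with `x` half a conditional variance and `c` a
cosine. -/
lemma exp_mul_one_sub_mul_le {x : ℝ} (hx : 0 ≤ x) {c : ℝ} (hc : |c| ≤ 1) :
    Real.exp x * (c * (1 - x)) ≤ c + Real.exp x * x ^ 2 := by
  have h1 : Real.exp x * (1 - x) ≤ 1 := by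
    have := Real.one_sub_le_exp_neg x
    calc Real.exp x * (1 - x) ≤ Real.exp x * Real.exp (-x) := by gcongr
      _ = 1 := by rw [← Real.exp_add]; simp
  have h2 : 1 ≤ Real.exp x * (1 - x + x ^ 2) := by
    have h3 := Real.add_one_le_exp x
    have h4 : 0 ≤ 1 - x + x ^ 2 := by nlinarith [sq_nonneg (x - 1 / 2)]
    calc (1 : ℝ) ≤ (x + 1) * (1 - x + x ^ 2) := by nlinarith [pow_nonneg hx 3]
      _ ≤ _ := by gcongr
  have h5 := abs_le.1 hc
  nlinarith [mul_nonneg (by linarith : 0 ≤ 1 + c) (by linarith : 0 ≤ 1 - Real.exp x * (1 - x))]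

/-- Kronecker's lemma for the weights `1 / (i + 1)`. -/
lemma tendsto_average_zero_of_tendsto_sum_div {d : ℕ → ℝ} {s : ℝ}
    (h : Tendsto (fun n : ℕ => ∑ i ∈ Finset.range n, d i / ((i : ℝ) + 1)) atTop (𝓝 s)) :
    Tendsto (fun n : ℕ => (n : ℝ)⁻¹ * ∑ i ∈ Finset.range n, d i) atTop (𝓝 0) := by
  set S : ℕ → ℝ := fun n => ∑ i ∈ Finset.range n, d i / ((i : ℝ) + 1) with hS
  -- Summation by parts: after division by `n`, the right side is `S n` minus its own Cesàro mean,
  -- and both tend to `s`.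
  have key : ∀ n : ℕ, ∑ i ∈ Finset.range n, d i = n * S n - ∑ i ∈ Finset.range n, S i := by
    intro n
    induction n with
    | zero => simp
    | succ n ih =>
      have h1 : S (n + 1) = S n + d n / ((n : ℝ) + 1) := by simp [hS, Finset.sum_range_succ]
      rw [Finset.sum_range_succ, ih, Finset.sum_range_succ, h1]
      have : (n : ℝ) + 1 ≠ 0 := by positivity
      push_cast
      field_simp
      ring
  have h2 : Tendsto (fun n : ℕ => S n - (n : ℝ)⁻¹ * ∑ i ∈ Finset.range n, S i) atTop
      (𝓝 (s - s)) := h.sub h.cesaro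
  rw [sub_self] at h2
  refine h2.congr' ?_
  filter_upwards [eventually_gt_atTop 0] with n hn
  have : (n : ℝ) ≠ 0 := by positivity
  rw [key]
  field_simp

/-- Both bounds telescope from `1/m - 1/(m+1) ≤ 1/m² ≤ 1/(m-1) - 1/m` with `m = n + j + 1`. -/
lemma sum_inv_sq_bounds {n N : ℕ} (hn : 0 < n) :
    1 / ((n : ℝ) + 1) - 1 / ((n : ℝ) + N + 1) ≤ ∑ j ∈ Finset.range N, 1 / ((n : ℝ) + j + 1) ^ 2 ∧
      ∑ j ∈ Finset.range N, 1 / ((n : ℝ) + j + 1) ^ 2 ≤ 1 / (n : ℝ) - 1 / ((n : ℝ) + N) := by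
  have hn' : (0 : ℝ) < n := by exact_mod_cast hn
  induction N with
  | zero => simp
  | succ N ih =>
    have hx : (0 : ℝ) < n + N := by positivity
    rw [Finset.sum_range_succ]
    push_cast
    constructor
    · have : 1 / ((n : ℝ) + N + 1) - 1 / (n + (N + 1) + 1) ≤ 1 / ((n : ℝ) + N + 1) ^ 2 := by
        rw [div_sub_div _ _ (by positivity) (by positivity), div_le_div_iff₀ (by positivity)
          (by positivity)]
        nlinarith
      linarith [ih.1]
    · have : 1 / ((n : ℝ) + N + 1) ^ 2 ≤ 1 / ((n : ℝ) + N) - 1 / (n + (N + 1)) := by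
        rw [div_sub_div _ _ (by positivity) (by positivity), div_le_div_iff₀ (by positivity)
          (by positivity)]
        nlinarith
      linarith [ih.2]

/-- A horizon of at least `n ^ 2` makes the boundary term `n / (n + N n + 1)` of the telescoped
lower bound at most `1 / (n + 1)`. -/
lemma tendsto_mul_sum_inv_sq {N : ℕ → ℕ} (hN : ∀ n, n ^ 2 ≤ N n) :
    Tendsto (fun n : ℕ => ∑ j ∈ Finset.range (N n), (n : ℝ) / ((n : ℝ) + j + 1) ^ 2) atTop
      (𝓝 1) := by
  have h1 : Tendsto (fun n : ℕ => (n : ℝ) / (n + 1) - 1 / (n + 1)) atTop (𝓝 1) := by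
    have a := tendsto_natCast_div_add_atTop (1 : ℝ)
    have b := tendsto_one_div_add_atTop_nhds_zero_nat (𝕜 := ℝ)
    simpa using a.sub b
  refine tendsto_of_tendsto_of_tendsto_of_le_of_le' h1 tendsto_const_nhds ?_ ?_
  · filter_upwards [eventually_gt_atTop 0] with n hn
    have hn' : (0 : ℝ) < n := by exact_mod_cast hn
    have h := (sum_inv_sq_bounds (N := N n) hn).1
    have hN' : (n : ℝ) ^ 2 ≤ N n := by exact_mod_cast hN n
    have h2 : (n : ℝ) * (1 / (n + N n + 1)) ≤ 1 / (n + 1) := by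
      rw [mul_one_div, div_le_div_iff₀ (by positivity) (by positivity)]
      nlinarith
    simp_rw [div_eq_mul_one_div (n : ℝ), ← Finset.mul_sum]
    have := mul_le_mul_of_nonneg_left h hn'.le
    rw [mul_sub] at this
    linarith
  · filter_upwards [eventually_gt_atTop 0] with n hn
    have hn' : (0 : ℝ) < n := by exact_mod_cast hn
    have h := (sum_inv_sq_bounds (N := N n) hn).2
    simp_rw [div_eq_mul_one_div (n : ℝ), ← Finset.mul_sum]
    calc (n : ℝ) * ∑ j ∈ Finset.range (N n), 1 / ((n : ℝ) + j + 1) ^ 2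
        ≤ n * (1 / n) := by
          refine mul_le_mul_of_nonneg_left (h.trans ?_) hn'.le
          have : (0 : ℝ) ≤ 1 / (n + N n) := by positivity
          linarith
      _ = 1 := by field_simp

/-- Averages of the tail of a convergent sequence, with weights `n / (n + j + 1)²`. -/
lemma tendsto_sum_inv_sq_mul {N : ℕ → ℕ} (hN : ∀ n, n ^ 2 ≤ N n) {h : ℕ → ℝ} {l : ℝ}
    (hh : Tendsto h atTop (𝓝 l)) :
    Tendsto (fun n : ℕ => ∑ j ∈ Finset.range (N n), (n : ℝ) / ((n : ℝ) + j + 1) ^ 2 * h (n + j))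
      atTop (𝓝 l) := by
  have h1 := tendsto_mul_sum_inv_sq hN
  have h2 : Tendsto (fun n : ℕ => ∑ j ∈ Finset.range (N n),
      (n : ℝ) / ((n : ℝ) + j + 1) ^ 2 * (h (n + j) - l)) atTop (𝓝 0) := by
    rw [Metric.tendsto_atTop] at hh ⊢
    intro ε hε
    obtain ⟨n₀, hn₀⟩ := hh (ε / 2) (by positivity)
    obtain ⟨n₁, hn₁⟩ := eventually_atTop.1 (h1.eventually (gt_mem_nhds (by norm_num : (1 : ℝ) < 3 / 2)))
    refine ⟨max n₀ n₁, fun n hn => ?_⟩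
    rw [Real.dist_eq, sub_zero]
    calc |∑ j ∈ Finset.range (N n), (n : ℝ) / ((n : ℝ) + j + 1) ^ 2 * (h (n + j) - l)|
        ≤ ∑ j ∈ Finset.range (N n), (n : ℝ) / ((n : ℝ) + j + 1) ^ 2 * (ε / 2) := by
          refine (Finset.abs_sum_le_sum_abs _ _).trans (Finset.sum_le_sum fun j _ => ?_)
          rw [abs_mul, abs_of_nonneg (by positivity)]
          have := hn₀ (n + j) (le_trans (le_max_left _ _) (hn.trans (Nat.le_add_right _ _)))
          rw [Real.dist_eq] at this
          gcongr
      _ < ε := by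
          rw [← Finset.sum_mul]
          have := hn₁ n ((le_max_right _ _).trans hn)
          nlinarith
  have h3 := h2.add (h1.mul_const l)
  rw [zero_add, one_mul] at h3
  refine h3.congr fun n => ?_
  rw [Finset.sum_mul, ← Finset.sum_add_distrib]
  exact Finset.sum_congr rfl fun j _ => by ring

/-- A tight sequence of probability measures whose characteristic functions converge on a dense
set to the characteristic function of a probability measure converges weakly to it. -/
lemma tendsto_of_tendsto_charFun_of_dense {E : Type*} [NormedAddCommGroup E]
    [InnerProductSpace ℝ E] [FiniteDimensional ℝ E] [MeasurableSpace E] [BorelSpace E]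
    {ν : ℕ → ProbabilityMeasure E} {ν₀ : ProbabilityMeasure E} {D : Set E} (hD : Dense D)
    (hchar : ∀ u ∈ D, Tendsto (fun n => charFun (ν n : Measure E) u) atTop
      (𝓝 (charFun (ν₀ : Measure E) u)))
    (htight : ∀ ε > 0, ∃ R : ℝ, ∀ᶠ n in atTop, (ν n : Measure E).real {y | R < ‖y‖} ≤ ε) :
    Tendsto ν atTop (𝓝 ν₀) := by
  refine ProbabilityMeasure.tendsto_of_tendsto_charFun fun u => ?_
  -- A characteristic function is `|R|`-Lipschitz up to twice the mass outside the ball of radius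
  -- `R`. Tightness makes this uniform in the sequence, so convergence passes from a nearby point of
  -- `D` to `u`.
  have hlip : ∀ (m : ProbabilityMeasure E) (R : ℝ) (v w : E),
      ‖charFun (m : Measure E) v - charFun (m : Measure E) w‖
        ≤ |R| * ‖v - w‖ + 2 * (m : Measure E).real {y | R < ‖y‖} := by
    intro m R v w
    have hint : ∀ v : E, Integrable (fun y => Complex.exp (inner ℝ y v * Complex.I))
        (m : Measure E) := by
      intro v
      refine (integrable_const (1 : ℝ)).mono' (by fun_prop) (Eventually.of_forall fun y => ?_)
      rw [Complex.norm_exp_ofReal_mul_I]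
    have hmeas : MeasurableSet {y : E | R < ‖y‖} := measurableSet_lt measurable_const measurable_norm
    rw [charFun_apply, charFun_apply, ← integral_sub (hint v) (hint w)]
    refine (norm_integral_le_integral_norm _).trans ?_
    have hb : ∀ y : E, ‖Complex.exp (inner ℝ y v * Complex.I)
        - Complex.exp (inner ℝ y w * Complex.I)‖
        ≤ |R| * ‖v - w‖ + Set.indicator {y : E | R < ‖y‖} (fun _ => (2 : ℝ)) y := by
      intro y
      by_cases hy : R < ‖y‖
      · rw [Set.indicator_of_mem (by exact hy)]
        refine (norm_sub_le _ _).trans ?_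
        rw [Complex.norm_exp_ofReal_mul_I, Complex.norm_exp_ofReal_mul_I]
        have : 0 ≤ |R| * ‖v - w‖ := by positivity
        linarith
      · rw [Set.indicator_of_notMem (by exact hy), add_zero]
        have h1 : Complex.exp (inner ℝ y v * Complex.I) - Complex.exp (inner ℝ y w * Complex.I)
            = Complex.exp (inner ℝ y w * Complex.I)
              * (Complex.exp (Complex.I * (inner ℝ y (v - w) : ℝ)) - 1) := by
          rw [mul_sub, ← Complex.exp_add, inner_sub_right, mul_one]
          congr 2
          push_cast
          ring
        rw [h1, norm_mul, Complex.norm_exp_ofReal_mul_I, one_mul]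
        refine Real.norm_exp_I_mul_ofReal_sub_one_le.trans ?_
        refine (norm_inner_le_norm _ _).trans ?_
        gcongr
        exact (not_lt.1 hy).trans (le_abs_self R)
    have hI : Integrable (Set.indicator {y : E | R < ‖y‖} (fun _ => (2 : ℝ))) (m : Measure E) :=
      (integrable_const 2).indicator hmeas
    refine (integral_mono ((hint v).sub (hint w)).norm ((integrable_const _).add hI) hb).trans ?_
    rw [integral_add' (integrable_const _) hI, integral_const, integral_indicator hmeas,
      setIntegral_const]
    simp [mul_comm]
  rw [Metric.tendsto_atTop]
  intro ε hε
  obtain ⟨R, hR⟩ := htight (ε / 16) (by positivity)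
  obtain ⟨R', hR'⟩ : ∃ R' : ℝ, R ≤ R' ∧ (ν₀ : Measure E).real {y | R' < ‖y‖} ≤ ε / 16 := by
    have hT : IsTightMeasureSet {(ν₀ : Measure E)} := isTightMeasureSet_singleton
    have h1 := tendsto_measure_norm_gt_of_isTightMeasureSet hT
    simp only [Set.mem_singleton_iff, iSup_iSup_eq_left] at h1
    have h2 := (ENNReal.tendsto_toReal ENNReal.zero_ne_top).comp h1
    have h3 : ∀ᶠ r : ℝ in atTop, (ν₀ : Measure E).real {y | r < ‖y‖} < ε / 16 :=
      h2.eventually (gt_mem_nhds (by simp; positivity))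
    obtain ⟨r, hr1, hr2⟩ := (h3.and (eventually_ge_atTop R)).exists
    exact ⟨r, hr2, hr1.le⟩
  have hνR : ∀ᶠ n in atTop, (ν n : Measure E).real {y | R' < ‖y‖} ≤ ε / 16 := by
    filter_upwards [hR] with n hn
    exact (measureReal_mono fun y (hy : R' < ‖y‖) => lt_of_le_of_lt hR'.1 hy).trans hn
  obtain ⟨v, hvD, hv⟩ := hD.exists_dist_lt u (ε := ε / (8 * (|R'| + 1))) (by positivity)
  have hv' : |R'| * ‖u - v‖ ≤ ε / 8 := by
    rw [dist_eq_norm] at hv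
    calc |R'| * ‖u - v‖ ≤ (|R'| + 1) * (ε / (8 * (|R'| + 1))) := by gcongr; linarith
      _ = ε / 8 := by field_simp
  have hc := Metric.tendsto_atTop.1 (hchar v hvD) (ε / 4) (by positivity)
  obtain ⟨n₀, hn₀⟩ := hc
  obtain ⟨n₁, hn₁⟩ := eventually_atTop.1 hνR
  refine ⟨max n₀ n₁, fun n hn => ?_⟩
  have a1 := hlip (ν n) R' u v
  have a2 := hlip ν₀ R' v u
  have a3 := hn₀ n ((le_max_left _ _).trans hn)
  have a4 := hn₁ n ((le_max_right _ _).trans hn)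
  rw [norm_sub_rev v u] at a2
  rw [dist_eq_norm] at a3 ⊢
  calc ‖charFun (ν n : Measure E) u - charFun (ν₀ : Measure E) u‖
      = ‖(charFun (ν n : Measure E) u - charFun (ν n : Measure E) v)
        + (charFun (ν n : Measure E) v - charFun (ν₀ : Measure E) v)
        + (charFun (ν₀ : Measure E) v - charFun (ν₀ : Measure E) u)‖ := by congr 1; ring
    _ ≤ _ := norm_add₃_le
    _ < ε := by linarith [hR'.2]

/-! ### Conditional expectations of bounded random variables -/

section CondExp

variable {Ω : Type*} {m0 : MeasurableSpace Ω} {μ : Measure Ω}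

/-- Almost surely bounded real random variables. -/
def AEBdd (μ : Measure Ω) (f : Ω → ℝ) : Prop := ∃ C : ℝ, ∀ᵐ ω ∂μ, |f ω| ≤ C

lemma AEBdd.of_le {f : Ω → ℝ} (C : ℝ) (h : ∀ ω, |f ω| ≤ C) : AEBdd μ f :=
  ⟨C, Eventually.of_forall h⟩

lemma AEBdd.const (c : ℝ) : AEBdd μ fun _ => c := AEBdd.of_le |c| fun _ => le_rfl

lemma AEBdd.mul {f g : Ω → ℝ} (hf : AEBdd μ f) (hg : AEBdd μ g) :
    AEBdd μ fun ω => f ω * g ω := by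
  obtain ⟨C, hC⟩ := hf
  obtain ⟨D, hD⟩ := hg
  refine ⟨C * D, ?_⟩
  filter_upwards [hC, hD] with ω h1 h2
  rw [abs_mul]
  exact mul_le_mul h1 h2 (abs_nonneg _) ((abs_nonneg _).trans h1)

lemma AEBdd.add {f g : Ω → ℝ} (hf : AEBdd μ f) (hg : AEBdd μ g) :
    AEBdd μ fun ω => f ω + g ω := by
  obtain ⟨C, hC⟩ := hf
  obtain ⟨D, hD⟩ := hg
  refine ⟨C + D, ?_⟩
  filter_upwards [hC, hD] with ω h1 h2
  exact (abs_add_le _ _).trans (add_le_add h1 h2)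

lemma AEBdd.neg {f : Ω → ℝ} (hf : AEBdd μ f) : AEBdd μ fun ω => -f ω := by
  obtain ⟨C, hC⟩ := hf
  exact ⟨C, by simpa using hC⟩

lemma AEBdd.sub {f g : Ω → ℝ} (hf : AEBdd μ f) (hg : AEBdd μ g) :
    AEBdd μ fun ω => f ω - g ω := by
  simpa [sub_eq_add_neg] using hf.add hg.neg

lemma AEBdd.pow {f : Ω → ℝ} (hf : AEBdd μ f) (n : ℕ) : AEBdd μ fun ω => f ω ^ n := by
  obtain ⟨C, hC⟩ := hf
  refine ⟨C ^ n, ?_⟩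
  filter_upwards [hC] with ω h
  rw [abs_pow]
  gcongr

lemma AEBdd.sum {ι : Type*} {f : ι → Ω → ℝ} (s : Finset ι) (hf : ∀ i ∈ s, AEBdd μ (f i)) :
    AEBdd μ fun ω => ∑ i ∈ s, f i ω := by
  classical
  induction s using Finset.induction_on with
  | empty => simpa using AEBdd.const 0
  | insert i s hi ih =>
    simp_rw [Finset.sum_insert hi]
    exact (hf i (Finset.mem_insert_self i s)).add
      (ih fun j hj => hf j (Finset.mem_insert_of_mem hj))

lemma AEBdd.condExp {f : Ω → ℝ} (hf : AEBdd μ f) (m : MeasurableSpace Ω) : AEBdd μ (μ[f | m]) := by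
  obtain ⟨C, hC⟩ := hf
  exact ⟨C, ae_bdd_abs_condExp_of_ae_bdd_abs hC⟩

lemma condExp_mul_left_of_bdd {m : MeasurableSpace Ω} {g f : Ω → ℝ}
    (hm : m ≤ m0) (hg : StronglyMeasurable[m] g) (hgb : AEBdd μ g) (hf : Integrable f μ) :
    μ[fun ω => g ω * f ω | m] =ᵐ[μ] fun ω => g ω * (μ[f | m]) ω := by
  obtain ⟨C, hC⟩ := hgb
  exact condExp_mul_of_stronglyMeasurable_left hg (hf.bdd_mul (hg.mono hm).aestronglyMeasurable hC) hf

lemma ae_summable_of_summable_integral {f : ℕ → Ω → ℝ} (hf : ∀ n, Integrable (f n) μ)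
    (hnn : ∀ n, 0 ≤ᵐ[μ] f n) (hs : Summable fun n => ∫ ω, f n ω ∂μ) :
    ∀ᵐ ω ∂μ, Summable fun n => f n ω := by
  have h1 : ∫⁻ ω, ∑' n, ENNReal.ofReal (f n ω) ∂μ ≠ ∞ := by
    rw [lintegral_tsum fun n => (hf n).aemeasurable.ennreal_ofReal]
    simp_rw [← ofReal_integral_eq_lintegral_ofReal (hf _) (hnn _)]
    exact hs.tsum_ofReal_ne_top
  have h2 := ae_lt_top' (AEMeasurable.tsum fun n => (hf n).aemeasurable.ennreal_ofReal) h1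
  filter_upwards [h2, ae_all_iff.2 hnn] with ω h3 h4
  have h5 := ENNReal.summable_toReal h3.ne
  exact h5.congr fun n => (ENNReal.toReal_ofReal (h4 n))

lemma ae_tendsto_zero_of_antitone {f : ℕ → Ω → ℝ} (hf : ∀ n, Integrable (f n) μ)
    (hnn : ∀ n, 0 ≤ᵐ[μ] f n) (hanti : ∀ n, f (n + 1) ≤ᵐ[μ] f n)
    (hlim : Tendsto (fun n => ∫ ω, f n ω ∂μ) atTop (𝓝 0)) :
    ∀ᵐ ω ∂μ, Tendsto (fun n => f n ω) atTop (𝓝 0) := by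
  refine tendsto_of_integral_tendsto_of_antitone hf (integrable_zero _ _ _)
    (by simpa using hlim) ?_ ?_
  · filter_upwards [ae_all_iff.2 hanti] with ω h using antitone_nat_of_succ_le h
  · filter_upwards [ae_all_iff.2 hnn] with ω h using h

variable [IsProbabilityMeasure μ]

lemma AEBdd.integrable {f : Ω → ℝ} (hf : AEBdd μ f) (hm : AEStronglyMeasurable f μ) :
    Integrable f μ := by
  obtain ⟨C, hC⟩ := hf
  exact Integrable.of_bound hm C hC

/-- The conditional expectation of a polynomial `g₀ + g₁ d + g₂ d² + g₃ d⁴` of a centred bounded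
variable `d`, with coefficients in the conditioning sigma-algebra. -/
lemma condExp_quartic {m : MeasurableSpace Ω} (hm : m ≤ m0) {d a b g₀ g₁ g₂ g₃ : Ω → ℝ}
    (hd : AEStronglyMeasurable[m0] d μ) (hdb : AEBdd μ d) (h0 : μ[d | m] =ᵐ[μ] 0)
    (ha : μ[fun ω => d ω ^ 2 | m] =ᵐ[μ] a) (hb : μ[fun ω => d ω ^ 4 | m] =ᵐ[μ] b)
    (hg₀ : StronglyMeasurable[m] g₀) (hg₁ : StronglyMeasurable[m] g₁)
    (hg₂ : StronglyMeasurable[m] g₂) (hg₃ : StronglyMeasurable[m] g₃)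
    (hb₀ : AEBdd μ g₀) (hb₁ : AEBdd μ g₁) (hb₂ : AEBdd μ g₂) (hb₃ : AEBdd μ g₃) :
    μ[fun ω => g₀ ω + g₁ ω * d ω + g₂ ω * d ω ^ 2 + g₃ ω * d ω ^ 4 | m]
      =ᵐ[μ] fun ω => g₀ ω + g₂ ω * a ω + g₃ ω * b ω := by
  have i1 : Integrable d μ := hdb.integrable hd
  have i2 : Integrable (fun ω => d ω ^ 2) μ := (hdb.pow 2).integrable (hd.pow 2)
  have i4 : Integrable (fun ω => d ω ^ 4) μ := (hdb.pow 4).integrable (hd.pow 4)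
  have j0 : Integrable g₀ μ := hb₀.integrable (hg₀.mono hm).aestronglyMeasurable
  have j1 : Integrable (fun ω => g₁ ω * d ω) μ :=
    (hb₁.mul hdb).integrable ((hg₁.mono hm).aestronglyMeasurable.mul hd)
  have j2 : Integrable (fun ω => g₂ ω * d ω ^ 2) μ :=
    (hb₂.mul (hdb.pow 2)).integrable ((hg₂.mono hm).aestronglyMeasurable.mul (hd.pow 2))
  have j4 : Integrable (fun ω => g₃ ω * d ω ^ 4) μ :=
    (hb₃.mul (hdb.pow 4)).integrable ((hg₃.mono hm).aestronglyMeasurable.mul (hd.pow 4))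
  have e1 := condExp_add ((j0.add j1).add j2) j4 m
  have e2 := condExp_add (j0.add j1) j2 m
  have e3 := condExp_add j0 j1 m
  have e0 : μ[g₀ | m] = g₀ := condExp_of_stronglyMeasurable hm hg₀ j0
  filter_upwards [e1, e2, e3, condExp_mul_left_of_bdd hm hg₁ hb₁ i1,
    condExp_mul_left_of_bdd hm hg₂ hb₂ i2, condExp_mul_left_of_bdd hm hg₃ hb₃ i4, h0, ha, hb]
    with ω k1 k2 k3 k4 k5 k6 k7 k8 k9
  refine (k1.trans ?_)
  simp only [Pi.add_apply] at k1 k2 k3 ⊢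
  rw [k2, k3, k4, k5, k6, k7, k8, k9, e0]
  simp

/-- Conditional Jensen, read off from `0 ≤ E[(d² - a)² | m] = b - a²`, where `a` counts as a known
coefficient. -/
lemma sq_condExp_sq_le {m : MeasurableSpace Ω} (hm : m ≤ m0) {d a b : Ω → ℝ}
    (hd : AEStronglyMeasurable[m0] d μ) (hdb : AEBdd μ d) (h0 : μ[d | m] =ᵐ[μ] 0)
    (ha : μ[fun ω => d ω ^ 2 | m] =ᵐ[μ] a) (hb : μ[fun ω => d ω ^ 4 | m] =ᵐ[μ] b)
    (ham : StronglyMeasurable[m] a) : ∀ᵐ ω ∂μ, a ω ^ 2 ≤ b ω := by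
  have hab : AEBdd μ a := by
    obtain ⟨C, hC⟩ := (hdb.pow 2).condExp m
    refine ⟨C, ?_⟩
    filter_upwards [hC, ha] with ω h1 h2
    rwa [← h2]
  have h := condExp_quartic hm hd hdb h0 ha hb (ham.pow 2) (g₁ := fun _ => 0)
    stronglyMeasurable_const (g₂ := fun ω => (-2) * a ω) (ham.const_mul _) (g₃ := fun _ => 1)
    stronglyMeasurable_const (hab.pow 2) (AEBdd.const 0) ((AEBdd.const (-2)).mul hab)
    (AEBdd.const 1)
  have hnn : 0 ≤ᵐ[μ] μ[fun ω => (a ^ 2) ω + (fun _ => (0 : ℝ)) ω * d ω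
      + (fun ω => (-2) * a ω) ω * d ω ^ 2 + (fun _ => (1 : ℝ)) ω * d ω ^ 4 | m] := by
    refine condExp_nonneg (Eventually.of_forall fun ω => ?_)
    simp only [Pi.zero_apply, Pi.pow_apply]
    nlinarith [sq_nonneg (d ω ^ 2 - a ω)]
  filter_upwards [h, hnn] with ω h1 h2
  rw [h1] at h2
  simp only [Pi.zero_apply, Pi.pow_apply] at h2
  nlinarith

/-- The one-step drift bounds are summed by the tower property. -/
lemma condExp_le_add_sum (ℱ : Filtration ℕ m0) {Z β : ℕ → Ω → ℝ}
    (hZm : StronglyMeasurable[ℱ 0] (Z 0)) (hZ : ∀ j, Integrable (Z j) μ)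
    (hβ : ∀ j, Integrable (β j) μ)
    (hstep : ∀ j, μ[Z (j + 1) | ℱ j] ≤ᵐ[μ] fun ω => Z j ω + β j ω) (N : ℕ) :
    μ[Z N | ℱ 0] ≤ᵐ[μ]
      fun ω => Z 0 ω + (μ[fun ω' => ∑ j ∈ Finset.range N, β j ω' | ℱ 0]) ω := by
  induction N with
  | zero =>
    rw [condExp_of_stronglyMeasurable (ℱ.le 0) hZm (hZ 0)]
    simp only [Finset.range_zero, Finset.sum_empty]
    rw [condExp_const (ℱ.le 0) (0 : ℝ)]
    exact Eventually.of_forall fun ω => by simp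
  | succ N ih =>
    have hs : Integrable (fun ω' => ∑ j ∈ Finset.range N, β j ω') μ :=
      integrable_finsetSum _ fun j _ => hβ j
    have h1 : μ[Z (N + 1) | ℱ 0] =ᵐ[μ] μ[μ[Z (N + 1) | ℱ N] | ℱ 0] :=
      (condExp_condExp_of_le (ℱ.mono (Nat.zero_le N)) (ℱ.le N)).symm
    have h2 := condExp_mono (m := ℱ 0) integrable_condExp ((hZ N).add (hβ N)) (hstep N)
    have h3 := condExp_add (hZ N) (hβ N) (ℱ 0)
    have h4 := condExp_add hs (hβ N) (ℱ 0)
    have h5 : (fun ω' => ∑ j ∈ Finset.range (N + 1), β j ω')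
        = (fun ω' => ∑ j ∈ Finset.range N, β j ω') + β N := by
      funext ω; simp [Finset.sum_range_succ]
    rw [h5]
    filter_upwards [ih, h1, h2, h3, h4] with ω k k1 k2 k3 k4
    rw [k1, k4]
    refine k2.trans ?_
    rw [k3]
    simp only [Pi.add_apply]
    linarith

/-- Conditional dominated convergence along a filtration: if `Z n → 0` almost surely and the `Z n`
are uniformly bounded, then `E[Z n | ℱ n] → 0` almost surely. -/
lemma ae_tendsto_condExp_zero (ℱ : Filtration ℕ m0) {Z : ℕ → Ω → ℝ} {C : ℝ}
    (hZ : ∀ n, AEStronglyMeasurable (Z n) μ) (hb : ∀ n, ∀ᵐ ω ∂μ, |Z n ω| ≤ C)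
    (h0 : ∀ᵐ ω ∂μ, Tendsto (fun n => Z n ω) atTop (𝓝 0)) :
    ∀ᵐ ω ∂μ, Tendsto (fun n => (μ[Z n | ℱ n]) ω) atTop (𝓝 0) := by
  -- The tail supremum `Y N` dominates all later `Z`. For fixed `N`, Lévy's upward theorem gives
  -- `E[Y N | ℱ n] → E[Y N | ⨆ n, ℱ n]`; these limits decrease in `N` and have means tending to `0`,
  -- hence vanish almost surely in the limit.
  set Y : ℕ → Ω → ℝ := fun N ω => ⨆ m, |Z (N + m) ω| with hY
  have hball := ae_all_iff.2 hb
  have hbdd : ∀ᵐ ω ∂μ, ∀ N, BddAbove (Set.range fun m => |Z (N + m) ω|) := by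
    filter_upwards [hball] with ω h N
    exact ⟨C, by rintro _ ⟨m, rfl⟩; exact h _⟩
  have hYnn : ∀ N ω, 0 ≤ Y N ω := fun N ω => Real.iSup_nonneg fun m => abs_nonneg _
  have hYC : ∀ᵐ ω ∂μ, ∀ N, |Y N ω| ≤ C := by
    filter_upwards [hball] with ω h N
    rw [abs_of_nonneg (hYnn N ω)]
    exact ciSup_le fun m => h _
  have hYm : ∀ N, AEStronglyMeasurable (Y N) μ := by
    intro N
    refine AEMeasurable.aestronglyMeasurable ?_
    exact AEMeasurable.iSup fun m => (hZ (N + m)).aemeasurable.abs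
  have hYint : ∀ N, Integrable (Y N) μ := fun N =>
    Integrable.of_bound (hYm N) C (by filter_upwards [hYC] with ω h using h N)
  have hYlim : ∀ᵐ ω ∂μ, Tendsto (fun N => Y N ω) atTop (𝓝 0) := by
    filter_upwards [h0] with ω h
    rw [Metric.tendsto_atTop] at h ⊢
    intro ε hε
    obtain ⟨n₀, hn₀⟩ := h (ε / 2) (by positivity)
    refine ⟨n₀, fun n hn => ?_⟩
    rw [Real.dist_eq, sub_zero, abs_of_nonneg (hYnn n ω)]
    refine lt_of_le_of_lt (ciSup_le fun m => ?_) (half_lt_self hε)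
    have := hn₀ (n + m) (by omega)
    rw [Real.dist_eq, sub_zero] at this
    exact this.le
  have hYI : Tendsto (fun N => ∫ ω, Y N ω ∂μ) atTop (𝓝 0) := by
    have := tendsto_integral_of_dominated_convergence (μ := μ) (fun _ => C) hYm
      (integrable_const _) (fun N => by filter_upwards [hYC] with ω h using h N) hYlim
    simpa using this
  have hle : (⨆ n, ℱ n) ≤ m0 := iSup_le fun n => ℱ.le n
  have hW : ∀ᵐ ω ∂μ, Tendsto (fun N => (μ[Y N | ⨆ n, ℱ n]) ω) atTop (𝓝 0) := by
    refine ae_tendsto_zero_of_antitone (fun N => integrable_condExp)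
      (fun N => condExp_nonneg (Eventually.of_forall (hYnn N))) (fun N => ?_) ?_
    · refine condExp_mono (hYint _) (hYint _) ?_
      filter_upwards [hbdd] with ω h
      refine ciSup_le fun m => ?_
      have := le_ciSup (h N) (1 + m)
      simpa [add_assoc] using this
    · simpa only [integral_condExp hle] using hYI
  have hLevy : ∀ᵐ ω ∂μ, ∀ N, Tendsto (fun n => (μ[Y N | ℱ n]) ω) atTop
      (𝓝 ((μ[Y N | ⨆ n, ℱ n]) ω)) := ae_all_iff.2 fun N => tendsto_ae_condExp (Y N)
  have hdom : ∀ᵐ ω ∂μ, ∀ N m, |(μ[Z (N + m) | ℱ (N + m)]) ω| ≤ (μ[Y N | ℱ (N + m)]) ω := by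
    refine ae_all_iff.2 fun N => ae_all_iff.2 fun m => ?_
    have h1 := abs_condExp_ae_le_condExp_abs (μ := μ) (m := ℱ (N + m)) (Z (N + m))
    have h2 := condExp_mono (m := ℱ (N + m))
      (Integrable.of_bound (hZ (N + m)) C (hb (N + m))).abs (hYint N)
      (by filter_upwards [hbdd] with ω h using le_ciSup (h N) m)
    filter_upwards [h1, h2] with ω k1 k2 using k1.trans k2
  filter_upwards [hW, hLevy, hdom] with ω h1 h2 h3
  rw [Metric.tendsto_atTop]
  intro ε hε
  obtain ⟨N, hN⟩ := (h1.eventually (gt_mem_nhds hε)).exists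
  obtain ⟨n₀, hn₀⟩ := eventually_atTop.1 ((h2 N).eventually (gt_mem_nhds hN))
  refine ⟨max n₀ N, fun n hn => ?_⟩
  obtain ⟨m, rfl⟩ := Nat.exists_eq_add_of_le ((le_max_right _ _).trans hn)
  rw [Real.dist_eq, sub_zero]
  exact (h3 N m).trans_lt (hn₀ _ ((le_max_left _ _).trans hn))

/-- Strong law of large numbers for bounded martingale differences. -/
lemma ae_tendsto_average_martingaleDiff (ℱ : Filtration ℕ m0) {d : ℕ → Ω → ℝ}
    (hd : ∀ j, StronglyMeasurable[ℱ (j + 1)] (d j)) (hdb : ∀ j, AEBdd μ (d j))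
    (h0 : ∀ j, μ[d j | ℱ j] =ᵐ[μ] 0)
    (hs : Summable fun j : ℕ => (∫ ω, d j ω ^ 2 ∂μ) / ((j : ℝ) + 1) ^ 2) :
    ∀ᵐ ω ∂μ, Tendsto (fun n : ℕ => (n : ℝ)⁻¹ * ∑ i ∈ Finset.range n, d i ω) atTop (𝓝 0) := by
  -- The sums of `d j / (j + 1)` form a martingale bounded in `L²` by the assumed series; it
  -- converges, and Kronecker's lemma concludes.
  set e : ℕ → Ω → ℝ := fun j ω => d j ω / ((j : ℝ) + 1) with he
  set T : ℕ → Ω → ℝ := fun n ω => ∑ i ∈ Finset.range n, e i ω with hT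
  have hem : ∀ j, StronglyMeasurable[ℱ (j + 1)] (e j) := fun j => by
    simpa [he, div_eq_mul_inv] using (hd j).mul_const ((j : ℝ) + 1)⁻¹
  have heb : ∀ j, AEBdd μ (e j) := fun j => by
    simpa [he, div_eq_mul_inv] using (hdb j).mul (AEBdd.const ((j : ℝ) + 1)⁻¹)
  have hei : ∀ j, Integrable (e j) μ := fun j =>
    (heb j).integrable ((hem j).mono (ℱ.le _)).aestronglyMeasurable
  have he0 : ∀ j, μ[e j | ℱ j] =ᵐ[μ] 0 := by
    intro j
    have h1 : e j = ((j : ℝ) + 1)⁻¹ • d j := by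
      funext ω; simp [he, div_eq_inv_mul]
    rw [h1]
    filter_upwards [condExp_smul (μ := μ) (((j : ℝ) + 1)⁻¹) (d j) (ℱ j), h0 j] with ω k1 k2
    rw [k1]
    simp [k2]
  have hTm : ∀ n, StronglyMeasurable[ℱ n] (T n) := fun n =>
    Finset.stronglyMeasurable_fun_sum _ fun i hi =>
      (hem i).mono (ℱ.mono (Nat.succ_le_of_lt (Finset.mem_range.1 hi)))
  have hTb : ∀ n, AEBdd μ (T n) := fun n => AEBdd.sum _ fun i _ => heb i
  have hTi : ∀ n, Integrable (T n) μ := fun n =>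
    (hTb n).integrable ((hTm n).mono (ℱ.le _)).aestronglyMeasurable
  have hTsucc : ∀ n, T (n + 1) = T n + e n := fun n => by
    funext ω; simp [hT, Finset.sum_range_succ]
  have hmart : Martingale T ℱ μ := by
    refine martingale_nat hTm hTi fun n => ?_
    rw [hTsucc]
    have h1 : μ[T n | ℱ n] = T n := condExp_of_stronglyMeasurable (ℱ.le n) (hTm n) (hTi n)
    filter_upwards [condExp_add (hTi n) (hei n) (ℱ n), he0 n] with ω k1 k2
    rw [k1]
    simp [k2, h1]
  have hT2 : ∀ n, ∫ ω, T n ω ^ 2 ∂μ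
      = ∑ j ∈ Finset.range n, (∫ ω, d j ω ^ 2 ∂μ) / ((j : ℝ) + 1) ^ 2 := by
    intro n
    induction n with
    | zero => simp [hT]
    | succ n ih =>
      have i1 : Integrable (fun ω => T n ω ^ 2) μ :=
        ((hTb n).pow 2).integrable (((hTm n).mono (ℱ.le _)).aestronglyMeasurable.pow 2)
      have i2 : Integrable (fun ω => T n ω * e n ω) μ :=
        ((hTb n).mul (heb n)).integrable (((hTm n).mono (ℱ.le _)).aestronglyMeasurable.mul
          ((hem n).mono (ℱ.le _)).aestronglyMeasurable)
      have i3 : Integrable (fun ω => e n ω ^ 2) μ :=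
        ((heb n).pow 2).integrable (((hem n).mono (ℱ.le _)).aestronglyMeasurable.pow 2)
      have h1 : ∫ ω, T n ω * e n ω ∂μ = 0 := by
        rw [← integral_condExp (ℱ.le n)]
        refine integral_eq_zero_of_ae ?_
        filter_upwards [condExp_mul_left_of_bdd (ℱ.le n) (hTm n) (hTb n) (hei n), he0 n]
          with ω k1 k2
        rw [k1, k2]
        simp
      have h2 : ∫ ω, e n ω ^ 2 ∂μ = (∫ ω, d n ω ^ 2 ∂μ) / ((n : ℝ) + 1) ^ 2 := by
        simp_rw [he, div_pow]
        rw [integral_div]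
      rw [Finset.sum_range_succ, ← ih, ← h2]
      have h3 : (fun ω => T (n + 1) ω ^ 2)
          = fun ω => T n ω ^ 2 + (2 * (T n ω * e n ω) + e n ω ^ 2) := by
        funext ω; rw [hTsucc]; simp only [Pi.add_apply]; ring
      have i4 : Integrable (fun ω => 2 * (T n ω * e n ω) + e n ω ^ 2) μ := (i2.const_mul 2).add i3
      rw [h3, integral_add i1 i4, integral_add (i2.const_mul 2) i3, integral_const_mul, h1]
      simp
  set R : ℝ := 1 + ∑' j : ℕ, (∫ ω, d j ω ^ 2 ∂μ) / ((j : ℝ) + 1) ^ 2 with hR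
  have hterm : ∀ j : ℕ, 0 ≤ (∫ ω, d j ω ^ 2 ∂μ) / ((j : ℝ) + 1) ^ 2 := fun j =>
    div_nonneg (integral_nonneg fun ω => sq_nonneg _) (by positivity)
  have hbdd : ∀ n, eLpNorm (T n) 1 μ ≤ (R.toNNReal : ℝ≥0∞) := by
    intro n
    rw [eLpNorm_one_eq_lintegral_enorm]
    simp_rw [← ofReal_norm]
    rw [← ofReal_integral_eq_lintegral_ofReal (hTi n).norm
      (Eventually.of_forall fun ω => norm_nonneg _)]
    refine ENNReal.ofReal_le_ofReal ?_
    have i1 : Integrable (fun ω => T n ω ^ 2) μ :=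
      ((hTb n).pow 2).integrable (((hTm n).mono (ℱ.le _)).aestronglyMeasurable.pow 2)
    calc ∫ ω, ‖T n ω‖ ∂μ ≤ ∫ ω, (1 + T n ω ^ 2) ∂μ := by
          refine integral_mono (hTi n).norm ((integrable_const _).add i1) fun ω => ?_
          simp only [Real.norm_eq_abs]
          nlinarith [sq_nonneg (|T n ω| - 1), sq_abs (T n ω), abs_nonneg (T n ω)]
      _ = 1 + ∫ ω, T n ω ^ 2 ∂μ := by rw [integral_add (integrable_const _) i1]; simp
      _ ≤ R := by
          rw [hT2]
          have := hs.sum_le_tsum (Finset.range n) fun j _ => hterm j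
          linarith
  filter_upwards [hmart.submartingale.exists_ae_tendsto_of_bdd hbdd] with ω ⟨c, hc⟩
  exact tendsto_average_zero_of_tendsto_sum_div hc

end CondExp

/-! ### Bounds for martingales with bounded conditional variance -/

section Martingale

variable {Ω : Type*} {m0 : MeasurableSpace Ω} {μ : Measure Ω} [IsProbabilityMeasure μ]

/-- Given the past, the mean of `cos (θ + S + d)` is about `cos (θ + S) * (1 - a / 2)`, the sine
term vanishing because `d` is centred; multiplying by `exp (a / 2)` restores `cos (θ + S)`. An upper
bound is enough, because replacing `θ` by `θ + π` changes the sign. -/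
lemma condExp_cos_le (ℱ : Filtration ℕ m0) {d a b : ℕ → Ω → ℝ} {K : ℝ}
    (hd : ∀ j, StronglyMeasurable[ℱ (j + 1)] (d j)) (hdb : ∀ j, AEBdd μ (d j))
    (h0 : ∀ j, μ[d j | ℱ j] =ᵐ[μ] 0)
    (ha : ∀ j, μ[fun ω => d j ω ^ 2 | ℱ j] =ᵐ[μ] a j)
    (hb : ∀ j, μ[fun ω => d j ω ^ 4 | ℱ j] =ᵐ[μ] b j)
    (ham : ∀ j, StronglyMeasurable[ℱ j] (a j)) (ha0 : ∀ j ω, 0 ≤ a j ω)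
    (hb0 : ∀ j ω, 0 ≤ b j ω)
    (hK : ∀ N ω, ∑ j ∈ Finset.range N, a j ω ≤ K)
    {δ : ℝ} (hδ : 0 < δ) (θ : ℝ) (N : ℕ) :
    μ[fun ω => Real.cos (θ + ∑ j ∈ Finset.range N, d j ω)
        * Real.exp ((∑ j ∈ Finset.range N, a j ω) / 2) | ℱ 0]
      ≤ᵐ[μ] fun ω => Real.cos θ + (μ[fun ω' => ∑ j ∈ Finset.range N,
        Real.exp (K / 2) * (δ * a j ω' + (1 / δ + 2) * b j ω') | ℱ 0]) ω := by
  set S : ℕ → Ω → ℝ := fun N ω => ∑ j ∈ Finset.range N, d j ω with hS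
  set A : ℕ → Ω → ℝ := fun N ω => ∑ j ∈ Finset.range N, a j ω with hA
  have hSm : ∀ n, StronglyMeasurable[ℱ n] (S n) := fun n =>
    Finset.stronglyMeasurable_fun_sum _ fun i hi =>
      (hd i).mono (ℱ.mono (Nat.succ_le_of_lt (Finset.mem_range.1 hi)))
  -- Predictability: `A (n + 1)` is already known at time `n`, so its exponential can be pulled out
  -- of the conditional expectation.
  have hAm : ∀ n, StronglyMeasurable[ℱ n] (A (n + 1)) := fun n =>
    Finset.stronglyMeasurable_fun_sum _ fun i hi =>
      (ham i).mono (ℱ.mono (Nat.lt_succ_iff.1 (Finset.mem_range.1 hi)))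
  have hAm' : ∀ n, StronglyMeasurable[ℱ n] (A n) := fun n =>
    Finset.stronglyMeasurable_fun_sum _ fun i hi =>
      (ham i).mono (ℱ.mono (Finset.mem_range.1 hi).le)
  have hAe : ∀ n ω, Real.exp (A n ω / 2) ≤ Real.exp (K / 2) := fun n ω =>
    Real.exp_le_exp.2 (by linarith [hK n ω])
  have hA0 : ∀ n ω, 0 ≤ A n ω := fun n ω => Finset.sum_nonneg fun j _ => ha0 j ω
  have hexpm : ∀ n, StronglyMeasurable[ℱ n] fun ω => Real.exp (A (n + 1) ω / 2) := fun n =>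
    Real.continuous_exp.comp_stronglyMeasurable
      (by simpa [div_eq_mul_inv] using (hAm n).mul_const (2 : ℝ)⁻¹)
  have hexpm' : ∀ n, StronglyMeasurable[ℱ n] fun ω => Real.exp (A n ω / 2) := fun n =>
    Real.continuous_exp.comp_stronglyMeasurable
      (by simpa [div_eq_mul_inv] using (hAm' n).mul_const (2 : ℝ)⁻¹)
  have hexpb : ∀ n, AEBdd μ fun ω => Real.exp (A n ω / 2) := fun n =>
    AEBdd.of_le (Real.exp (K / 2)) fun ω => by rw [Real.abs_exp]; exact hAe n ω
  have hcosm : ∀ n, StronglyMeasurable[ℱ n] fun ω => Real.cos (θ + S n ω) := fun n =>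
    Real.continuous_cos.comp_stronglyMeasurable (stronglyMeasurable_const.add (hSm n))
  have hsinm : ∀ n, StronglyMeasurable[ℱ n] fun ω => Real.sin (θ + S n ω) := fun n =>
    Real.continuous_sin.comp_stronglyMeasurable (stronglyMeasurable_const.add (hSm n))
  have hcosb : ∀ n, AEBdd μ fun ω => Real.cos (θ + S n ω) := fun n =>
    AEBdd.of_le 1 fun ω => Real.abs_cos_le_one _
  have hsinb : ∀ n, AEBdd μ fun ω => Real.sin (θ + S n ω) := fun n =>
    AEBdd.of_le 1 fun ω => Real.abs_sin_le_one _
  have haint : ∀ j, Integrable (a j) μ := fun j => integrable_condExp.congr (ha j)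
  have hbint : ∀ j, Integrable (b j) μ := fun j => integrable_condExp.congr (hb j)
  have hQint : ∀ n, Integrable (fun ω => Real.cos (θ + S n ω) * Real.exp (A n ω / 2)) μ :=
    fun n => ((hcosb n).mul (hexpb n)).integrable
      (((hcosm n).mul (hexpm' n)).mono (ℱ.le n)).aestronglyMeasurable
  have key := condExp_le_add_sum (μ := μ) ℱ
    (Z := fun n ω => Real.cos (θ + S n ω) * Real.exp (A n ω / 2))
    (β := fun j ω => Real.exp (K / 2) * (δ * a j ω + (1 / δ + 2) * b j ω))
    ((hcosm 0).mul (hexpm' 0)) hQint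
    (fun j => (((haint j).const_mul δ).add ((hbint j).const_mul _)).const_mul _) ?_ N
  · simpa [hS, hA] using key
  intro n
  have hdm := ((hd n).mono (ℱ.le _)).aestronglyMeasurable (μ := μ)
  have hq := condExp_quartic (ℱ.le n) hdm (hdb n) (h0 n) (ha n) (hb n)
    (g₀ := fun ω => Real.exp (A (n + 1) ω / 2) * Real.cos (θ + S n ω))
    (g₁ := fun ω => Real.exp (A (n + 1) ω / 2) * (-Real.sin (θ + S n ω)))
    (g₂ := fun ω => Real.exp (A (n + 1) ω / 2) * (δ - Real.cos (θ + S n ω) * (1 / 2)))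
    (g₃ := fun ω => Real.exp (A (n + 1) ω / 2) * (1 / δ + 1))
    ((hexpm n).mul (hcosm n)) ((hexpm n).mul (hsinm n).neg)
    ((hexpm n).mul (stronglyMeasurable_const.sub ((hcosm n).mul_const _)))
    ((hexpm n).mul stronglyMeasurable_const)
    ((hexpb _).mul (hcosb n)) ((hexpb _).mul (hsinb n).neg)
    ((hexpb _).mul ((AEBdd.const δ).sub ((hcosb n).mul (AEBdd.const (1 / 2)))))
    ((hexpb _).mul (AEBdd.const _))
  have hint : Integrable (fun ω =>
      Real.exp (A (n + 1) ω / 2) * Real.cos (θ + S n ω)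
      + Real.exp (A (n + 1) ω / 2) * (-Real.sin (θ + S n ω)) * d n ω
      + Real.exp (A (n + 1) ω / 2) * (δ - Real.cos (θ + S n ω) * (1 / 2)) * d n ω ^ 2
      + Real.exp (A (n + 1) ω / 2) * (1 / δ + 1) * d n ω ^ 4) μ := by
    refine AEBdd.integrable ?_ ?_
    · exact (((((hexpb _).mul (hcosb n)).add (((hexpb _).mul (hsinb n).neg).mul (hdb n))).add
        (((hexpb _).mul ((AEBdd.const δ).sub ((hcosb n).mul (AEBdd.const (1 / 2))))).mul
          ((hdb n).pow 2))).add (((hexpb _).mul (AEBdd.const _)).mul ((hdb n).pow 4)))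
    · have e1 := ((hexpm n).mono (ℱ.le n)).aestronglyMeasurable (μ := μ)
      have e2 := ((hcosm n).mono (ℱ.le n)).aestronglyMeasurable (μ := μ)
      have e3 := ((hsinm n).mono (ℱ.le n)).aestronglyMeasurable (μ := μ)
      exact (((e1.mul e2).add ((e1.mul e3.neg).mul hdm)).add
        ((e1.mul (aestronglyMeasurable_const.sub (e2.mul aestronglyMeasurable_const))).mul
          (hdm.pow 2))).add ((e1.mul aestronglyMeasurable_const).mul (hdm.pow 4))
  have hmono := condExp_mono (m := ℱ n) (hQint (n + 1)) hint (Eventually.of_forall fun ω => by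
    have h1 := cos_add_le_taylor (θ + S n ω) (d n ω) hδ
    have h2 : S (n + 1) ω = S n ω + d n ω := by simp [hS, Finset.sum_range_succ]
    have h3 := mul_le_mul_of_nonneg_left h1 (Real.exp_pos (A (n + 1) ω / 2)).le
    simp only [h2, ← add_assoc]
    rw [mul_comm]
    refine h3.trans (le_of_eq ?_)
    ring)
  filter_upwards [hq, hmono, sq_condExp_sq_le (ℱ.le n) hdm (hdb n) (h0 n) (ha n) (hb n) (ham n)]
    with ω k1 k2 k3
  refine k2.trans ?_
  rw [k1]
  have h2 : A (n + 1) ω / 2 = A n ω / 2 + a n ω / 2 := by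
    simp [hA, Finset.sum_range_succ, add_div]
  have h3 := exp_mul_one_sub_mul_le (x := a n ω / 2) (by linarith [ha0 n ω])
    (Real.abs_cos_le_one (θ + S n ω))
  have h4 := mul_le_mul_of_nonneg_left h3 (Real.exp_pos (A n ω / 2)).le
  have h5 : Real.exp (A (n + 1) ω / 2) = Real.exp (A n ω / 2) * Real.exp (a n ω / 2) := by
    rw [h2, Real.exp_add]
  have h6 : 0 ≤ a n ω ^ 2 / 4 + (δ * a n ω + (1 / δ + 1) * b n ω) := by
    have := ha0 n ω
    have := hb0 n ω
    positivity
  -- Since `a ^ 2 ≤ b`, the second-order error of the exponential is absorbed by raising `1 / δ + 1`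
  -- to `1 / δ + 2`.
  have h7 : Real.exp (A (n + 1) ω / 2) * (a n ω ^ 2 / 4 + (δ * a n ω + (1 / δ + 1) * b n ω))
      ≤ Real.exp (K / 2) * (δ * a n ω + (1 / δ + 2) * b n ω) := by
    refine mul_le_mul (hAe _ _) ?_ h6 (Real.exp_pos _).le
    nlinarith [hb0 n ω]
  rw [h5] at h7 ⊢
  nlinarith [h4, h7]

/-- Increments are conditionally orthogonal, so the square of the sum grows in conditional mean by
`a j` at each step. This feeds Chebyshev's inequality for tightness. -/
lemma condExp_sq_le (ℱ : Filtration ℕ m0) {d a : ℕ → Ω → ℝ} {K : ℝ}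
    (hd : ∀ j, StronglyMeasurable[ℱ (j + 1)] (d j)) (hdb : ∀ j, AEBdd μ (d j))
    (h0 : ∀ j, μ[d j | ℱ j] =ᵐ[μ] 0)
    (ha : ∀ j, μ[fun ω => d j ω ^ 2 | ℱ j] =ᵐ[μ] a j)
    (hK : ∀ N ω, ∑ j ∈ Finset.range N, a j ω ≤ K) (N : ℕ) :
    ∀ᵐ ω ∂μ, (μ[fun ω => (∑ j ∈ Finset.range N, d j ω) ^ 2 | ℱ 0]) ω ≤ K := by
  set S : ℕ → Ω → ℝ := fun N ω => ∑ j ∈ Finset.range N, d j ω with hS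
  have hSm : ∀ n, StronglyMeasurable[ℱ n] (S n) := fun n =>
    Finset.stronglyMeasurable_fun_sum _ fun i hi =>
      (hd i).mono (ℱ.mono (Nat.succ_le_of_lt (Finset.mem_range.1 hi)))
  have hSb : ∀ n, AEBdd μ (S n) := fun n => AEBdd.sum _ fun i _ => hdb i
  have haint : ∀ j, Integrable (a j) μ := fun j => integrable_condExp.congr (ha j)
  have hSint : ∀ n, Integrable (fun ω => S n ω ^ 2) μ := fun n =>
    ((hSb n).pow 2).integrable (((hSm n).pow 2).mono (ℱ.le n)).aestronglyMeasurable
  have key := condExp_le_add_sum (μ := μ) ℱ (Z := fun n ω => S n ω ^ 2) (β := a)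
    ((hSm 0).pow 2) hSint haint ?_ N
  · have hle := condExp_mono (m := ℱ 0)
      (integrable_finsetSum (Finset.range N) fun j _ => haint j) (integrable_const K)
      (Eventually.of_forall fun ω => hK N ω)
    rw [condExp_const (ℱ.le 0) K] at hle
    filter_upwards [key, hle] with ω h1 h2
    have h3 : S 0 ω = 0 := by simp [hS]
    rw [h3] at h1
    simpa using h1.trans (add_le_add le_rfl h2)
  intro n
  have hq := condExp_quartic (ℱ.le n) ((hd n).mono (ℱ.le _)).aestronglyMeasurable (hdb n) (h0 n)
    (ha n) (EventuallyEq.refl _ _) (g₀ := fun ω => S n ω ^ 2) (g₁ := fun ω => 2 * S n ω)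
    (g₂ := fun _ => 1) (g₃ := fun _ => 0) ((hSm n).pow 2) ((hSm n).const_mul _)
    stronglyMeasurable_const stronglyMeasurable_const ((hSb n).pow 2)
    ((AEBdd.const 2).mul (hSb n)) (AEBdd.const 1) (AEBdd.const 0)
  have h1 : (fun ω => S (n + 1) ω ^ 2) = fun ω => S n ω ^ 2 + 2 * S n ω * d n ω
      + 1 * d n ω ^ 2 + 0 * d n ω ^ 4 := by
    funext ω
    simp only [hS, Finset.sum_range_succ]
    ring
  rw [h1]
  filter_upwards [hq] with ω k
  rw [k]
  simp

end Martingale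

/-! ### Almost sure conditional central limit theorem for martingale difference arrays -/

section CLT

variable {Ω : Type*} {m0 : MeasurableSpace Ω} {μ : Measure Ω} [IsProbabilityMeasure μ]

/-- The filtration `j ↦ ℱ (n + j)`. -/
def shiftFiltration (ℱ : Filtration ℕ m0) (n : ℕ) : Filtration ℕ m0 where
  seq j := ℱ (n + j)
  mono' _ _ h := ℱ.mono (Nat.add_le_add_left h n)
  le' j := ℱ.le (n + j)

/-- If `j` is the last index below `N` satisfying `p`, every retained term lies among the first `j +
1`, whose full sum is at most `K`. -/
lemma sum_stopped_le {a : ℕ → ℝ} {p : ℕ → Prop} [DecidablePred p] {K : ℝ} (hK : 0 ≤ K)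
    (ha : ∀ j, 0 ≤ a j) (hp : ∀ j, p j → ∑ i ∈ Finset.range (j + 1), a i ≤ K) (N : ℕ) :
    ∑ j ∈ Finset.range N, (if p j then 1 else 0) * a j ≤ K := by
  induction N with
  | zero => simpa
  | succ N ih =>
    by_cases h : p N
    · refine le_trans (Finset.sum_le_sum fun j _ => ?_) (hp N h)
      split_ifs
      · simp
      · simpa using ha j
    · rw [Finset.sum_range_succ]
      simpa [h] using ih

/-- Stopping a martingale difference sequence before its conditional second and fourth moments
accumulate too much. -/
lemma exists_stopped (ℱ : Filtration ℕ m0) {ξ : ℕ → Ω → ℝ} {K : ℝ} (hK : 0 ≤ K)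
    (hξ : ∀ j, StronglyMeasurable[ℱ (j + 1)] (ξ j)) (hξb : ∀ j, AEBdd μ (ξ j))
    (h0 : ∀ j, μ[ξ j | ℱ j] =ᵐ[μ] 0) (N : ℕ) :
    ∃ d a b : ℕ → Ω → ℝ, (∀ j, StronglyMeasurable[ℱ (j + 1)] (d j)) ∧ (∀ j, AEBdd μ (d j)) ∧
      (∀ j, μ[d j | ℱ j] =ᵐ[μ] 0) ∧ (∀ j, μ[fun ω => d j ω ^ 2 | ℱ j] =ᵐ[μ] a j) ∧
      (∀ j, μ[fun ω => d j ω ^ 4 | ℱ j] =ᵐ[μ] b j) ∧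
      (∀ j, StronglyMeasurable[ℱ j] (a j)) ∧ (∀ j, StronglyMeasurable[ℱ j] (b j)) ∧
      (∀ j ω, 0 ≤ a j ω) ∧ (∀ j ω, 0 ≤ b j ω) ∧
      (∀ N ω, ∑ j ∈ Finset.range N, a j ω ≤ K) ∧ (∀ N ω, ∑ j ∈ Finset.range N, b j ω ≤ 1) ∧
      ∀ᵐ ω ∂μ, ∑ j ∈ Finset.range N, (μ[fun ω => ξ j ω ^ 2 | ℱ j]) ω ≤ K →
        ∑ j ∈ Finset.range N, (μ[fun ω => ξ j ω ^ 4 | ℱ j]) ω ≤ 1 →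
        ∀ j < N, d j ω = ξ j ω ∧ a j ω = (μ[fun ω => ξ j ω ^ 2 | ℱ j]) ω ∧
          b j ω = (μ[fun ω => ξ j ω ^ 4 | ℱ j]) ω := by
  classical
  -- The absolute values alter the conditional moments only on a null set and make nonnegativity
  -- hold at every `ω`.
  set a' : ℕ → Ω → ℝ := fun j ω => |(μ[fun ω => ξ j ω ^ 2 | ℱ j]) ω| with ha'
  set b' : ℕ → Ω → ℝ := fun j ω => |(μ[fun ω => ξ j ω ^ 4 | ℱ j]) ω| with hb'
  -- The sums include index `j` itself: these moments are `ℱ j`-measurable, so stopping can occur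
  -- before a bound is exceeded, and `g j` is still predictable.
  set p : ℕ → Ω → Prop := fun j ω => ∑ i ∈ Finset.range (j + 1), a' i ω ≤ K ∧
    ∑ i ∈ Finset.range (j + 1), b' i ω ≤ 1 with hp
  set g : ℕ → Ω → ℝ := fun j ω => if p j ω then 1 else 0 with hg
  have ha'm : ∀ j, StronglyMeasurable[ℱ j] (a' j) := fun j =>
    (stronglyMeasurable_condExp (μ := μ) (m := ℱ j) (f := fun ω => ξ j ω ^ 2)).norm
  have hb'm : ∀ j, StronglyMeasurable[ℱ j] (b' j) := fun j =>
    (stronglyMeasurable_condExp (μ := μ) (m := ℱ j) (f := fun ω => ξ j ω ^ 4)).norm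
  have hsum : ∀ {c : ℕ → Ω → ℝ}, (∀ j, StronglyMeasurable[ℱ j] (c j)) → ∀ j,
      StronglyMeasurable[ℱ j] fun ω => ∑ i ∈ Finset.range (j + 1), c i ω := fun hc j =>
    Finset.stronglyMeasurable_fun_sum _ fun i hi =>
      (hc i).mono (ℱ.mono (Nat.lt_succ_iff.1 (Finset.mem_range.1 hi)))
  have hpm : ∀ j, MeasurableSet[ℱ j] {ω | p j ω} := fun j =>
    MeasurableSet.inter (@measurableSet_le _ _ _ _ _ (ℱ j) _ _ _ _ _ (hsum ha'm j).measurable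
        (@measurable_const _ _ _ (ℱ j) K))
      (@measurableSet_le _ _ _ _ _ (ℱ j) _ _ _ _ _ (hsum hb'm j).measurable
        (@measurable_const _ _ _ (ℱ j) 1))
  have hgm : ∀ j, StronglyMeasurable[ℱ j] (g j) := fun j =>
    StronglyMeasurable.ite (hpm j) stronglyMeasurable_const stronglyMeasurable_const
  have hg01 : ∀ j ω, g j ω = 0 ∨ g j ω = 1 := fun j ω => by
    by_cases h : p j ω <;> simp [hg, h]
  have hgpow : ∀ j ω (n : ℕ), n ≠ 0 → g j ω ^ n = g j ω := fun j ω n hn => by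
    rcases hg01 j ω with h | h <;> simp [h, hn]
  have hgb : ∀ j, AEBdd μ (g j) := fun j => AEBdd.of_le 1 fun ω => by
    rcases hg01 j ω with h | h <;> simp [h]
  have hg0 : ∀ j ω, 0 ≤ g j ω := fun j ω => by rcases hg01 j ω with h | h <;> simp [h]
  have hξm : ∀ j, AEStronglyMeasurable (ξ j) μ := fun j =>
    ((hξ j).mono (ℱ.le _)).aestronglyMeasurable
  have ha'e : ∀ j, μ[fun ω => ξ j ω ^ 2 | ℱ j] =ᵐ[μ] a' j := fun j => by
    have : 0 ≤ᵐ[μ] μ[fun ω => ξ j ω ^ 2 | ℱ j] :=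
      condExp_nonneg (Eventually.of_forall fun ω => sq_nonneg _)
    filter_upwards [this] with ω h
    exact (abs_of_nonneg h).symm
  have hb'e : ∀ j, μ[fun ω => ξ j ω ^ 4 | ℱ j] =ᵐ[μ] b' j := fun j => by
    have : 0 ≤ᵐ[μ] μ[fun ω => ξ j ω ^ 4 | ℱ j] :=
      condExp_nonneg (Eventually.of_forall fun ω => by
        have : (0 : ℝ) ≤ ξ j ω ^ 4 := by positivity
        exact this)
    filter_upwards [this] with ω h
    exact (abs_of_nonneg h).symm
  refine ⟨fun j ω => g j ω * ξ j ω, fun j ω => g j ω * a' j ω, fun j ω => g j ω * b' j ω,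
    fun j => ((hgm j).mono (ℱ.mono (Nat.le_succ j))).mul (hξ j), fun j => (hgb j).mul (hξb j),
    fun j => ?_, fun j => ?_, fun j => ?_, fun j => (hgm j).mul (ha'm j),
    fun j => (hgm j).mul (hb'm j), fun j ω => mul_nonneg (hg0 j ω) (abs_nonneg _),
    fun j ω => mul_nonneg (hg0 j ω) (abs_nonneg _), fun N ω => ?_, fun N ω => ?_, ?_⟩
  · filter_upwards [condExp_mul_left_of_bdd (ℱ.le j) (hgm j) (hgb j)
      ((hξb j).integrable (hξm j)), h0 j] with ω k1 k2
    rw [k1, k2]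
    simp
  · have : (fun ω => (g j ω * ξ j ω) ^ 2) = fun ω => g j ω * ξ j ω ^ 2 := by
      funext ω; rw [mul_pow, hgpow j ω 2 two_ne_zero]
    rw [this]
    filter_upwards [condExp_mul_left_of_bdd (ℱ.le j) (hgm j) (hgb j)
      (((hξb j).pow 2).integrable ((hξm j).pow 2)), ha'e j] with ω k1 k2
    rw [k1, k2]
  · have : (fun ω => (g j ω * ξ j ω) ^ 4) = fun ω => g j ω * ξ j ω ^ 4 := by
      funext ω; rw [mul_pow, hgpow j ω 4 four_ne_zero]
    rw [this]
    filter_upwards [condExp_mul_left_of_bdd (ℱ.le j) (hgm j) (hgb j)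
      (((hξb j).pow 4).integrable ((hξm j).pow 4)), hb'e j] with ω k1 k2
    rw [k1, k2]
  · exact sum_stopped_le (p := fun j => p j ω) hK (fun j => abs_nonneg _) (fun j h => h.1) N
  · exact sum_stopped_le (p := fun j => p j ω) zero_le_one (fun j => abs_nonneg _)
      (fun j h => h.2) N
  · filter_upwards [ae_all_iff.2 ha'e, ae_all_iff.2 hb'e] with ω k1 k2 hA hB j hj
    simp_rw [k1] at hA
    simp_rw [k2] at hB
    have hsub : Finset.range (j + 1) ⊆ Finset.range N := Finset.range_subset_range.2 hj
    have hpj : p j ω :=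
      ⟨(Finset.sum_le_sum_of_subset_of_nonneg hsub fun _ _ _ => abs_nonneg _).trans hA,
        (Finset.sum_le_sum_of_subset_of_nonneg hsub fun _ _ _ => abs_nonneg _).trans hB⟩
    have hgj : g j ω = 1 := by simp [hg, hpj]
    rw [hgj, k1 j, k2 j]
    simp

/-- Almost sure conditional central limit theorem for martingale difference arrays. -/
theorem ae_tendsto_condExp_cos_array (ℱ : Filtration ℕ m0) {ξ : ℕ → ℕ → Ω → ℝ} {N : ℕ → ℕ}
    {v : ℝ} (hv : 0 ≤ v)
    (hξ : ∀ n j, StronglyMeasurable[ℱ (n + j + 1)] (ξ n j)) (hξb : ∀ n j, AEBdd μ (ξ n j))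
    (h0 : ∀ n j, μ[ξ n j | ℱ (n + j)] =ᵐ[μ] 0)
    (h2 : ∀ᵐ ω ∂μ, Tendsto (fun n => ∑ j ∈ Finset.range (N n),
      (μ[fun ω => ξ n j ω ^ 2 | ℱ (n + j)]) ω) atTop (𝓝 v))
    (h4 : ∀ᵐ ω ∂μ, Tendsto (fun n => ∑ j ∈ Finset.range (N n),
      (μ[fun ω => ξ n j ω ^ 4 | ℱ (n + j)]) ω) atTop (𝓝 0)) :
    (∀ θ : ℝ, ∀ᵐ ω ∂μ, Tendsto (fun n => (μ[fun ω =>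
      Real.cos (θ + ∑ j ∈ Finset.range (N n), ξ n j ω) | ℱ n]) ω) atTop
        (𝓝 (Real.exp (-v / 2) * Real.cos θ))) ∧
    ∀ R : ℝ, 0 < R → ∀ᵐ ω ∂μ, ∀ ε > 0, ∀ᶠ n in atTop,
      (μ[fun ω => if R < |∑ j ∈ Finset.range (N n), ξ n j ω| then (1 : ℝ) else 0 | ℱ n]) ω
        ≤ (v + 1) / R ^ 2 + ε := by
  have hK : (0 : ℝ) ≤ v + 1 := by linarith
  -- The levels `v + 1` and `1` lie strictly above the limits `v` and `0`, so almost surely the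
  -- stopping is inactive in all late rows; how late depends on `ω`.
  choose d a b hd hdb hd0 hda hdb4 ham hbm ha0 hb0 haK hb1 heq using fun n =>
    exists_stopped (μ := μ) (shiftFiltration ℱ n) hK (hξ n) (hξb n) (h0 n) (N n)
  set S : ℕ → Ω → ℝ := fun n ω => ∑ j ∈ Finset.range (N n), ξ n j ω with hS
  set T : ℕ → Ω → ℝ := fun n ω => ∑ j ∈ Finset.range (N n), d n j ω with hT
  set A : ℕ → Ω → ℝ := fun n ω => ∑ j ∈ Finset.range (N n), a n j ω with hA
  set B : ℕ → Ω → ℝ := fun n ω => ∑ j ∈ Finset.range (N n), b n j ω with hB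
  have hSm : ∀ n, AEStronglyMeasurable (S n) μ := fun n =>
    Finset.aestronglyMeasurable_fun_sum _ fun j _ =>
      ((hξ n j).mono (ℱ.le _)).aestronglyMeasurable
  have hTm : ∀ n, AEStronglyMeasurable (T n) μ := fun n =>
    Finset.aestronglyMeasurable_fun_sum _ fun j _ =>
      ((hd n j).mono (Filtration.le _ _)).aestronglyMeasurable
  have hAm : ∀ n, AEStronglyMeasurable (A n) μ := fun n =>
    Finset.aestronglyMeasurable_fun_sum _ fun j _ =>
      ((ham n j).mono (Filtration.le _ _)).aestronglyMeasurable
  have hBm : ∀ n, AEStronglyMeasurable (B n) μ := fun n =>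
    Finset.aestronglyMeasurable_fun_sum _ fun j _ =>
      ((hbm n j).mono (Filtration.le _ _)).aestronglyMeasurable
  have hA0 : ∀ n ω, 0 ≤ A n ω := fun n ω => Finset.sum_nonneg fun j _ => ha0 n j ω
  have hB0 : ∀ n ω, 0 ≤ B n ω := fun n ω => Finset.sum_nonneg fun j _ => hb0 n j ω
  have hev : ∀ᵐ ω ∂μ, ∀ᶠ n in atTop, S n ω = T n ω ∧
      A n ω = ∑ j ∈ Finset.range (N n), (μ[fun ω => ξ n j ω ^ 2 | ℱ (n + j)]) ω ∧
      B n ω = ∑ j ∈ Finset.range (N n), (μ[fun ω => ξ n j ω ^ 4 | ℱ (n + j)]) ω := by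
    filter_upwards [h2, h4, ae_all_iff.2 heq] with ω k2 k4 k
    filter_upwards [k2.eventually (ge_mem_nhds (by linarith : v < v + 1)),
      k4.eventually (ge_mem_nhds zero_lt_one)] with n e1 e2
    have := k n e1 e2
    exact ⟨Finset.sum_congr rfl fun j hj => ((this j (Finset.mem_range.1 hj)).1).symm,
      Finset.sum_congr rfl fun j hj => (this j (Finset.mem_range.1 hj)).2.1,
      Finset.sum_congr rfl fun j hj => (this j (Finset.mem_range.1 hj)).2.2⟩
  have hAlim : ∀ᵐ ω ∂μ, Tendsto (fun n => A n ω) atTop (𝓝 v) := by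
    filter_upwards [h2, hev] with ω k1 k2
    exact k1.congr' (by filter_upwards [k2] with n e using e.2.1.symm)
  have hBlim : ∀ᵐ ω ∂μ, Tendsto (fun n => B n ω) atTop (𝓝 0) := by
    filter_upwards [h4, hev] with ω k1 k2
    exact k1.congr' (by filter_upwards [k2] with n e using e.2.2.symm)
  have hBcond : ∀ᵐ ω ∂μ, Tendsto (fun n => (μ[B n | ℱ n]) ω) atTop (𝓝 0) :=
    ae_tendsto_condExp_zero ℱ (C := 1) hBm (fun n => Eventually.of_forall fun ω => by
      rw [abs_of_nonneg (hB0 n ω)]; exact hb1 n _ ω) hBlim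
  have haint : ∀ n j, Integrable (a n j) μ := fun n j => integrable_condExp.congr (hda n j)
  have hbint : ∀ n j, Integrable (b n j) μ := fun n j => integrable_condExp.congr (hdb4 n j)
  set E : ℝ := Real.exp ((v + 1) / 2) with hE
  have hAE : ∀ n ω, Real.exp (A n ω / 2) ≤ E := fun n ω =>
    Real.exp_le_exp.2 (by linarith [haK n (N n) ω])
  constructor
  · intro θ
    set Q : ℝ → ℕ → Ω → ℝ := fun θ n ω => Real.cos (θ + T n ω) * Real.exp (A n ω / 2) with hQ
    -- The parameter `δ` runs over `1 / (m + 1)`, a countable family, so that one null set serves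
    -- all values.
    have hup : ∀ (m : ℕ) (θ : ℝ), ∀ᵐ ω ∂μ, ∀ n, (μ[Q θ n | ℱ n]) ω ≤ Real.cos θ
        + E * (1 / ((m : ℝ) + 1) * (v + 1) + ((m : ℝ) + 1 + 2) * (μ[B n | ℱ n]) ω) := by
      intro m θ
      refine ae_all_iff.2 fun n => ?_
      have hδ : (0 : ℝ) < 1 / ((m : ℝ) + 1) := by positivity
      have k1 := condExp_cos_le (μ := μ) (shiftFiltration ℱ n) (hd n) (hdb n) (hd0 n) (hda n)
        (hdb4 n) (ham n) (ha0 n) (hb0 n) (haK n) hδ θ (N n)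
      have k2 : μ[fun ω' => ∑ j ∈ Finset.range (N n), Real.exp ((v + 1) / 2)
          * (1 / ((m : ℝ) + 1) * a n j ω' + (1 / (1 / ((m : ℝ) + 1)) + 2) * b n j ω') |
            shiftFiltration ℱ n 0] ≤ᵐ[μ]
          μ[fun ω' => E * (1 / ((m : ℝ) + 1)) * (v + 1) + E * ((m : ℝ) + 1 + 2) * B n ω' | ℱ n] := by
        refine condExp_mono ?_ ?_ (Eventually.of_forall fun ω => ?_)
        · exact integrable_finsetSum _ fun j _ =>
            (((haint n j).const_mul _).add ((hbint n j).const_mul _)).const_mul _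
        · exact (integrable_const _).add
            ((integrable_finsetSum (Finset.range (N n)) fun j _ => hbint n j).const_mul _)
        · simp only [one_div_one_div]
          rw [← Finset.mul_sum, Finset.sum_add_distrib, ← Finset.mul_sum, ← Finset.mul_sum, mul_add,
            ← mul_assoc, ← mul_assoc]
          gcongr
          exact haK n _ ω
      have hBi : Integrable (B n) μ := integrable_finsetSum (Finset.range (N n)) fun j _ => hbint n j
      have k3 := condExp_add (μ := μ) (integrable_const (E * (1 / ((m : ℝ) + 1)) * (v + 1)))
        (hBi.const_mul (E * ((m : ℝ) + 1 + 2))) (ℱ n)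
      have k4 := condExp_smul (μ := μ) (E * ((m : ℝ) + 1 + 2)) (B n) (ℱ n)
      filter_upwards [k1, k2, k3, k4] with ω l1 l2 l3 l4
      refine l1.trans ?_
      refine (add_le_add le_rfl (l2.trans (le_of_eq l3))).trans ?_
      simp only [Pi.add_apply]
      rw [condExp_const (ℱ.le n)]
      have l5 : (μ[fun x => E * ((m : ℝ) + 1 + 2) * B n x | ℱ n]) ω
          = E * ((m : ℝ) + 1 + 2) * (μ[B n | ℱ n]) ω := l4
      rw [l5]
      linarith
    have hQm : ∀ θ n, AEStronglyMeasurable (Q θ n) μ := fun θ n =>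
      (Real.continuous_cos.comp_aestronglyMeasurable (aestronglyMeasurable_const.add (hTm n))).mul
        (Real.continuous_exp.comp_aestronglyMeasurable
          (by simpa [div_eq_mul_inv] using (hAm n).mul_const (2 : ℝ)⁻¹))
    have hQb : ∀ θ n ω, |Q θ n ω| ≤ E := fun θ n ω => by
      rw [hQ, abs_mul, Real.abs_exp]
      exact (mul_le_of_le_one_left (Real.exp_pos _).le (Real.abs_cos_le_one _)).trans (hAE n ω)
    have hQi : ∀ θ n, Integrable (Q θ n) μ := fun θ n =>
      (AEBdd.of_le E (hQb θ n)).integrable (hQm θ n)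
    -- The upper bound at phase `θ + π` is the lower bound at phase `θ`.
    have hQneg : ∀ n, μ[Q (θ + Real.pi) n | ℱ n] =ᵐ[μ] fun ω => -(μ[Q θ n | ℱ n]) ω := by
      intro n
      have : Q (θ + Real.pi) n = -Q θ n := by
        funext ω
        simp only [hQ, Pi.neg_apply]
        rw [add_right_comm, Real.cos_add_pi]
        ring
      rw [this]
      exact condExp_neg _ _
    have hQlim : ∀ᵐ ω ∂μ, Tendsto (fun n => (μ[Q θ n | ℱ n]) ω) atTop (𝓝 (Real.cos θ)) := by
      filter_upwards [ae_all_iff.2 fun m => hup m θ, ae_all_iff.2 fun m => hup m (θ + Real.pi),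
        ae_all_iff.2 hQneg, hBcond] with ω l1 l2 l3 l4
      rw [Metric.tendsto_atTop]
      intro ε hε
      have hEpos : 0 < E := Real.exp_pos _
      have hm : Tendsto (fun m : ℕ => E * (1 / ((m : ℝ) + 1) * (v + 1))) atTop (𝓝 0) := by
        have := (tendsto_one_div_add_atTop_nhds_zero_nat (𝕜 := ℝ)).mul_const (v + 1)
        simpa using this.const_mul E
      obtain ⟨m, hm⟩ := (hm.eventually (gt_mem_nhds (half_pos hε))).exists
      have hB' : Tendsto (fun n => E * (((m : ℝ) + 1 + 2) * (μ[B n | ℱ n]) ω)) atTop (𝓝 0) := by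
        simpa using (l4.const_mul ((m : ℝ) + 1 + 2)).const_mul E
      obtain ⟨n₀, hn₀⟩ := eventually_atTop.1 (hB'.eventually (gt_mem_nhds (half_pos hε)))
      refine ⟨n₀, fun n hn => ?_⟩
      have e1 := l1 m n
      have e2 := l2 m n
      rw [l3 n, Real.cos_add_pi] at e2
      have e3 := hn₀ n hn
      rw [Real.dist_eq, abs_lt]
      constructor <;> linarith
    set e : ℝ := Real.exp (v / 2) with he
    -- `Z` undoes the stopping and replaces the random factor `exp (A / 2)` by its limit; it is
    -- bounded and tends to `0`, so its conditional expectations do too.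
    set Z : ℕ → Ω → ℝ := fun n ω => e * Real.cos (θ + S n ω) - Q θ n ω with hZ
    have hcm : ∀ n, AEStronglyMeasurable (fun ω => Real.cos (θ + S n ω)) μ := fun n =>
      Real.continuous_cos.comp_aestronglyMeasurable (aestronglyMeasurable_const.add (hSm n))
    have hci : ∀ n, Integrable (fun ω => Real.cos (θ + S n ω)) μ := fun n =>
      (AEBdd.of_le 1 fun ω => Real.abs_cos_le_one _).integrable (hcm n)
    have hZcond : ∀ᵐ ω ∂μ, Tendsto (fun n => (μ[Z n | ℱ n]) ω) atTop (𝓝 0) := by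
      refine ae_tendsto_condExp_zero ℱ (C := e + E)
        (fun n => (aestronglyMeasurable_const.mul (hcm n)).sub (hQm θ n))
        (fun n => Eventually.of_forall fun ω => ?_) ?_
      · refine (abs_sub _ _).trans (add_le_add ?_ (hQb θ n ω))
        rw [abs_mul, Real.abs_exp]
        exact mul_le_of_le_one_right (Real.exp_pos _).le (Real.abs_cos_le_one _)
      · filter_upwards [hev, hAlim] with ω l1 l2
        have l3 : Tendsto (fun n => |e - Real.exp (A n ω / 2)|) atTop (𝓝 0) := by
          have := (tendsto_const_nhds (x := e)).sub
            ((Real.continuous_exp.tendsto _).comp (l2.div_const 2))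
          simpa [he] using this.abs
        refine squeeze_zero_norm' ?_ l3
        filter_upwards [l1] with n hn
        rw [hZ, hQ]
        simp only [hn.1]
        rw [mul_comm e, ← mul_sub, Real.norm_eq_abs, abs_mul]
        exact mul_le_of_le_one_left (abs_nonneg _) (Real.abs_cos_le_one _)
    have hsplit : ∀ n, μ[Z n | ℱ n] =ᵐ[μ] fun ω =>
        e * (μ[fun ω => Real.cos (θ + S n ω) | ℱ n]) ω - (μ[Q θ n | ℱ n]) ω := by
      intro n
      have k1 := condExp_sub ((hci n).const_mul e) (hQi θ n) (ℱ n)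
      have k2 := condExp_smul (μ := μ) e (fun ω => Real.cos (θ + S n ω)) (ℱ n)
      filter_upwards [k1, k2] with ω l1 l2
      refine l1.trans ?_
      simp only [Pi.sub_apply]
      congr 1
    filter_upwards [hQlim, hZcond, ae_all_iff.2 hsplit] with ω l1 l2 l3
    have l4 := ((l1.add l2).const_mul (Real.exp (-v / 2)))
    rw [add_zero] at l4
    refine l4.congr fun n => ?_
    rw [l3 n, add_sub_cancel, ← mul_assoc, he, ← Real.exp_add]
    simp [neg_div, hS]
  · intro R hR
    -- Chebyshev applies to the stopped sum `T`; `H` pays for the event where stopping mattered.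
    set H : ℕ → Ω → ℝ := fun n ω => if S n ω = T n ω then 0 else 1 with hH
    have hHm : ∀ n, AEStronglyMeasurable (H n) μ := by
      intro n
      have hset : NullMeasurableSet {ω | S n ω = T n ω} μ :=
        nullMeasurableSet_eq_fun (hSm n).aemeasurable (hTm n).aemeasurable
      have : H n = Set.indicator {ω | S n ω = T n ω}ᶜ fun _ => (1 : ℝ) := by
        funext ω
        by_cases h : S n ω = T n ω <;> simp [hH, h]
      rw [this]
      exact aestronglyMeasurable_const.indicator₀ hset.compl
    have hHcond : ∀ᵐ ω ∂μ, Tendsto (fun n => (μ[H n | ℱ n]) ω) atTop (𝓝 0) := by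
      refine ae_tendsto_condExp_zero ℱ (C := 1) hHm (fun n => Eventually.of_forall fun ω => ?_) ?_
      · by_cases h : S n ω = T n ω <;> simp [hH, h]
      · filter_upwards [hev] with ω l1
        refine tendsto_const_nhds.congr' ?_
        filter_upwards [l1] with n hn
        simp [hH, hn.1]
    have hHi : ∀ n, Integrable (H n) μ := fun n =>
      (AEBdd.of_le 1 fun ω => by by_cases h : S n ω = T n ω <;> simp [hH, h]).integrable (hHm n)
    have hTi : ∀ n, Integrable (fun ω => T n ω ^ 2) μ := fun n =>
      ((AEBdd.sum _ fun j _ => hdb n j).pow 2).integrable ((hTm n).pow 2)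
    have hbound : ∀ n, ∀ᵐ ω ∂μ, (μ[fun ω => if R < |S n ω| then (1 : ℝ) else 0 | ℱ n]) ω
        ≤ (v + 1) / R ^ 2 + (μ[H n | ℱ n]) ω := by
      intro n
      have k1 := condExp_sq_le (μ := μ) (shiftFiltration ℱ n) (hd n) (hdb n) (hd0 n) (hda n)
        (haK n) (N n)
      have hset : NullMeasurableSet {ω | R < |S n ω|} μ :=
        nullMeasurableSet_lt aemeasurable_const (hSm n).aemeasurable.abs
      have hi : Integrable (fun ω => if R < |S n ω| then (1 : ℝ) else 0) μ := by
        have : (fun ω => if R < |S n ω| then (1 : ℝ) else 0)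
            = Set.indicator {ω | R < |S n ω|} fun _ => (1 : ℝ) := by
          funext ω
          by_cases h : R < |S n ω| <;> simp [h]
        rw [this]
        exact (integrable_const 1).indicator₀ hset
      have k2 := condExp_mono (m := ℱ n) hi (((hTi n).const_mul (R ^ 2)⁻¹).add (hHi n))
        (Eventually.of_forall fun ω => by
          simp only [Pi.add_apply]
          by_cases h : S n ω = T n ω
          · rw [← h]
            split_ifs with h1
            · have h2 : R ^ 2 ≤ S n ω ^ 2 := by
                rw [← sq_abs (S n ω)]
                gcongr
              have h3 : 1 ≤ (R ^ 2)⁻¹ * S n ω ^ 2 := by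
                rw [← div_eq_inv_mul, le_div_iff₀ (by positivity)]
                linarith
              simp [hH, h]
              rw [← h]
              exact h3
            · simp [hH, h]
              positivity
          · have h3 : 0 ≤ (R ^ 2)⁻¹ * T n ω ^ 2 := by positivity
            have h4 : H n ω = 1 := by simp [hH, h]
            rw [h4]
            split_ifs <;> linarith)
      have k3 := condExp_add ((hTi n).const_mul (R ^ 2)⁻¹) (hHi n) (ℱ n)
      have k4 := condExp_smul (μ := μ) (R ^ 2)⁻¹ (fun ω => T n ω ^ 2) (ℱ n)
      filter_upwards [k1, k2, k3, k4] with ω l1 l2 l3 l4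
      refine l2.trans ((le_of_eq l3).trans ?_)
      simp only [Pi.add_apply]
      have l5 : (μ[fun x => (R ^ 2)⁻¹ * T n x ^ 2 | ℱ n]) ω
        = (R ^ 2)⁻¹ * (μ[fun x => T n x ^ 2 | ℱ n]) ω := l4
      have l6 : (μ[fun x => T n x ^ 2 | ℱ n]) ω ≤ v + 1 := l1
      rw [l5, div_eq_inv_mul]
      gcongr
    filter_upwards [hHcond, ae_all_iff.2 hbound] with ω l1 l2 ε hε
    filter_upwards [l1.eventually (ge_mem_nhds hε)] with n hn
    exact (l2 n).trans (by linarith)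

end CLT

/-! ### The inverse square root of a positive semidefinite matrix -/

section Matrix

open scoped MatrixOrder

variable {k : ℕ}

lemma isClosed_setOf_posSemidef :
    IsClosed {A : Matrix (Fin k) (Fin k) ℝ | A.PosSemidef} := by
  have : {A : Matrix (Fin k) (Fin k) ℝ | A.PosSemidef}
      = {A | A.conjTranspose = A} ∩ ⋂ x : Fin k → ℝ, {A | 0 ≤ star x ⬝ᵥ A.mulVec x} := by
    ext A
    simp only [Set.mem_inter_iff, Set.mem_iInter, Set.mem_ofPred_eq]
    exact Matrix.posSemidef_iff_dotProduct_mulVec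
  rw [this]
  refine (isClosed_eq continuous_id.matrix_conjTranspose continuous_id).inter
    (isClosed_iInter fun x => isClosed_le continuous_const ?_)
  exact Continuous.dotProduct continuous_const (continuous_id.matrix_mulVec continuous_const)

/-- For the symmetric root `B`, the entry `A i i` is the sum of the squares of row `i` of `B`. This
confines roots of nearby matrices to a compact set. -/
lemma abs_sqrt_apply_le {A : Matrix (Fin k) (Fin k) ℝ} (hA : A.PosSemidef) (i j : Fin k) :
    |CFC.sqrt A i j| ≤ Real.sqrt (A i i) := by
  have hB : (CFC.sqrt A).PosSemidef := Matrix.nonneg_iff_posSemidef.1 (CFC.sqrt_nonneg A)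
  have hBB : CFC.sqrt A * CFC.sqrt A = A := CFC.sqrt_mul_sqrt_self A hA.nonneg
  have hsymm : ∀ i j, CFC.sqrt A j i = CFC.sqrt A i j := fun i j => by
    have := hB.1.apply i j
    simpa using this
  refine Real.abs_le_sqrt ?_
  conv_rhs => rw [← hBB, Matrix.mul_apply]
  simp_rw [hsymm i]
  rw [sq]
  exact Finset.single_le_sum (f := fun l => CFC.sqrt A i l * CFC.sqrt A i l)
    (fun l _ => mul_self_nonneg _) (Finset.mem_univ j)

/-- Compactness plus uniqueness: near `A` the roots stay in a compact set of positive semidefinite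
matrices, and any cluster point squares to `A`, hence is its root. -/
lemma continuousOn_sqrt :
    ContinuousOn (CFC.sqrt : Matrix (Fin k) (Fin k) ℝ → Matrix (Fin k) (Fin k) ℝ)
      {A | A.PosSemidef} := by
  intro A hA
  set C : ℝ := Real.sqrt (∑ i, |A i i| + 1)
  set s : Set (Matrix (Fin k) (Fin k) ℝ) :=
    {B | B.PosSemidef} ∩ Set.pi Set.univ fun _ => Set.pi Set.univ fun _ => Set.Icc (-C) C
  have hs : IsCompact s := IsCompact.inter_left
    (isCompact_univ_pi fun _ => isCompact_univ_pi fun _ => isCompact_Icc) isClosed_setOf_posSemidef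
  have hAmem : ∀ᶠ B in 𝓝[{A | A.PosSemidef}] A, B.PosSemidef := eventually_mem_nhdsWithin
  refine hs.tendsto_nhds_of_unique_mapClusterPt ?_ ?_
  · have h1 : ∀ᶠ B : Matrix (Fin k) (Fin k) ℝ in 𝓝 A, ∀ i, B i i < ∑ i, |A i i| + 1 := by
      refine eventually_all.2 fun i => ?_
      have hc : Tendsto (fun B : Matrix (Fin k) (Fin k) ℝ => B i i) (𝓝 A) (𝓝 (A i i)) :=
        (continuous_apply_apply (ρ := fun _ _ => ℝ) i i).tendsto A
      refine hc.eventually (gt_mem_nhds ?_)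
      have := Finset.single_le_sum (f := fun l => |A l l|) (fun l _ => abs_nonneg _)
        (Finset.mem_univ i)
      linarith [le_abs_self (A i i)]
    filter_upwards [hAmem, nhdsWithin_le_nhds h1] with B hB hB1
    refine ⟨Matrix.nonneg_iff_posSemidef.1 (CFC.sqrt_nonneg B), fun i _ j _ => ?_⟩
    exact abs_le.1 ((abs_sqrt_apply_le hB i j).trans (Real.sqrt_le_sqrt (hB1 i).le))
  · intro B hB hclust
    have h1 : MapClusterPt (B * B) (𝓝[{A | A.PosSemidef}] A)
        fun M : Matrix (Fin k) (Fin k) ℝ => CFC.sqrt M * CFC.sqrt M :=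
      hclust.continuousAt_comp (f := fun M => M * M)
        (continuous_id.matrix_mul continuous_id).continuousAt
    have h2 : Tendsto (fun M : Matrix (Fin k) (Fin k) ℝ => CFC.sqrt M * CFC.sqrt M)
        (𝓝[{A | A.PosSemidef}] A) (𝓝 A) := by
      refine (tendsto_id'.2 nhdsWithin_le_nhds).congr' ?_
      filter_upwards [hAmem] with M hM
      exact (CFC.sqrt_mul_sqrt_self M hM.nonneg).symm
    have h3 : ClusterPt (B * B) (𝓝 A) := ClusterPt.mono h1 h2
    have h4 : B * B = A := eq_of_nhds_neBot h3
    exact (CFC.sqrt_unique h4 hB.1.nonneg).symm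

lemma isUnit_det_sqrt {A : Matrix (Fin k) (Fin k) ℝ} (hA : A.PosDef) : IsUnit (CFC.sqrt A).det := by
  have h := congrArg Matrix.det (CFC.sqrt_mul_sqrt_self A hA.posSemidef.nonneg)
  rw [Matrix.det_mul] at h
  have h2 : IsUnit A.det := (Matrix.isUnit_iff_isUnit_det A).1 hA.isUnit
  rw [← h] at h2
  exact isUnit_of_mul_isUnit_left h2

/-- Cramer's formula is continuous where the determinant is nonzero, so only the limit need be
invertible and the value at singular `V n` is irrelevant. -/
lemma tendsto_invSqrt {V : ℕ → Matrix (Fin k) (Fin k) ℝ} {U : Matrix (Fin k) (Fin k) ℝ}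
    (hV : ∀ n, (V n).PosSemidef) (hU : U.PosDef) (h : Tendsto V atTop (𝓝 U)) :
    Tendsto (fun n => invSqrt (V n)) atTop (𝓝 (invSqrt U)) := by
  have h1 : Tendsto (fun n => CFC.sqrt (V n)) atTop (𝓝 (CFC.sqrt U)) :=
    (continuousOn_sqrt U hU.posSemidef).tendsto.comp
      (tendsto_nhdsWithin_iff.2 ⟨h, Eventually.of_forall hV⟩)
  simp only [invSqrt, Matrix.inv_def, Ring.inverse_eq_inv']
  have h2 : Tendsto (fun n => (CFC.sqrt (V n)).det) atTop (𝓝 (CFC.sqrt U).det) :=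
    ((continuous_id.matrix_det).tendsto _).comp h1
  have h3 : Tendsto (fun n => (CFC.sqrt (V n)).adjugate) atTop (𝓝 (CFC.sqrt U).adjugate) :=
    ((continuous_id.matrix_adjugate).tendsto _).comp h1
  exact (h2.inv₀ (isUnit_det_sqrt hU).ne_zero).smul h3

/-- `F` is continuous only on the positive semidefinite cone, so `V` is viewed as a random element
of that subtype. The sigma-algebra is arbitrary, to allow that of the past. -/
lemma measurable_comp_of_continuousOn_posSemidef {Ω : Type*} {m : MeasurableSpace Ω}
    {V : Ω → Matrix (Fin k) (Fin k) ℝ} (hV : ∀ i j, Measurable fun ω => V ω i j)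
    (hpsd : ∀ ω, (V ω).PosSemidef) {F : Matrix (Fin k) (Fin k) ℝ → ℝ}
    (hF : ContinuousOn F {A | A.PosSemidef}) : Measurable fun ω => F (V ω) := by
  have h1 : Measurable fun ω => (⟨fun i j => V ω i j, hpsd ω⟩ :
      {A : Fin k → Fin k → ℝ // (Matrix.of A).PosSemidef}) :=
    (measurable_pi_lambda _ fun i => measurable_pi_lambda _ fun j => hV i j).subtype_mk
  have h2 : Continuous fun A : {A : Fin k → Fin k → ℝ // (Matrix.of A).PosSemidef} =>
      F (Matrix.of A.1) :=
    hF.comp_continuous (f := fun A : {A : Fin k → Fin k → ℝ //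
      (Matrix.of A).PosSemidef} => Matrix.of A.1) continuous_subtype_val fun A => A.2
  exact h2.measurable.comp h1

lemma measurable_invSqrt {Ω : Type*} {m : MeasurableSpace Ω} {V : Ω → Matrix (Fin k) (Fin k) ℝ}
    (hV : ∀ i j, Measurable fun ω => V ω i j) (hpsd : ∀ ω, (V ω).PosSemidef) (i j : Fin k) :
    Measurable fun ω => invSqrt (V ω) i j := by
  have h1 : (fun ω => invSqrt (V ω) i j)
      = fun ω => (CFC.sqrt (V ω)).det⁻¹ * (CFC.sqrt (V ω)).adjugate i j := by
    funext ω
    simp [invSqrt, Matrix.inv_def]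
  rw [h1]
  refine (measurable_comp_of_continuousOn_posSemidef hV hpsd
    (F := fun A => (CFC.sqrt A).det) ?_).inv.mul
    (measurable_comp_of_continuousOn_posSemidef hV hpsd
      (F := fun A => (CFC.sqrt A).adjugate i j) ?_)
  · exact (continuous_id.matrix_det).comp_continuousOn continuousOn_sqrt
  · exact ((continuous_apply_apply (ρ := fun _ _ => ℝ) i j).comp
      continuous_id.matrix_adjugate).comp_continuousOn continuousOn_sqrt

/-- `U^{-1/2} U U^{-1/2} = 1`. This makes the limiting conditional variance of the scaled error
non-random. -/
lemma quadraticForm_invSqrt {U : Matrix (Fin k) (Fin k) ℝ} (hU : U.PosDef) (u : Fin k → ℝ) :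
    Matrix.vecMul u (invSqrt U) ⬝ᵥ U.mulVec (Matrix.vecMul u (invSqrt U)) = u ⬝ᵥ u := by
  have hdet := isUnit_det_sqrt hU
  have hB : (CFC.sqrt U).PosSemidef := Matrix.nonneg_iff_posSemidef.1 (CFC.sqrt_nonneg U)
  have hsymm : (invSqrt U).transpose = invSqrt U := by
    have h : (CFC.sqrt U).transpose = CFC.sqrt U := by
      have := hB.1.eq
      rwa [Matrix.conjTranspose_eq_transpose_of_trivial] at this
    rw [invSqrt, Matrix.transpose_nonsing_inv, h]
  have hUB : U = CFC.sqrt U * CFC.sqrt U := (CFC.sqrt_mul_sqrt_self U hU.posSemidef.nonneg).symm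
  have h1 : invSqrt U * U * invSqrt U = 1 := by
    -- Stated for a general root `B`, so that rewriting `U` does not also rewrite it inside its
    -- square root.
    have h : ∀ B : Matrix (Fin k) (Fin k) ℝ, IsUnit B.det → U = B * B → B⁻¹ * U * B⁻¹ = 1 := by
      intro B hB1 hB2
      rw [hB2, ← Matrix.mul_assoc, Matrix.nonsing_inv_mul _ hB1, Matrix.one_mul,
        Matrix.mul_nonsing_inv _ hB1]
    exact h _ hdet hUB
  have h2 : Matrix.vecMul u (invSqrt U) = (invSqrt U).mulVec u := by
    rw [← Matrix.mulVec_transpose, hsymm]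
  conv_lhs => rw [h2]
  rw [← h2, ← Matrix.dotProduct_mulVec, h2, Matrix.mulVec_mulVec, Matrix.mulVec_mulVec,
    h1, Matrix.one_mulVec]

lemma posSemidef_V {Ω : Type*} (X : ℕ → Ω → ℝ) (P : ∀ n : ℕ, Kernel (Fin n → ℝ) ℝ) (t : Fin k → ℝ)
    (n : ℕ) (ω : Ω) : (V X P t n ω).PosSemidef := by
  unfold V
  refine Matrix.PosSemidef.smul (Matrix.posSemidef_sum _ fun m _ => ?_) (by positivity)
  refine Matrix.PosSemidef.smul ?_ (by positivity)
  have := Matrix.posSemidef_vecMulVec_self_star (updateVec X P t m ω)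
  simpa using this

end Matrix

/-! ### Conditionally identically distributed sequences -/

section CID

variable {Ω : Type*} {X : ℕ → Ω → ℝ}

lemma measurable_pastSigma {n i : ℕ} (h : i < n) : Measurable[pastSigma X n] (X i) :=
  (measurable_pi_apply (⟨i, h⟩ : Fin n)).comp (comap_measurable (firstN X n))

lemma integral_empirical (f : ℝ → ℝ) (n : ℕ) (ω : Ω) :
    ∫ x, f x ∂(empirical X n ω : Measure ℝ)
      = ((n + 1 : ℕ) : ℝ)⁻¹ * ∑ i ∈ Finset.range (n + 1), f (X i ω) := by
  change ∫ x, f x ∂(((n : ℝ≥0∞) + 1)⁻¹ • ∑ i ∈ Finset.range (n + 1), Measure.dirac (X i ω)) = _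
  rw [integral_smul_measure, integral_finsetSum_measure fun i _ => integrable_dirac (by simp)]
  simp only [integral_dirac, smul_eq_mul]
  congr 1
  rw [ENNReal.toReal_inv, ENNReal.toReal_add (by simp) (by simp)]
  simp

variable [m0 : MeasurableSpace Ω] {μ : Measure Ω}

lemma measurable_firstN (hX : ∀ n, Measurable (X n)) (n : ℕ) : Measurable (firstN X n) :=
  measurable_pi_lambda _ fun i => hX i

/-- The filtration generated by the observations. -/
def pastFiltration (X : ℕ → Ω → ℝ) (hX : ∀ n, Measurable (X n)) : Filtration ℕ m0 where
  seq := pastSigma X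
  mono' n m h := by
    have h1 : firstN X n = (fun x : Fin m → ℝ => fun i : Fin n => x (Fin.castLE h i)) ∘
        firstN X m := rfl
    change MeasurableSpace.comap (firstN X n) _ ≤ MeasurableSpace.comap (firstN X m) _
    rw [h1, ← MeasurableSpace.comap_comp]
    refine MeasurableSpace.comap_mono (Measurable.comap_le ?_)
    exact measurable_pi_lambda _ fun i => measurable_pi_apply _
  le' n := (measurable_firstN hX n).comap_le

variable [IsProbabilityMeasure μ]

/-- Events of the past are `{firstN X n ∈ B}`, so integrating over them only involves the joint laws
that the c.i.d. property equates. -/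
lemma IsCID.condExp_eq (hcid : IsCID X μ) (hX : ∀ n, Measurable (X n)) {f : ℝ → ℝ}
    (hf : Measurable f) {C : ℝ} (hC : ∀ x, |f x| ≤ C) {n j : ℕ} (hn : 1 ≤ n) (hj : n ≤ j) :
    μ[fun ω => f (X j ω) | pastSigma X n] =ᵐ[μ] μ[fun ω => f (X n ω) | pastSigma X n] := by
  have hle : pastSigma X n ≤ m0 := (measurable_firstN hX n).comap_le
  have hint : ∀ i, Integrable (fun ω => f (X i ω)) μ := fun i =>
    Integrable.of_bound (hf.comp (hX i)).aestronglyMeasurable C (Eventually.of_forall fun ω => hC _)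
  refine ae_eq_condExp_of_forall_setIntegral_eq hle (hint n)
    (fun s _ _ => integrable_condExp.integrableOn) (fun s hs _ => ?_)
    stronglyMeasurable_condExp.aestronglyMeasurable
  rw [setIntegral_condExp hle (hint j) hs]
  obtain ⟨B, hB, rfl⟩ := hs
  have hid := hcid n (j - n + 1) hn (by omega)
  have hidx : n + (j - n + 1) - 1 = j := by omega
  rw [hidx] at hid
  have hu : Measurable fun p : (Fin n → ℝ) × ℝ => B.indicator (fun _ => (1 : ℝ)) p.1 * f p.2 :=
    ((measurable_const.indicator hB).comp measurable_fst).mul (hf.comp measurable_snd)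
  have h1 := (hid.comp hu).integral_eq
  have h2 : ∀ i, ∫ ω in firstN X n ⁻¹' B, f (X i ω) ∂μ
      = ∫ ω, B.indicator (fun _ => (1 : ℝ)) (firstN X n ω) * f (X i ω) ∂μ := by
    intro i
    rw [← integral_indicator (measurable_firstN hX n hB)]
    congr 1
    funext ω
    by_cases h : firstN X n ω ∈ B
    · rw [Set.indicator_of_mem (show ω ∈ firstN X n ⁻¹' B from h), Set.indicator_of_mem h, one_mul]
    · rw [Set.indicator_of_notMem (show ω ∉ firstN X n ⁻¹' B from h), Set.indicator_of_notMem h,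
        zero_mul]
  rw [h2, h2]
  exact h1.symm

/-- For a bounded measurable function `f` of a c.i.d. sequence, the predictive means converge, and
so do the empirical means, to the same limit. -/
lemma IsCID.exists_limit (hcid : IsCID X μ) (hX : ∀ n, Measurable (X n)) {f : ℝ → ℝ}
    (hf : Measurable f) {C : ℝ} (hC : ∀ x, |f x| ≤ C) :
    ∃ L : Ω → ℝ, Integrable L μ ∧ ∫ ω, L ω ∂μ = ∫ ω, f (X 1 ω) ∂μ ∧
      (∀ᵐ ω ∂μ, Tendsto (fun n => (μ[fun ω => f (X n ω) | pastSigma X n]) ω) atTop (𝓝 (L ω))) ∧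
      (∀ᵐ ω ∂μ, Tendsto (fun n : ℕ => (n : ℝ)⁻¹ * ∑ i ∈ Finset.range n, f (X i ω)) atTop
        (𝓝 (L ω))) := by
  set ℱ := pastFiltration X hX with hℱ
  set M : ℕ → Ω → ℝ := fun n => μ[fun ω => f (X n ω) | ℱ n] with hM
  have hfX : ∀ i, Measurable fun ω => f (X i ω) := fun i => hf.comp (hX i)
  have hint : ∀ i, Integrable (fun ω => f (X i ω)) μ := fun i =>
    Integrable.of_bound (hfX i).aestronglyMeasurable C (Eventually.of_forall fun ω => hC _)
  have hMb : ∀ n, ∀ᵐ ω ∂μ, |M n ω| ≤ C := fun n =>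
    ae_bdd_abs_condExp_of_ae_bdd_abs (Eventually.of_forall fun ω => hC _)
  have hC0 : 0 ≤ C := (abs_nonneg _).trans (hC 0)
  -- Time starts at `1` because the c.i.d. identity is assumed only for `n ≥ 1`.
  have hmart : Martingale (fun n => M (1 + n)) (shiftFiltration ℱ 1) μ := by
    refine martingale_nat (fun n => stronglyMeasurable_condExp) (fun n => integrable_condExp)
      fun n => ?_
    have h1 : μ[M (1 + (n + 1)) | ℱ (1 + n)] =ᵐ[μ] μ[fun ω => f (X (1 + (n + 1)) ω) | ℱ (1 + n)] :=
      condExp_condExp_of_le (ℱ.mono (by omega)) (ℱ.le _)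
    exact (h1.trans (hcid.condExp_eq hX hf hC (by omega) (by omega))).symm
  have hbdd : ∀ n, eLpNorm (M (1 + n)) 1 μ ≤ (C.toNNReal : ℝ≥0∞) := by
    intro n
    have := eLpNorm_le_of_ae_bound (p := 1) (f := M (1 + n)) (C := C) (μ := μ) (hMb _)
    simpa [ENNReal.ofReal] using this
  set L : Ω → ℝ := Filtration.limitProcess (fun n => M (1 + n)) (shiftFiltration ℱ 1) μ with hL
  have hlim' := hmart.submartingale.ae_tendsto_limitProcess hbdd
  have hlim : ∀ᵐ ω ∂μ, Tendsto (fun n => M n ω) atTop (𝓝 (L ω)) := by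
    filter_upwards [hlim'] with ω h
    refine (tendsto_add_atTop_iff_nat 1).1 ?_
    exact h.congr fun n => by rw [add_comm]
  have hLm : AEStronglyMeasurable L μ :=
    (Filtration.stronglyMeasurable_limitProcess.mono
      (iSup_le fun n => (shiftFiltration ℱ 1).le n)).aestronglyMeasurable
  have hLb : ∀ᵐ ω ∂μ, |L ω| ≤ C := by
    filter_upwards [hlim, ae_all_iff.2 hMb] with ω h1 h2
    exact le_of_tendsto h1.abs (Eventually.of_forall h2)
  have hLi : Integrable L μ := Integrable.of_bound hLm C hLb
  refine ⟨L, hLi, ?_, hlim, ?_⟩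
  · have h1 := tendsto_integral_of_dominated_convergence (μ := μ) (fun _ => C)
      (fun n => (integrable_condExp (μ := μ) (m := ℱ n)
        (f := fun ω => f (X n ω))).aestronglyMeasurable) (integrable_const C) hMb hlim
    refine tendsto_nhds_unique h1 (tendsto_const_nhds.congr' ?_)
    filter_upwards [eventually_ge_atTop 1] with n hn
    have h2 : ∫ ω, M n ω ∂μ = ∫ ω, f (X n ω) ∂μ := integral_condExp (ℱ.le n)
    have h3 : ∫ ω, (μ[fun ω => f (X n ω) | ℱ 1]) ω ∂μ = ∫ ω, f (X n ω) ∂μ :=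
      integral_condExp (ℱ.le 1)
    have h4 : ∫ ω, (μ[fun ω => f (X 1 ω) | ℱ 1]) ω ∂μ = ∫ ω, f (X 1 ω) ∂μ :=
      integral_condExp (ℱ.le 1)
    rw [h2, ← h3, ← h4]
    exact integral_congr_ae (hcid.condExp_eq hX hf hC le_rfl hn).symm
  · have hfm : ∀ j, StronglyMeasurable[ℱ (j + 1)] fun ω => f (X j ω) := fun j =>
      (hf.comp (measurable_pastSigma (Nat.lt_succ_self j))).stronglyMeasurable
    have hdb : ∀ j, ∀ᵐ ω ∂μ, |f (X j ω) - M j ω| ≤ 2 * C := fun j => by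
      filter_upwards [hMb j] with ω h
      have := abs_sub (f (X j ω)) (M j ω)
      linarith [hC (X j ω)]
    -- Each `f (X j)` is compared with its predictive mean `M j`; the Cesàro means of `M` have the
    -- limit of `M`.
    have hslln := ae_tendsto_average_martingaleDiff (μ := μ) ℱ
      (d := fun j ω => f (X j ω) - M j ω)
      (fun j => (hfm j).sub (stronglyMeasurable_condExp.mono (ℱ.mono (Nat.le_succ j))))
      (fun j => ⟨2 * C, hdb j⟩) (fun j => ?_) ?_
    · filter_upwards [hslln, hlim] with ω h1 h2
      have h3 := h1.add h2.cesaro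
      rw [zero_add] at h3
      refine h3.congr fun n => ?_
      rw [← mul_add, ← Finset.sum_add_distrib]
      simp
    · have h1 := condExp_sub (hint j) (integrable_condExp (μ := μ) (m := ℱ j)
        (f := fun ω => f (X j ω))) (ℱ j)
      have h2 : μ[M j | ℱ j] = M j := condExp_of_stronglyMeasurable (ℱ.le j)
        stronglyMeasurable_condExp integrable_condExp
      filter_upwards [h1] with ω k1
      refine k1.trans ?_
      simp only [Pi.sub_apply, Pi.zero_apply]
      change M j ω - (μ[M j | ℱ j]) ω = 0
      rw [h2, sub_self]
    · have hs : Summable fun j : ℕ => (2 * C) ^ 2 * (1 / ((j : ℝ) + 1) ^ 2) := by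
        refine Summable.mul_left _ ?_
        have := (summable_nat_add_iff 1).2 (Real.summable_one_div_nat_pow.2 one_lt_two)
        simpa using this
      refine hs.of_nonneg_of_le (fun j => div_nonneg (integral_nonneg fun ω => sq_nonneg _)
        (by positivity)) fun j => ?_
      rw [mul_one_div]
      gcongr
      have hdm : AEStronglyMeasurable (fun ω => f (X j ω) - M j ω) μ :=
        (hint j).aestronglyMeasurable.sub integrable_condExp.aestronglyMeasurable
      calc ∫ ω, (f (X j ω) - M j ω) ^ 2 ∂μ ≤ ∫ _, (2 * C) ^ 2 ∂μ := by
            refine integral_mono_ae ((AEBdd.pow ⟨2 * C, hdb j⟩ 2).integrable (hdm.pow 2))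
              (integrable_const _) ?_
            filter_upwards [hdb j] with ω h
            exact sq_le_sq' (by linarith [(abs_le.1 h).1]) (abs_le.1 h).2
        _ = (2 * C) ^ 2 := by simp

end CID

/-! ### Existence of weak limits from characteristic functions and tightness -/

section Tight

/-- The limit law is not known in advance: Prokhorov's theorem supplies a cluster point, whose
characteristic function must agree with the limits on `D`, and the dense-set criterion then gives
full convergence. -/
lemma exists_tendsto_of_tendsto_charFun {ν : ℕ → ProbabilityMeasure ℝ} {D : Set ℝ} (hD : Dense D)
    (hchar : ∀ u ∈ D, ∃ c, Tendsto (fun n => charFun (ν n : Measure ℝ) u) atTop (𝓝 c))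
    (htight : ∀ ε > 0, ∃ R : ℝ, ∀ᶠ n in atTop, (ν n : Measure ℝ).real {y | R < ‖y‖} ≤ ε) :
    ∃ ν₀, Tendsto ν atTop (𝓝 ν₀) := by
  have hT : IsTightMeasureSet (Set.range fun n => (ν n : Measure ℝ)) := by
    refine isTightMeasureSet_range_of_tendsto_limsup_measure_norm_gt ?_
    rw [ENNReal.tendsto_atTop_zero]
    intro ε hε
    obtain ⟨δ, hδ0, hδ⟩ : ∃ δ : ℝ, 0 < δ ∧ ENNReal.ofReal δ ≤ ε := by
      rcases eq_or_ne ε ∞ with rfl | h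
      · exact ⟨1, one_pos, le_top⟩
      · exact ⟨ε.toReal, ENNReal.toReal_pos hε.ne' h, ENNReal.ofReal_toReal_le⟩
    obtain ⟨R, hR⟩ := htight δ hδ0
    refine ⟨R, fun r hr => ?_⟩
    refine (limsup_le_of_le (by isBoundedDefault) ?_).trans hδ
    filter_upwards [hR] with n hn
    rw [← ENNReal.ofReal_toReal (measure_ne_top (ν n : Measure ℝ) _)]
    refine ENNReal.ofReal_le_ofReal (le_trans ?_ hn)
    exact measureReal_mono fun y (hy : r < ‖y‖) => lt_of_le_of_lt hr hy
  have hT' : IsTightMeasureSet {((m : ProbabilityMeasure ℝ) : Measure ℝ) | m ∈ Set.range ν} := by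
    convert hT using 1
    ext m
    simp
  obtain ⟨ν₀, -, hν₀⟩ := (isCompact_closure_of_isTightMeasureSet hT').exists_mapClusterPt
    (u := ν) (f := atTop) (by
      rw [Filter.le_principal_iff]
      exact Filter.mem_map.2 (Eventually.of_forall fun n => subset_closure ⟨n, rfl⟩))
  refine ⟨ν₀, tendsto_of_tendsto_charFun_of_dense hD (fun u hu => ?_) htight⟩
  obtain ⟨c, hc⟩ := hchar u hu
  have hcont : Continuous fun m : ProbabilityMeasure ℝ => charFun (m : Measure ℝ) u := by
    refine continuous_iff_continuousAt.2 fun m => ?_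
    simp_rw [ContinuousAt, charFun_eq_integral_innerProbChar]
    exact (ProbabilityMeasure.tendsto_iff_forall_integral_rclike_tendsto ℂ).1 tendsto_id _
  have h1 : MapClusterPt (charFun (ν₀ : Measure ℝ) u) atTop fun n => charFun (ν n : Measure ℝ) u :=
    hν₀.continuousAt_comp hcont.continuousAt
  have h2 : ClusterPt (charFun (ν₀ : Measure ℝ) u) (𝓝 c) := ClusterPt.mono h1 hc
  rwa [eq_of_nhds_neBot h2]

end Tight

/-! ### The weak limit of the empirical distributions and its distribution function -/

section EmpiricalLimit

/-- As `sin x = cos (x - π / 2)`, real cosines with a free phase carry all of the characteristic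
function; hence the phase `θ` in the limit theorems. -/
lemma charFun_eq_integral_cos {E : Type*} [NormedAddCommGroup E] [InnerProductSpace ℝ E]
    [MeasurableSpace E] [BorelSpace E] [SecondCountableTopology E] (ν : Measure E)
    [IsProbabilityMeasure ν] (u : E) :
    charFun ν u = ((∫ y, Real.cos (0 + inner ℝ y u) ∂ν : ℝ) : ℂ)
      + ((∫ y, Real.cos (-(Real.pi / 2) + inner ℝ y u) ∂ν : ℝ) : ℂ) * Complex.I := by
  have hm : Measurable fun y : E => inner ℝ y u := by fun_prop
  have hi : ∀ θ : ℝ, Integrable (fun y : E => Real.cos (θ + inner ℝ y u)) ν := fun θ =>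
    (AEBdd.of_le 1 fun ω => Real.abs_cos_le_one _).integrable
      (Real.measurable_cos.comp (measurable_const.add hm)).aestronglyMeasurable
  rw [charFun_apply, ← integral_complex_ofReal, ← integral_complex_ofReal, ← integral_mul_const,
    ← integral_add (hi _).ofReal ((hi _).ofReal.mul_const _)]
  congr 1
  funext y
  have : Real.cos (-(Real.pi / 2) + inner ℝ y u) = Real.sin (inner ℝ y u) := by
    rw [neg_add_eq_sub, Real.cos_sub_pi_div_two]
  rw [this, Complex.exp_mul_I, zero_add]
  push_cast
  rfl

variable {Ω : Type*} [m0 : MeasurableSpace Ω] {μ : Measure Ω} [IsProbabilityMeasure μ]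
  {X : ℕ → Ω → ℝ}

lemma IsCID.exists_limit_empirical (hcid : IsCID X μ) (hX : ∀ n, Measurable (X n)) {f : ℝ → ℝ}
    (hf : Measurable f) {C : ℝ} (hC : ∀ x, |f x| ≤ C) :
    ∃ L : Ω → ℝ, Integrable L μ ∧ ∫ ω, L ω ∂μ = ∫ ω, f (X 1 ω) ∂μ ∧
      (∀ᵐ ω ∂μ, Tendsto (fun n => (μ[fun ω => f (X n ω) | pastSigma X n]) ω) atTop (𝓝 (L ω))) ∧
      (∀ᵐ ω ∂μ, Tendsto (fun n : ℕ => ∫ x, f x ∂(empirical X n ω : Measure ℝ)) atTop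
        (𝓝 (L ω))) := by
  obtain ⟨L, h1, h2, h3, h4⟩ := hcid.exists_limit hX hf hC
  refine ⟨L, h1, h2, h3, ?_⟩
  filter_upwards [h4] with ω h
  refine ((tendsto_add_atTop_iff_nat 1).2 h).congr fun n => ?_
  rw [integral_empirical]

lemma tendsto_integral_indicator_norm_gt (ν : Measure Ω) [IsProbabilityMeasure ν] {Y : Ω → ℝ}
    (hY : Measurable Y) :
    Tendsto (fun R : ℕ => ∫ ω, Set.indicator {y : ℝ | (R : ℝ) < ‖y‖} (fun _ => (1 : ℝ)) (Y ω) ∂ν)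
      atTop (𝓝 0) := by
  have hm : ∀ R : ℕ, MeasurableSet {y : ℝ | (R : ℝ) < ‖y‖} := fun R =>
    measurableSet_lt measurable_const measurable_norm
  have := tendsto_integral_of_dominated_convergence (μ := ν) (F := fun (R : ℕ) ω =>
    Set.indicator {y : ℝ | (R : ℝ) < ‖y‖} (fun _ => (1 : ℝ)) (Y ω)) (f := fun _ => 0) (fun _ => 1)
    (fun R => ((measurable_const.indicator (hm R)).comp hY).aestronglyMeasurable)
    (integrable_const 1) (fun R => Eventually.of_forall fun ω => ?_)
    (Eventually.of_forall fun ω => ?_)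
  · simpa using this
  · refine (norm_indicator_le_norm_self _ _).trans ?_
    simp
  · refine tendsto_const_nhds.congr' ?_
    filter_upwards [tendsto_natCast_atTop_atTop.eventually (eventually_ge_atTop ‖Y ω‖)] with R hR
    rw [Set.indicator_of_notMem]
    exact not_lt.2 hR

/-- The empirical distributions of a c.i.d. sequence converge weakly almost surely. -/
theorem IsCID.ae_tendsto_empirical (hcid : IsCID X μ) (hX : ∀ n, Measurable (X n)) :
    ∀ᵐ ω ∂μ, Tendsto (fun n => empirical X n ω) atTop (𝓝 (limitDist X ω)) := by
  have hcos : ∀ (θ : ℝ) (u : ℝ), Measurable fun x : ℝ => Real.cos (θ + inner ℝ x u) := fun θ u =>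
    by fun_prop
  have hchar : ∀ᵐ ω ∂μ, ∀ q : ℚ, ∃ c, Tendsto
      (fun n => charFun (empirical X n ω : Measure ℝ) (q : ℝ)) atTop (𝓝 c) := by
    refine ae_all_iff.2 fun q => ?_
    obtain ⟨L₀, -, -, -, h₀⟩ := hcid.exists_limit_empirical hX (hcos 0 q)
      fun x => Real.abs_cos_le_one _
    obtain ⟨L₁, -, -, -, h₁⟩ := hcid.exists_limit_empirical hX (hcos (-(Real.pi / 2)) q)
      fun x => Real.abs_cos_le_one _
    filter_upwards [h₀, h₁] with ω k₀ k₁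
    simp_rw [charFun_eq_integral_cos]
    exact ⟨_, ((Complex.continuous_ofReal.tendsto _).comp k₀).add
      (((Complex.continuous_ofReal.tendsto _).comp k₁).mul_const _)⟩
  have htight : ∀ᵐ ω ∂μ, ∀ ε > 0, ∃ R : ℝ, ∀ᶠ n in atTop,
      (empirical X n ω : Measure ℝ).real {y | R < ‖y‖} ≤ ε := by
    have hm : ∀ R : ℕ, MeasurableSet {y : ℝ | (R : ℝ) < ‖y‖} := fun R =>
      measurableSet_lt measurable_const measurable_norm
    have hb : ∀ (R : ℕ) (x : ℝ),
        |Set.indicator {y : ℝ | (R : ℝ) < ‖y‖} (fun _ => (1 : ℝ)) x| ≤ 1 := fun R x => by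
      refine (norm_indicator_le_norm_self (fun _ => (1 : ℝ)) x).trans ?_
      simp
    choose L hLi hLint _hM hL using fun R : ℕ => hcid.exists_limit_empirical hX
      (measurable_const.indicator (hm R)) (hb R)
    have hreal : ∀ (R n : ℕ) (ω : Ω), ∫ x, Set.indicator {y : ℝ | (R : ℝ) < ‖y‖}
        (fun _ => (1 : ℝ)) x ∂(empirical X n ω : Measure ℝ)
          = (empirical X n ω : Measure ℝ).real {y | (R : ℝ) < ‖y‖} := fun R n ω => by
      rw [integral_indicator (hm R)]; simp
    simp_rw [hreal] at hL
    -- The limiting tail masses decrease in `R`, and their means are tail probabilities of the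
    -- single variable `X 1`, which tend to `0`.
    have hL0 : ∀ᵐ ω ∂μ, Tendsto (fun R => L R ω) atTop (𝓝 0) := by
      refine ae_tendsto_zero_of_antitone hLi (fun R => ?_) (fun R => ?_) ?_
      · filter_upwards [hL R] with ω h using ge_of_tendsto' h fun n => measureReal_nonneg
      · filter_upwards [hL R, hL (R + 1)] with ω h h'
        refine le_of_tendsto_of_tendsto' h' h fun n => measureReal_mono fun y hy => ?_
        simp only [Set.mem_ofPred_eq, Nat.cast_add, Nat.cast_one] at hy ⊢
        linarith
      · simp_rw [hLint]
        exact tendsto_integral_indicator_norm_gt μ (hX 1)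
    filter_upwards [ae_all_iff.2 hL, hL0] with ω h1 h2 ε hε
    obtain ⟨R, hR⟩ := (h2.eventually (gt_mem_nhds hε)).exists
    exact ⟨R, (h1 R).eventually (ge_mem_nhds hR)⟩
  filter_upwards [hchar, htight] with ω h1 h2
  refine tendsto_nhds_limUnder (exists_tendsto_of_tendsto_charFun (D := Set.range ((↑) : ℚ → ℝ))
    Rat.denseRange_cast ?_ h2)
  rintro _ ⟨q, rfl⟩
  exact h1 q

/-- A piecewise linear upper approximation of the indicator of `(-∞, t]`. -/
def ramp (t : ℝ) (m : ℕ) (x : ℝ) : ℝ := max 0 (min 1 (1 - m * (x - t)))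

lemma continuous_ramp (t : ℝ) (m : ℕ) : Continuous (ramp t m) := by unfold ramp; fun_prop

lemma ramp_nonneg (t : ℝ) (m : ℕ) (x : ℝ) : 0 ≤ ramp t m x := le_max_left _ _

lemma ramp_le_one (t : ℝ) (m : ℕ) (x : ℝ) : ramp t m x ≤ 1 :=
  max_le zero_le_one (min_le_left _ _)

lemma abs_ramp_le (t : ℝ) (m : ℕ) (x : ℝ) : |ramp t m x| ≤ 1 := by
  rw [abs_of_nonneg (ramp_nonneg t m x)]
  exact ramp_le_one t m x

lemma ramp_of_le {t x : ℝ} (m : ℕ) (h : x ≤ t) : ramp t m x = 1 := by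
  have : (1 : ℝ) ≤ 1 - m * (x - t) := by
    have : (m : ℝ) * (x - t) ≤ 0 := mul_nonpos_of_nonneg_of_nonpos (by positivity) (by linarith)
    linarith
  simp [ramp, min_eq_left this]

lemma indicator_le_ramp (t : ℝ) (m : ℕ) (x : ℝ) :
    Set.indicator (Set.Iic t) (fun _ => (1 : ℝ)) x ≤ ramp t m x := by
  by_cases h : x ≤ t
  · rw [ramp_of_le m h, Set.indicator_of_mem (Set.mem_Iic.2 h)]
  · rw [Set.indicator_of_notMem (by simpa using h)]
    exact ramp_nonneg t m x

lemma ramp_succ_le (t : ℝ) (m : ℕ) (x : ℝ) : ramp t (m + 1) x ≤ ramp t m x := by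
  by_cases h : x ≤ t
  · rw [ramp_of_le _ h, ramp_of_le _ h]
  · unfold ramp
    gcongr
    · linarith
    · linarith

lemma tendsto_ramp (t x : ℝ) : Tendsto (fun m => ramp t m x) atTop
    (𝓝 (Set.indicator (Set.Iic t) (fun _ => (1 : ℝ)) x)) := by
  refine tendsto_const_nhds.congr' ?_
  by_cases h : x ≤ t
  · exact Eventually.of_forall fun m => by
      simp only [ramp_of_le m h, Set.indicator_of_mem (Set.mem_Iic.2 h)]
  · rw [not_le] at h
    rw [Set.indicator_of_notMem (by simpa using h)]
    filter_upwards [tendsto_natCast_atTop_atTop.eventually (eventually_ge_atTop (1 / (x - t)))]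
      with m hm
    have : (1 : ℝ) ≤ m * (x - t) := by
      rwa [div_le_iff₀ (by linarith)] at hm
    rw [ramp, max_eq_left]
    exact (min_le_right _ _).trans (by linarith)

lemma tendsto_integral_ramp {α : Type*} [MeasurableSpace α] (ν : Measure α) [IsProbabilityMeasure ν]
    (t : ℝ) {Y : α → ℝ} (hY : Measurable Y) :
    Tendsto (fun m => ∫ a, ramp t m (Y a) ∂ν) atTop
      (𝓝 (∫ a, Set.indicator (Set.Iic t) (fun _ => (1 : ℝ)) (Y a) ∂ν)) :=
  tendsto_integral_of_dominated_convergence (fun _ => 1)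
    (fun m => ((continuous_ramp t m).measurable.comp hY).aestronglyMeasurable)
    (integrable_const 1) (fun m => Eventually.of_forall fun _ => abs_ramp_le t m _)
    (Eventually.of_forall fun _ => tendsto_ramp t _)

/-- The limit distribution function of a c.i.d. sequence is the almost sure limit of the
predictive probabilities. -/
theorem IsCID.ae_tendsto_condExp_limitCDF (hcid : IsCID X μ) (hX : ∀ n, Measurable (X n)) (t : ℝ) :
    ∀ᵐ ω ∂μ, Tendsto (fun n => (μ[fun ω => Set.indicator (Set.Iic t) (fun _ => (1 : ℝ)) (X n ω) |
      pastSigma X n]) ω) atTop (𝓝 (limitCDF X t ω)) := by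
  have hind : Measurable (Set.indicator (Set.Iic t) (fun _ => (1 : ℝ))) :=
    measurable_const.indicator measurableSet_Iic
  obtain ⟨L, hLi, hLint, hLM, hLe⟩ := hcid.exists_limit_empirical hX hind (C := 1) fun x => by
    refine (norm_indicator_le_norm_self (fun _ => (1 : ℝ)) x).trans ?_
    simp
  choose R hRi hRint _hM hRe using fun m => hcid.exists_limit_empirical hX
    (continuous_ramp t m).measurable (abs_ramp_le t m)
  have hint : ∀ (ν : ProbabilityMeasure ℝ) m, Integrable (ramp t m) (ν : Measure ℝ) := fun ν m =>
    (AEBdd.of_le 1 (abs_ramp_le t m)).integrable (continuous_ramp t m).aestronglyMeasurable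
  have hint' : ∀ ν : ProbabilityMeasure ℝ,
      Integrable (Set.indicator (Set.Iic t) (fun _ => (1 : ℝ))) (ν : Measure ℝ) := fun ν =>
    (integrable_const 1).indicator measurableSet_Iic
  -- Weak convergence does not test the discontinuous indicator directly. The limits `R m` of the
  -- ramps decrease, stay above `L`, and have means converging to that of `L`, hence they converge
  -- to `L` almost surely.
  have hdiff : ∀ᵐ ω ∂μ, Tendsto (fun m => R m ω - L ω) atTop (𝓝 0) := by
    refine ae_tendsto_zero_of_antitone (f := fun m ω => R m ω - L ω) (fun m => (hRi m).sub hLi)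
      (fun m => ?_) (fun m => ?_) ?_
    · filter_upwards [hRe m, hLe] with ω h1 h2
      exact sub_nonneg.2 (le_of_tendsto_of_tendsto' h2 h1 fun n =>
        integral_mono (hint' _) (hint _ m) (indicator_le_ramp t m))
    · filter_upwards [hRe m, hRe (m + 1)] with ω h1 h2
      exact sub_le_sub_right (le_of_tendsto_of_tendsto' h2 h1 fun n =>
        integral_mono (hint _ _) (hint _ m) (ramp_succ_le t m)) _
    · have h1 := (tendsto_integral_ramp μ t (hX 1)).sub_const (∫ ω, L ω ∂μ)
      rw [hLint, sub_self] at h1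
      refine h1.congr fun m => ?_
      rw [integral_sub (hRi m) hLi, hRint, hLint]
  filter_upwards [hdiff, hLM, ae_all_iff.2 hRe, hcid.ae_tendsto_empirical hX] with ω h1 h2 h3 h4
  have h5 : ∀ m, ∫ x, ramp t m x ∂(limitDist X ω : Measure ℝ) = R m ω := fun m => by
    have := (ProbabilityMeasure.tendsto_iff_forall_integral_tendsto.1 h4)
      (BoundedContinuousFunction.ofNormedAddCommGroup (ramp t m) (continuous_ramp t m) 1
        (abs_ramp_le t m))
    exact tendsto_nhds_unique this (h3 m)
  have h6 := tendsto_integral_ramp (limitDist X ω : Measure ℝ) t measurable_id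
  simp only [id, h5] at h6
  have h7 : limitCDF X t ω = L ω := by
    have h8 : ∫ x, Set.indicator (Set.Iic t) (fun _ => (1 : ℝ)) x ∂(limitDist X ω : Measure ℝ)
        = limitCDF X t ω := by
      rw [integral_indicator measurableSet_Iic]
      simp [limitCDF]
    rw [h8] at h6
    refine tendsto_nhds_unique h6 ?_
    simpa using h1.add_const (L ω)
  rwa [h7]

end EmpiricalLimit

/-! ### Strong law for averages of adapted variables -/

section Averages

variable {Ω : Type*} {m0 : MeasurableSpace Ω} {μ : Measure Ω} [IsProbabilityMeasure μ]

/-- Conditional expectation is an orthogonal projection in `L²`, so centring does not increase the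
second moment. -/
lemma integral_sub_condExp_sq_le {m : MeasurableSpace Ω} (hm : m ≤ m0) {Y : Ω → ℝ}
    (hY : AEStronglyMeasurable[m0] Y μ) (hYb : AEBdd μ Y) :
    ∫ ω, (Y ω - (μ[Y | m]) ω) ^ 2 ∂μ ≤ ∫ ω, Y ω ^ 2 ∂μ := by
  have hYi := hYb.integrable hY
  have hgm : StronglyMeasurable[m] (μ[Y | m]) := stronglyMeasurable_condExp
  have hgb : AEBdd μ (μ[Y | m]) := hYb.condExp m
  have hga : AEStronglyMeasurable[m0] (μ[Y | m]) μ := (hgm.mono hm).aestronglyMeasurable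
  have i1 : Integrable (fun ω => Y ω ^ 2) μ := (hYb.pow 2).integrable (hY.pow 2)
  have i2 : Integrable (fun ω => (μ[Y | m]) ω ^ 2) μ := (hgb.pow 2).integrable (hga.pow 2)
  have i3 : Integrable (fun ω => (μ[Y | m]) ω * Y ω) μ := (hgb.mul hYb).integrable (hga.mul hY)
  have h1 : ∫ ω, (μ[Y | m]) ω * Y ω ∂μ = ∫ ω, (μ[Y | m]) ω ^ 2 ∂μ := by
    rw [← integral_condExp hm]
    refine integral_congr_ae ?_
    filter_upwards [condExp_mul_left_of_bdd hm hgm hgb hYi] with ω h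
    rw [h, sq]
  have h2 : ∫ ω, (Y ω - (μ[Y | m]) ω) ^ 2 ∂μ
      = ∫ ω, Y ω ^ 2 ∂μ - 2 * ∫ ω, (μ[Y | m]) ω * Y ω ∂μ + ∫ ω, (μ[Y | m]) ω ^ 2 ∂μ := by
    have i4 : Integrable (fun ω => Y ω ^ 2 - 2 * ((μ[Y | m]) ω * Y ω)) μ :=
      i1.sub (i3.const_mul 2)
    rw [← integral_const_mul, ← integral_sub i1 (i3.const_mul 2), ← integral_add i4 i2]
    refine integral_congr_ae (Eventually.of_forall fun ω => ?_)
    simp only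
    ring
  have h3 : 0 ≤ ∫ ω, (μ[Y | m]) ω ^ 2 ∂μ := integral_nonneg fun ω => sq_nonneg _
  rw [h2, h1]
  linarith

/-- Averages of a bounded adapted sequence follow its conditional expectations. -/
lemma ae_tendsto_average_of_condExp (ℱ : Filtration ℕ m0) {Y : ℕ → Ω → ℝ} {l : Ω → ℝ}
    (hY : ∀ j, StronglyMeasurable[ℱ (j + 1)] (Y j)) (hYb : ∀ j, AEBdd μ (Y j))
    (hs : Summable fun j : ℕ => (∫ ω, Y j ω ^ 2 ∂μ) / ((j : ℝ) + 1) ^ 2)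
    (hl : ∀ᵐ ω ∂μ, Tendsto (fun j => (μ[Y j | ℱ j]) ω) atTop (𝓝 (l ω))) :
    ∀ᵐ ω ∂μ, Tendsto (fun n : ℕ => (n : ℝ)⁻¹ * ∑ i ∈ Finset.range n, Y i ω) atTop (𝓝 (l ω)) := by
  have hYa : ∀ j, AEStronglyMeasurable (Y j) μ := fun j =>
    ((hY j).mono (ℱ.le _)).aestronglyMeasurable
  have hc : ∀ j, StronglyMeasurable[ℱ j] (μ[Y j | ℱ j]) := fun j => stronglyMeasurable_condExp
  have h1 := ae_tendsto_average_martingaleDiff (μ := μ) ℱ (d := fun j ω => Y j ω - (μ[Y j | ℱ j]) ω)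
    (fun j => (hY j).sub ((hc j).mono (ℱ.mono (Nat.le_succ j))))
    (fun j => (hYb j).sub ((hYb j).condExp _)) (fun j => ?_) ?_
  · filter_upwards [h1, hl] with ω k1 k2
    have k3 := k1.add k2.cesaro
    rw [zero_add] at k3
    refine k3.congr fun n => ?_
    rw [← mul_add, ← Finset.sum_add_distrib]
    simp
  · have := condExp_sub ((hYb j).integrable (hYa j)) integrable_condExp (ℱ j) (μ := μ)
      (g := μ[Y j | ℱ j])
    rw [condExp_of_stronglyMeasurable (ℱ.le j) (hc j) integrable_condExp] at this
    filter_upwards [this] with ω h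
    refine Eq.trans h ?_
    simp
  · refine Summable.of_nonneg_of_le (fun j => ?_) (fun j => ?_) hs
    · exact div_nonneg (integral_nonneg fun ω => sq_nonneg _) (by positivity)
    · exact div_le_div_of_nonneg_right (integral_sub_condExp_sq_le (ℱ.le j) (hYa j) (hYb j))
        (by positivity)

end Averages

/-! ### The predictive martingale and convergence of the matrices `V` -/

section Predictive

variable {Ω : Type*} {X : ℕ → Ω → ℝ} {P : ∀ n : ℕ, Kernel (Fin n → ℝ) ℝ}

lemma stronglyMeasurable_predCDF (n : ℕ) (t : ℝ) :
    StronglyMeasurable[pastSigma X n] (predCDF X P n t) := by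
  have h : Measurable fun x => (P n x).real (Set.Iic t) :=
    ((P n).measurable_coe measurableSet_Iic).ennreal_toReal
  exact (h.comp (comap_measurable (firstN X n))).stronglyMeasurable

variable [∀ n, IsMarkovKernel (P n)]

lemma abs_predCDF_le (n : ℕ) (t : ℝ) (ω : Ω) : |predCDF X P n t ω| ≤ 1 := by
  rw [predCDF, abs_of_nonneg measureReal_nonneg]
  exact measureReal_le_one

variable [m0 : MeasurableSpace Ω] {μ : Measure Ω} [IsProbabilityMeasure μ]

lemma predCDF_ae_eq (hX : ∀ n, Measurable (X n)) (hP : IsPredictiveRule X μ P) (n : ℕ) (t : ℝ) :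
    predCDF X P n t =ᵐ[μ]
      μ[fun ω => Set.indicator (Set.Iic t) (fun _ => (1 : ℝ)) (X n ω) | pastSigma X n] := by
  have h1 := ae_of_ae_map (measurable_firstN hX n).aemeasurable
    (condDistrib_ae_eq_of_measure_eq_compProd (firstN X n) (hX n).aemeasurable (hP n).map_eq)
  have h2 := condDistrib_ae_eq_condExp (μ := μ) (measurable_firstN hX n) (hX n)
    (measurableSet_Iic (a := t))
  filter_upwards [h1, h2] with ω k1 k2
  rw [predCDF, ← k1, k2]
  rfl

lemma ae_tendsto_predCDF (hX : ∀ n, Measurable (X n)) (hcid : IsCID X μ)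
    (hP : IsPredictiveRule X μ P) (t : ℝ) :
    ∀ᵐ ω ∂μ, Tendsto (fun n => predCDF X P n t ω) atTop (𝓝 (limitCDF X t ω)) := by
  filter_upwards [hcid.ae_tendsto_condExp_limitCDF hX t,
    ae_all_iff.2 fun n => predCDF_ae_eq hX hP n t] with ω h1 h2
  exact h1.congr fun n => (h2 n).symm

/-- The martingale property: the tower property reduces the left side to the conditional law of `X
(n + 1)` given the first `n` observations, and the c.i.d. property replaces `X (n + 1)` by `X n`. -/
lemma condExp_predCDF_succ (hX : ∀ n, Measurable (X n)) (hcid : IsCID X μ)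
    (hP : IsPredictiveRule X μ P) (t : ℝ) {n : ℕ} (hn : 1 ≤ n) :
    μ[predCDF X P (n + 1) t | pastSigma X n] =ᵐ[μ] predCDF X P n t := by
  have hle : pastSigma X n ≤ pastSigma X (n + 1) := (pastFiltration X hX).mono (Nat.le_succ n)
  have h1 := condExp_congr_ae (m := pastSigma X n) (predCDF_ae_eq hX hP (n + 1) t)
  have h2 := condExp_condExp_of_le (μ := μ)
    (f := fun ω => Set.indicator (Set.Iic t) (fun _ => (1 : ℝ)) (X (n + 1) ω)) hle
    (measurable_firstN hX (n + 1)).comap_le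
  have h3 := hcid.condExp_eq hX (f := Set.indicator (Set.Iic t) (fun _ => (1 : ℝ)))
    (measurable_const.indicator measurableSet_Iic) (C := 1) (fun x => by
      refine (norm_indicator_le_norm_self (fun _ => (1 : ℝ)) x).trans ?_
      simp) hn (Nat.le_succ n)
  exact h1.trans (h2.trans (h3.trans (predCDF_ae_eq hX hP n t).symm))

/-- The matrices `V` converge almost surely to the limit of the conditional second moments. -/
theorem ae_tendsto_V (hX : ∀ n, Measurable (X n)) {k : ℕ} (t : Fin k → ℝ)
    (hsum : ∀ i, Summable fun n : ℕ => (n : ℝ) ^ 2 * ∫ ω, update X P (t i) n ω ^ 4 ∂μ)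
    (U : Ω → Matrix (Fin k) (Fin k) ℝ)
    (hU : ∀ i j, ∀ᵐ ω ∂μ, Tendsto (fun n : ℕ => (μ[fun ω' => (n : ℝ) ^ 2 *
      (update X P (t i) n ω' * update X P (t j) n ω') | pastSigma X (n - 1)]) ω) atTop
        (𝓝 (U ω i j))) :
    ∀ᵐ ω ∂μ, Tendsto (fun n => V X P t n ω) atTop (𝓝 (U ω)) := by
  have hDm : ∀ i n, StronglyMeasurable[pastSigma X (n + 1)] (update X P (t i) (n + 1)) :=
    fun i n => (stronglyMeasurable_predCDF (n + 1) (t i)).sub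
      ((stronglyMeasurable_predCDF n (t i)).mono ((pastFiltration X hX).mono (Nat.le_succ n)))
  have hDb : ∀ i n, AEBdd μ (update X P (t i) n) := fun i n =>
    (AEBdd.of_le 1 (abs_predCDF_le n (t i))).sub (AEBdd.of_le 1 (abs_predCDF_le (n - 1) (t i)))
  have hentry : ∀ i j, ∀ᵐ ω ∂μ, Tendsto (fun n => V X P t n ω i j) atTop (𝓝 (U ω i j)) := by
    intro i j
    have hYm : ∀ n, StronglyMeasurable[pastSigma X (n + 1)] fun ω => ((n + 1 : ℕ) : ℝ) ^ 2 *
        (update X P (t i) (n + 1) ω * update X P (t j) (n + 1) ω) := fun n =>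
      ((hDm i n).mul (hDm j n)).const_mul _
    have hYb : ∀ n, AEBdd μ fun ω => ((n + 1 : ℕ) : ℝ) ^ 2 *
        (update X P (t i) (n + 1) ω * update X P (t j) (n + 1) ω) := fun n =>
      (AEBdd.const _).mul ((hDb i _).mul (hDb j _))
    have hDa : ∀ i n, AEStronglyMeasurable (update X P (t i) (n + 1)) μ := fun i n =>
      ((hDm i n).mono (measurable_firstN hX (n + 1)).comap_le).aestronglyMeasurable
    have key := ae_tendsto_average_of_condExp (μ := μ) (pastFiltration X hX)
      (l := fun ω => U ω i j) hYm hYb ?_ ?_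
    · filter_upwards [key] with ω h
      refine h.congr fun n => ?_
      have h1 : V X P t n ω i j = (1 / (n : ℝ)) * ∑ m ∈ Finset.Icc 1 n, (m : ℝ) ^ 2 *
          (update X P (t i) m ω * update X P (t j) m ω) := by
        simp only [V, Matrix.smul_apply, Matrix.sum_apply, smul_eq_mul, Matrix.vecMulVec_apply,
          updateVec]
      rw [h1, one_div, ← Finset.Ico_add_one_right_eq_Icc, Finset.sum_Ico_eq_sum_range,
        Nat.add_sub_cancel]
      simp only [add_comm 1]
    -- Squaring `m² Δ_i Δ_j` and dividing by `m²` leaves `m² Δ_i² Δ_j² ≤ m² (Δ_i⁴ + Δ_j⁴)`, which is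
    -- summable in mean by the fourth-moment hypothesis.
    · refine Summable.of_nonneg_of_le (fun n => ?_) (fun n => ?_)
        (((summable_nat_add_iff 1).2 (hsum i)).add ((summable_nat_add_iff 1).2 (hsum j)))
      · exact div_nonneg (integral_nonneg fun ω => sq_nonneg _) (by positivity)
      · have hi4 : ∀ i, Integrable (fun ω => update X P (t i) (n + 1) ω ^ 4) μ := fun i =>
          ((hDb i _).pow 4).integrable ((hDa i n).pow 4)
        rw [← mul_add, ← integral_add (hi4 i) (hi4 j), div_le_iff₀ (by positivity), mul_right_comm,
          ← integral_const_mul]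
        refine integral_mono (((hYb n).pow 2).integrable
          (((hYm n).mono (measurable_firstN hX (n + 1)).comap_le).aestronglyMeasurable.pow 2))
          (((hi4 i).add (hi4 j)).const_mul _) fun ω => ?_
        push_cast
        have : (update X P (t i) (n + 1) ω * update X P (t j) (n + 1) ω) ^ 2
            ≤ update X P (t i) (n + 1) ω ^ 4 + update X P (t j) (n + 1) ω ^ 4 := by
          nlinarith [sq_nonneg (update X P (t i) (n + 1) ω ^ 2 - update X P (t j) (n + 1) ω ^ 2),
            sq_nonneg (update X P (t i) (n + 1) ω ^ 2), sq_nonneg (update X P (t j) (n + 1) ω ^ 2)]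
        calc _ = (((n : ℝ) + 1) ^ 2 * ((n : ℝ) + 1) ^ 2) *
              (update X P (t i) (n + 1) ω * update X P (t j) (n + 1) ω) ^ 2 := by ring
          _ ≤ _ := mul_le_mul_of_nonneg_left this (by positivity)
    · filter_upwards [hU i j] with ω h
      exact (tendsto_add_atTop_iff_nat (f := fun n : ℕ => (μ[fun ω' => (n : ℝ) ^ 2 *
        (update X P (t i) n ω' * update X P (t j) n ω') | pastSigma X (n - 1)]) ω) 1).2 h
  filter_upwards [ae_all_iff.2 fun i => ae_all_iff.2 fun j => hentry i j] with ω h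
  exact tendsto_pi_nhds.2 fun i => tendsto_pi_nhds.2 fun j => h i j

end Predictive

/-! ### Weighted tails of martingales -/

section WeightedTail

variable {Ω : Type*} {m0 : MeasurableSpace Ω} {μ : Measure Ω}

lemma condExp_sum_mul {ι : Type*} (s : Finset ι) {m : MeasurableSpace Ω} (hm : m ≤ m0)
    {g f : ι → Ω → ℝ} (hg : ∀ i, StronglyMeasurable[m] (g i)) (hgb : ∀ i, AEBdd μ (g i))
    (hf : ∀ i, Integrable (f i) μ) :
    μ[fun ω => ∑ i ∈ s, g i ω * f i ω | m] =ᵐ[μ] fun ω => ∑ i ∈ s, g i ω * (μ[f i | m]) ω := by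
  have hint : ∀ i, Integrable (fun ω => g i ω * f i ω) μ := fun i => by
    obtain ⟨C, hC⟩ := hgb i
    exact (hf i).bdd_mul ((hg i).mono hm).aestronglyMeasurable hC
  have h1 := condExp_finsetSum (s := s) (f := fun i ω => g i ω * f i ω) (fun i _ => hint i) m
  have h2 : (fun ω => ∑ i ∈ s, g i ω * f i ω) = ∑ i ∈ s, fun ω => g i ω * f i ω := by
    funext ω
    simp
  rw [h2]
  filter_upwards [h1, (Finset.eventually_all s).2 fun i _ =>
    condExp_mul_left_of_bdd hm (hg i) (hgb i) (hf i)] with ω k1 k2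
  rw [k1, Finset.sum_apply]
  exact Finset.sum_congr rfl fun i hi => k2 i hi

/-- Cauchy–Schwarz applied twice. -/
lemma sum_pow_four_le {ι : Type*} (s : Finset ι) (x : ι → ℝ) :
    (∑ i ∈ s, x i) ^ 4 ≤ (s.card : ℝ) ^ 3 * ∑ i ∈ s, x i ^ 4 := by
  have h1 := sq_sum_le_card_mul_sum_sq (s := s) (f := x)
  have h2 := sq_sum_le_card_mul_sum_sq (s := s) (f := fun i => x i ^ 2)
  simp only [← pow_mul] at h2
  norm_num at h2
  calc (∑ i ∈ s, x i) ^ 4 = ((∑ i ∈ s, x i) ^ 2) ^ 2 := by ring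
    _ ≤ (s.card * ∑ i ∈ s, x i ^ 2) ^ 2 := by gcongr
    _ = (s.card : ℝ) ^ 2 * (∑ i ∈ s, x i ^ 2) ^ 2 := by ring
    _ ≤ (s.card : ℝ) ^ 2 * (s.card * ∑ i ∈ s, x i ^ 4) := by gcongr
    _ = _ := by ring

variable {ι : Type*} [Fintype ι]

/-- The array of weighted increments `√n ∑ p, c n p * D p (n + j)`. -/
def weightedArray (D : ι → ℕ → Ω → ℝ) (c : ℕ → ι → Ω → ℝ) (n j : ℕ) (ω : Ω) : ℝ :=
  ∑ p, (Real.sqrt n * c n p ω) * D p (n + j) ω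

variable {ℱ : Filtration ℕ m0} {D : ι → ℕ → Ω → ℝ} {c : ℕ → ι → Ω → ℝ}

lemma stronglyMeasurable_weightedArray (hD : ∀ p j, StronglyMeasurable[ℱ (j + 1)] (D p j))
    (hc : ∀ n p, StronglyMeasurable[ℱ n] (c n p)) (n j : ℕ) :
    StronglyMeasurable[ℱ (n + j + 1)] (weightedArray D c n j) :=
  Finset.stronglyMeasurable_fun_sum _ fun p _ =>
    (((hc n p).mono (ℱ.mono (by omega))).const_mul _).mul (hD p (n + j))

lemma aebdd_weightedArray (hDb : ∀ p j, AEBdd μ (D p j)) (hcb : ∀ n p, AEBdd μ (c n p)) (n j : ℕ) :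
    AEBdd μ (weightedArray D c n j) :=
  AEBdd.sum _ fun p _ => ((AEBdd.const _).mul (hcb n p)).mul (hDb p (n + j))

variable [IsProbabilityMeasure μ]

lemma condExp_weightedArray (hD : ∀ p j, StronglyMeasurable[ℱ (j + 1)] (D p j))
    (hDb : ∀ p j, AEBdd μ (D p j)) (hc : ∀ n p, StronglyMeasurable[ℱ n] (c n p))
    (hcb : ∀ n p, AEBdd μ (c n p)) (h0 : ∀ p j, 1 ≤ j → μ[D p j | ℱ j] =ᵐ[μ] 0) (n j : ℕ) :
    μ[weightedArray D c n j | ℱ (n + j)] =ᵐ[μ] 0 := by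
  -- Row `0` vanishes because of the factor `√0`, so the martingale property is never needed at time
  -- `0`.
  rcases Nat.eq_zero_or_pos n with rfl | hn
  · have : weightedArray D c 0 j = 0 := by
      funext ω
      simp [weightedArray]
    rw [this, condExp_zero]
  · have h1 := condExp_sum_mul (μ := μ) Finset.univ (ℱ.le (n + j))
      (g := fun p ω => Real.sqrt n * c n p ω) (f := fun p => D p (n + j))
      (fun p => ((hc n p).mono (ℱ.mono (by omega))).const_mul _)
      (fun p => (AEBdd.const _).mul (hcb n p))
      (fun p => (hDb p _).integrable ((hD p _).mono (ℱ.le _)).aestronglyMeasurable)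
    refine h1.trans ?_
    filter_upwards [ae_all_iff.2 fun p => h0 p (n + j) (by omega)] with ω h
    simp [h]

/-- Writing `n = (n / m²) * m²` with `m = n + j + 1`, the terms `m² E[D_p D_q | past]` tend to `U`
and the weights `n / m²` have total mass tending to `1`. -/
lemma ae_tendsto_sum_condExp_weightedArray_sq
    (hD : ∀ p j, StronglyMeasurable[ℱ (j + 1)] (D p j))
    (hDb : ∀ p j, AEBdd μ (D p j)) (hc : ∀ n p, StronglyMeasurable[ℱ n] (c n p))
    (hcb : ∀ n p, AEBdd μ (c n p)) {U : Ω → Matrix ι ι ℝ}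
    (hU : ∀ p q, ∀ᵐ ω ∂μ, Tendsto (fun j : ℕ =>
      (μ[fun ω => ((j : ℝ) + 1) ^ 2 * (D p j ω * D q j ω) | ℱ j]) ω) atTop (𝓝 (U ω p q)))
    {c' : ι → Ω → ℝ} (hc' : ∀ p, ∀ᵐ ω ∂μ, Tendsto (fun n => c n p ω) atTop (𝓝 (c' p ω)))
    {N : ℕ → ℕ} (hN : ∀ n, n ^ 2 ≤ N n) :
    ∀ᵐ ω ∂μ, Tendsto (fun n => ∑ j ∈ Finset.range (N n),
      (μ[fun ω => weightedArray D c n j ω ^ 2 | ℱ (n + j)]) ω) atTop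
        (𝓝 (∑ p, ∑ q, c' p ω * c' q ω * U ω p q)) := by
  set H : ι × ι → ℕ → Ω → ℝ := fun r j =>
    μ[fun ω => ((j : ℝ) + 1) ^ 2 * (D r.1 j ω * D r.2 j ω) | ℱ j] with hH
  have h1 : ∀ n j, μ[fun ω => weightedArray D c n j ω ^ 2 | ℱ (n + j)] =ᵐ[μ] fun ω =>
      ∑ r : ι × ι, ((n : ℝ) / ((n : ℝ) + j + 1) ^ 2 * (c n r.1 ω * c n r.2 ω)) * H r (n + j) ω := by
    intro n j
    have h2 := condExp_sum_mul (μ := μ) (Finset.univ : Finset (ι × ι)) (ℱ.le (n + j))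
      (g := fun r ω => (n : ℝ) / ((n : ℝ) + j + 1) ^ 2 * (c n r.1 ω * c n r.2 ω))
      (f := fun r ω => (((n + j : ℕ) : ℝ) + 1) ^ 2 * (D r.1 (n + j) ω * D r.2 (n + j) ω))
      (fun r => (((hc n r.1).mul (hc n r.2)).const_mul _).mono (ℱ.mono (by omega)))
      (fun r => (AEBdd.const _).mul ((hcb n r.1).mul (hcb n r.2)))
      (fun r => ((AEBdd.const _).mul ((hDb r.1 _).mul (hDb r.2 _))).integrable
        ((((hD r.1 _).mul (hD r.2 _)).const_mul _).mono (ℱ.le _)).aestronglyMeasurable)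
    refine EventuallyEq.trans ?_ h2
    refine Eq.eventuallyEq ?_
    congr 1
    funext ω
    rw [weightedArray, sq, Finset.sum_mul_sum, ← Finset.univ_product_univ, Finset.sum_product]
    refine Finset.sum_congr rfl fun p _ => Finset.sum_congr rfl fun q _ => ?_
    have hs := Real.mul_self_sqrt (Nat.cast_nonneg n : (0 : ℝ) ≤ n)
    have hne : ((n : ℝ) + j + 1) ≠ 0 := by positivity
    simp only [Nat.cast_add]
    calc _ = (Real.sqrt n * Real.sqrt n) * (c n p ω * c n q ω * (D p (n + j) ω * D q (n + j) ω)) := by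
          ring
      _ = _ := by rw [hs]; field_simp
  filter_upwards [ae_all_iff.2 fun n => ae_all_iff.2 fun j => h1 n j, ae_all_iff.2 hc',
    ae_all_iff.2 fun p => ae_all_iff.2 fun q => hU p q] with ω k1 k2 k3
  simp only [k1]
  have k4 : ∀ r : ι × ι, Tendsto (fun n => (c n r.1 ω * c n r.2 ω) * ∑ j ∈ Finset.range (N n),
      (n : ℝ) / ((n : ℝ) + j + 1) ^ 2 * H r (n + j) ω) atTop
        (𝓝 (c' r.1 ω * c' r.2 ω * U ω r.1 r.2)) := fun r =>
    ((k2 r.1).mul (k2 r.2)).mul (tendsto_sum_inv_sq_mul hN (k3 r.1 r.2))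
  have k5 := tendsto_finsetSum Finset.univ fun r (_ : r ∈ Finset.univ) => k4 r
  rw [← Finset.univ_product_univ, Finset.sum_product] at k5
  refine k5.congr fun n => ?_
  rw [Finset.univ_product_univ, Finset.sum_comm]
  refine Finset.sum_congr rfl fun r _ => ?_
  rw [Finset.mul_sum]
  exact Finset.sum_congr rfl fun j _ => by ring

/-- The factor `√n ^ 4 = n²` is at most `(n + j + 1)²`, so the sum is bounded by convergent
coefficients times the tail of a series that converges almost surely, since its expectations are
summable. -/
lemma ae_tendsto_sum_condExp_weightedArray_pow_four
    (hD : ∀ p j, StronglyMeasurable[ℱ (j + 1)] (D p j))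
    (hDb : ∀ p j, AEBdd μ (D p j)) (hc : ∀ n p, StronglyMeasurable[ℱ n] (c n p))
    (hcb : ∀ n p, AEBdd μ (c n p))
    (h4 : ∀ p, Summable fun j : ℕ => ((j : ℝ) + 1) ^ 2 * ∫ ω, D p j ω ^ 4 ∂μ)
    {c' : ι → Ω → ℝ} (hc' : ∀ p, ∀ᵐ ω ∂μ, Tendsto (fun n => c n p ω) atTop (𝓝 (c' p ω)))
    (N : ℕ → ℕ) :
    ∀ᵐ ω ∂μ, Tendsto (fun n => ∑ j ∈ Finset.range (N n),
      (μ[fun ω => weightedArray D c n j ω ^ 4 | ℱ (n + j)]) ω) atTop (𝓝 0) := by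
  have hDa : ∀ p j, AEStronglyMeasurable (D p j) μ := fun p j =>
    ((hD p j).mono (ℱ.le _)).aestronglyMeasurable
  have hD4 : ∀ p j, Integrable (fun ω => D p j ω ^ 4) μ := fun p j =>
    ((hDb p j).pow 4).integrable ((hDa p j).pow 4)
  set G : ι → ℕ → Ω → ℝ := fun p j ω => ((j : ℝ) + 1) ^ 2 * (μ[fun ω => D p j ω ^ 4 | ℱ j]) ω
    with hG
  have hGnn : ∀ p j, 0 ≤ᵐ[μ] G p j := fun p j => by
    filter_upwards [condExp_nonneg (μ := μ) (m := ℱ j) (f := fun ω => D p j ω ^ 4)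
      (Eventually.of_forall fun ω => by positivity)] with ω h
    exact mul_nonneg (by positivity) h
  have hGs : ∀ p, ∀ᵐ ω ∂μ, Summable fun j => G p j ω := fun p =>
    ae_summable_of_summable_integral (fun j => integrable_condExp.const_mul _) (hGnn p) <| by
      refine (h4 p).congr fun j => ?_
      simp only [hG]
      rw [integral_const_mul, integral_condExp (ℱ.le j)]
  set κ : ℝ := (Finset.univ : Finset ι).card ^ 3 with hκ
  have h1 : ∀ n j, ∀ᵐ ω ∂μ, (μ[fun ω => weightedArray D c n j ω ^ 4 | ℱ (n + j)]) ω
      ≤ ∑ p, (κ * c n p ω ^ 4) * G p (n + j) ω := by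
    intro n j
    have h2 := condExp_sum_mul (μ := μ) Finset.univ (ℱ.le (n + j))
      (g := fun p ω => (κ * (n : ℝ) ^ 2) * c n p ω ^ 4) (f := fun p ω => D p (n + j) ω ^ 4)
      (fun p => (((hc n p).pow 4).const_mul _).mono (ℱ.mono (by omega)))
      (fun p => (AEBdd.const _).mul ((hcb n p).pow 4)) (fun p => hD4 p _)
    have h3 : μ[fun ω => weightedArray D c n j ω ^ 4 | ℱ (n + j)] ≤ᵐ[μ]
        μ[fun ω => ∑ p, ((κ * (n : ℝ) ^ 2) * c n p ω ^ 4) * D p (n + j) ω ^ 4 | ℱ (n + j)] := by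
      refine condExp_mono (((aebdd_weightedArray hDb hcb n j).pow 4).integrable
        (((stronglyMeasurable_weightedArray hD hc n j).mono (ℱ.le _)).aestronglyMeasurable.pow 4))
        ?_ (Eventually.of_forall fun ω => ?_)
      · refine integrable_finsetSum _ fun p _ => AEBdd.integrable
          (((AEBdd.const _).mul ((hcb n p).pow 4)).mul ((hDb p _).pow 4)) ?_
        exact ((((hc n p).mono (ℱ.le _)).aestronglyMeasurable.pow 4).const_mul _).mul
          ((hDa p _).pow 4)
      · refine (sum_pow_four_le Finset.univ _).trans (le_of_eq ?_)
        rw [Finset.mul_sum]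
        refine Finset.sum_congr rfl fun p _ => ?_
        have hs := Real.sq_sqrt (Nat.cast_nonneg n : (0 : ℝ) ≤ n)
        rw [mul_pow, mul_pow, show Real.sqrt n ^ 4 = (n : ℝ) ^ 2 by
          rw [show Real.sqrt n ^ 4 = (Real.sqrt n ^ 2) ^ 2 by ring, hs]]
        ring
    filter_upwards [h2, h3, ae_all_iff.2 fun p => hGnn p (n + j)] with ω k2 k3 k4
    refine k3.trans (k2.le.trans (Finset.sum_le_sum fun p _ => ?_))
    have k5 : 0 ≤ (μ[fun ω => D p (n + j) ω ^ 4 | ℱ (n + j)]) ω := by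
      have := k4 p
      simp only [hG, Pi.zero_apply] at this
      exact (mul_nonneg_iff_of_pos_left (by positivity)).1 this
    have k6 : (n : ℝ) ^ 2 ≤ (((n + j : ℕ) : ℝ) + 1) ^ 2 := by
      push_cast
      gcongr
      linarith [Nat.cast_nonneg (α := ℝ) j]
    calc (κ * (n : ℝ) ^ 2) * c n p ω ^ 4 * (μ[fun ω => D p (n + j) ω ^ 4 | ℱ (n + j)]) ω
        = (κ * c n p ω ^ 4 * (μ[fun ω => D p (n + j) ω ^ 4 | ℱ (n + j)]) ω) * (n : ℝ) ^ 2 := by ring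
      _ ≤ (κ * c n p ω ^ 4 * (μ[fun ω => D p (n + j) ω ^ 4 | ℱ (n + j)]) ω)
          * (((n + j : ℕ) : ℝ) + 1) ^ 2 := by gcongr
      _ = _ := by simp only [hG]; ring
  have h5 : ∀ n j, ∀ᵐ ω ∂μ, 0 ≤ (μ[fun ω => weightedArray D c n j ω ^ 4 | ℱ (n + j)]) ω :=
    fun n j => condExp_nonneg (Eventually.of_forall fun ω => by positivity)
  filter_upwards [ae_all_iff.2 fun n => ae_all_iff.2 fun j => h1 n j,
    ae_all_iff.2 fun n => ae_all_iff.2 fun j => h5 n j, ae_all_iff.2 hGs,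
    ae_all_iff.2 fun p => ae_all_iff.2 fun j => hGnn p j, ae_all_iff.2 hc'] with ω k1 k2 k3 k4 k5
  have k6 : Tendsto (fun n => ∑ p, (κ * c n p ω ^ 4) * ∑' j, G p (j + n) ω) atTop (𝓝 0) := by
    have := tendsto_finsetSum Finset.univ fun p (_ : p ∈ Finset.univ) =>
      (((k5 p).pow 4).const_mul κ).mul (tendsto_sum_nat_add fun j => G p j ω)
    simpa using this
  refine squeeze_zero (fun n => Finset.sum_nonneg fun j _ => k2 n j) (fun n => ?_) k6
  calc _ ≤ ∑ j ∈ Finset.range (N n), ∑ p, (κ * c n p ω ^ 4) * G p (n + j) ω :=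
        Finset.sum_le_sum fun j _ => k1 n j
    _ = ∑ p, (κ * c n p ω ^ 4) * ∑ j ∈ Finset.range (N n), G p (j + n) ω := by
        rw [Finset.sum_comm]
        simp only [Finset.mul_sum, add_comm]
    _ ≤ _ := by
        refine Finset.sum_le_sum fun p _ => mul_le_mul_of_nonneg_left ?_ (by positivity)
        exact ((summable_nat_add_iff n).2 (k3 p)).sum_le_tsum _ fun j _ => k4 p _

end WeightedTail

/-! ### From finite arrays to the full martingale remainder -/

section Remainder

variable {Ω : Type*} {m0 : MeasurableSpace Ω} {μ : Measure Ω} [IsProbabilityMeasure μ]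
  {ι : Type*} [Fintype ι]

/-- Bounded convergence gives `L¹` convergence, so `N n` can be taken so large that the expected
scaled cut-off error is at most `2⁻ⁿ`; summability then gives almost sure convergence to `0`. The
extra factor `n` absorbs weights of size up to `n`. -/
lemma exists_horizon {M : ι → ℕ → Ω → ℝ} {L : ι → Ω → ℝ}
    (hM : ∀ p n, AEStronglyMeasurable (M p n) μ) (hMb : ∀ p n ω, |M p n ω| ≤ 1)
    (hL : ∀ p, ∀ᵐ ω ∂μ, Tendsto (fun n => M p n ω) atTop (𝓝 (L p ω))) :
    ∃ N : ℕ → ℕ, (∀ n, n ^ 2 ≤ N n) ∧ ∀ᵐ ω ∂μ, Tendsto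
      (fun n : ℕ => Real.sqrt n * n * ∑ p, |L p ω - M p (n + N n) ω|) atTop (𝓝 0) := by
  have hLm : ∀ p, AEStronglyMeasurable (L p) μ := fun p =>
    aestronglyMeasurable_of_tendsto_ae atTop (hM p) (hL p)
  have hLb : ∀ p, ∀ᵐ ω ∂μ, |L p ω| ≤ 1 := fun p => by
    filter_upwards [hL p] with ω h
    exact le_of_tendsto' h.abs fun n => hMb p n ω
  have hm : ∀ i, AEStronglyMeasurable (fun ω => ∑ p, |L p ω - M p i ω|) μ := fun i =>
    Finset.aestronglyMeasurable_fun_sum _ fun p _ => ((hLm p).sub (hM p i)).norm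
  have hb : ∀ i, ∀ᵐ ω ∂μ, ‖∑ p, |L p ω - M p i ω|‖ ≤ (Finset.univ : Finset ι).card * 2 := fun i => by
    filter_upwards [ae_all_iff.2 hLb] with ω h
    rw [Real.norm_of_nonneg (Finset.sum_nonneg fun p _ => abs_nonneg _), ← nsmul_eq_mul]
    refine Finset.sum_le_card_nsmul _ _ _ fun p _ => (abs_sub _ _).trans ?_
    linarith [h p, hMb p i ω]
  have hint : ∀ i, Integrable (fun ω => ∑ p, |L p ω - M p i ω|) μ := fun i =>
    Integrable.of_bound (hm i) _ (hb i)
  have h1 : Tendsto (fun i => ∫ ω, ∑ p, |L p ω - M p i ω| ∂μ) atTop (𝓝 0) := by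
    have := tendsto_integral_of_dominated_convergence (μ := μ)
      (F := fun i ω => ∑ p, |L p ω - M p i ω|) (f := fun _ => 0) _ hm (integrable_const _) hb ?_
    · simpa using this
    · filter_upwards [ae_all_iff.2 hL] with ω h
      have := tendsto_finsetSum Finset.univ fun p (_ : p ∈ Finset.univ) =>
        ((h p).const_sub (L p ω)).abs
      simpa using this
  have h2 : ∀ n : ℕ, ∃ i, n ^ 2 ≤ i ∧
      Real.sqrt n * n * ∫ ω, ∑ p, |L p ω - M p (n + i) ω| ∂μ ≤ (1 / 2) ^ n := fun n => by
    have h3 := (h1.comp (tendsto_add_atTop_nat n)).const_mul (Real.sqrt n * n)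
    rw [mul_zero] at h3
    obtain ⟨i, hi, hi'⟩ := ((eventually_ge_atTop (n ^ 2)).and
      (h3.eventually (ge_mem_nhds (show (0 : ℝ) < (1 / 2) ^ n by positivity)))).exists
    refine ⟨i, hi, ?_⟩
    simpa only [Function.comp, add_comm] using hi'
  choose N hN hN' using h2
  refine ⟨N, hN, ?_⟩
  have h3 := ae_summable_of_summable_integral (μ := μ)
    (f := fun n ω => Real.sqrt n * n * ∑ p, |L p ω - M p (n + N n) ω|)
    (fun n => (hint _).const_mul _)
    (fun n => Eventually.of_forall fun ω =>
      mul_nonneg (by positivity) (Finset.sum_nonneg fun p _ => abs_nonneg _)) ?_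
  · filter_upwards [h3] with ω h using h.tendsto_atTop_zero
  · refine Summable.of_nonneg_of_le (fun n => ?_) (fun n => ?_)
      (summable_geometric_of_lt_one (by norm_num) (by norm_num : (1 / 2 : ℝ) < 1))
    · exact integral_nonneg fun ω =>
        mul_nonneg (by positivity) (Finset.sum_nonneg fun p _ => abs_nonneg _)
    · rw [integral_const_mul]
      exact hN' n

/-- Conditional limits are unchanged by an asymptotically negligible perturbation. -/
lemma ae_tendsto_condExp_cos_of_sub (ℱ : Filtration ℕ m0) {S Z : ℕ → Ω → ℝ}
    (hS : ∀ n, AEStronglyMeasurable (S n) μ) (hZ : ∀ n, AEStronglyMeasurable (Z n) μ)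
    (h : ∀ᵐ ω ∂μ, Tendsto (fun n => Z n ω - S n ω) atTop (𝓝 0)) {θ l : ℝ}
    (hl : ∀ᵐ ω ∂μ, Tendsto (fun n => (μ[fun ω => Real.cos (θ + S n ω) | ℱ n]) ω) atTop (𝓝 l)) :
    ∀ᵐ ω ∂μ, Tendsto (fun n => (μ[fun ω => Real.cos (θ + Z n ω) | ℱ n]) ω) atTop (𝓝 l) := by
  have hcm : ∀ {Y : Ω → ℝ}, AEStronglyMeasurable Y μ →
      AEStronglyMeasurable (fun ω => Real.cos (θ + Y ω)) μ := fun hY =>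
    Real.continuous_cos.comp_aestronglyMeasurable (aestronglyMeasurable_const.add hY)
  have hci : ∀ {Y : Ω → ℝ}, AEStronglyMeasurable Y μ →
      Integrable (fun ω => Real.cos (θ + Y ω)) μ := fun hY =>
    (AEBdd.of_le 1 fun ω => Real.abs_cos_le_one _).integrable (hcm hY)
  have h1 := ae_tendsto_condExp_zero (μ := μ) ℱ (C := 2)
    (Z := fun n ω => Real.cos (θ + Z n ω) - Real.cos (θ + S n ω))
    (fun n => (hcm (hZ n)).sub (hcm (hS n)))
    (fun n => Eventually.of_forall fun ω => (abs_sub _ _).trans <| by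
      linarith [Real.abs_cos_le_one (θ + Z n ω), Real.abs_cos_le_one (θ + S n ω)]) ?_
  · filter_upwards [h1, hl, ae_all_iff.2 fun n => condExp_sub (hci (hZ n)) (hci (hS n)) (ℱ n)]
      with ω k1 k2 k3
    have k4 := k1.add k2
    rw [zero_add] at k4
    refine k4.congr fun n => ?_
    have := k3 n
    simp only [Pi.sub_apply] at this
    exact eq_sub_iff_add_eq.1 this
  · filter_upwards [h] with ω k
    refine squeeze_zero_norm (fun n => ?_) (by simpa using k.abs)
    have := Real.abs_cos_sub_cos_le (θ + Z n ω) (θ + S n ω)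
    rwa [add_sub_add_left_eq_sub] at this

/-- `{R + 1 < |Z|}` is contained in `{R < |S|} ∪ {1 < |Z - S|}`, and the second event eventually
fails almost surely. -/
lemma ae_eventually_condExp_tail_of_sub (ℱ : Filtration ℕ m0) {S Z : ℕ → Ω → ℝ}
    (hS : ∀ n, AEStronglyMeasurable (S n) μ) (hZ : ∀ n, AEStronglyMeasurable (Z n) μ)
    (h : ∀ᵐ ω ∂μ, Tendsto (fun n => Z n ω - S n ω) atTop (𝓝 0)) {R l : ℝ}
    (hl : ∀ᵐ ω ∂μ, ∀ ε > 0, ∀ᶠ n in atTop,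
      (μ[fun ω => if R < |S n ω| then (1 : ℝ) else 0 | ℱ n]) ω ≤ l + ε) :
    ∀ᵐ ω ∂μ, ∀ ε > 0, ∀ᶠ n in atTop,
      (μ[fun ω => if R + 1 < |Z n ω| then (1 : ℝ) else 0 | ℱ n]) ω ≤ l + ε := by
  have hcm : ∀ {Y : Ω → ℝ} (r : ℝ), AEStronglyMeasurable Y μ →
      AEStronglyMeasurable (fun ω => if r < |Y ω| then (1 : ℝ) else 0) μ := fun r hY =>
    (Measurable.ite (measurableSet_lt measurable_const measurable_norm) measurable_const
      measurable_const : Measurable fun y : ℝ => if r < ‖y‖ then (1 : ℝ) else 0).comp_aemeasurable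
        hY.aemeasurable |>.aestronglyMeasurable
  have hb : ∀ (Y : Ω → ℝ) (r : ℝ) ω, |if r < |Y ω| then (1 : ℝ) else 0| ≤ 1 := fun Y r ω => by
    split_ifs <;> simp
  have hci : ∀ {Y : Ω → ℝ} (r : ℝ), AEStronglyMeasurable Y μ →
      Integrable (fun ω => if r < |Y ω| then (1 : ℝ) else 0) μ := fun r hY =>
    (AEBdd.of_le 1 (hb _ r)).integrable (hcm r hY)
  have hd : ∀ n, AEStronglyMeasurable (fun ω => Z n ω - S n ω) μ := fun n => (hZ n).sub (hS n)
  have h1 := ae_tendsto_condExp_zero (μ := μ) ℱ (C := 1)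
    (Z := fun n ω => if 1 < |Z n ω - S n ω| then (1 : ℝ) else 0)
    (fun n => hcm 1 (hd n)) (fun n => Eventually.of_forall (hb (fun ω => Z n ω - S n ω) 1)) ?_
  · have h2 : ∀ n, μ[fun ω => if R + 1 < |Z n ω| then (1 : ℝ) else 0 | ℱ n] ≤ᵐ[μ]
        μ[fun ω => (if R < |S n ω| then (1 : ℝ) else 0) +
          if 1 < |Z n ω - S n ω| then (1 : ℝ) else 0 | ℱ n] := fun n => by
      refine condExp_mono (hci _ (hZ n)) ((hci R (hS n)).add (hci 1 (hd n)))
        (Eventually.of_forall fun ω => ?_)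
      have : |Z n ω| ≤ |S n ω| + |Z n ω - S n ω| := by
        simpa using abs_add_le (S n ω) (Z n ω - S n ω)
      dsimp only
      split_ifs <;> linarith
    filter_upwards [h1, hl, ae_all_iff.2 h2,
      ae_all_iff.2 fun n => condExp_add (hci R (hS n)) (hci 1 (hd n)) (ℱ n)] with ω k1 k2 k3 k4 ε hε
    filter_upwards [k2 (ε / 2) (half_pos hε), k1.eventually (ge_mem_nhds (half_pos hε))] with n a1 a2
    have a3 := k4 n
    simp only [Pi.add_apply] at a3
    have a4 := (k3 n).trans (le_of_eq a3)
    linarith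
  · filter_upwards [h] with ω k
    have k1 := k.abs
    rw [abs_zero] at k1
    refine tendsto_const_nhds.congr' ?_
    filter_upwards [k1.eventually (ge_mem_nhds one_pos)] with n hn
    rw [if_neg (not_lt.2 hn)]

/-- Almost sure conditional central limit theorem for the weighted remainders of convergent
bounded martingales. -/
theorem ae_tendsto_condExp_cos_remainder (ℱ : Filtration ℕ m0) {M : ι → ℕ → Ω → ℝ}
    {L : ι → Ω → ℝ} (hM : ∀ p n, StronglyMeasurable[ℱ n] (M p n)) (hMb : ∀ p n ω, |M p n ω| ≤ 1)
    (hmart : ∀ p n, 1 ≤ n → μ[M p (n + 1) | ℱ n] =ᵐ[μ] M p n)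
    (hL : ∀ p, ∀ᵐ ω ∂μ, Tendsto (fun n => M p n ω) atTop (𝓝 (L p ω)))
    (h4 : ∀ p, Summable fun j : ℕ =>
      ((j : ℝ) + 1) ^ 2 * ∫ ω, (M p (j + 1) ω - M p j ω) ^ 4 ∂μ)
    {U : Ω → Matrix ι ι ℝ}
    (hU : ∀ p q, ∀ᵐ ω ∂μ, Tendsto (fun j : ℕ => (μ[fun ω => ((j : ℝ) + 1) ^ 2 *
      ((M p (j + 1) ω - M p j ω) * (M q (j + 1) ω - M q j ω)) | ℱ j]) ω) atTop (𝓝 (U ω p q)))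
    {c : ℕ → ι → Ω → ℝ} (hc : ∀ n p, StronglyMeasurable[ℱ n] (c n p)) {c' : ι → Ω → ℝ}
    (hc' : ∀ p, ∀ᵐ ω ∂μ, Tendsto (fun n => c n p ω) atTop (𝓝 (c' p ω))) {v : ℝ} (hv : 0 ≤ v)
    (hcU : ∀ᵐ ω ∂μ, ∑ p, ∑ q, c' p ω * c' q ω * U ω p q = v) :
    (∀ θ : ℝ, ∀ᵐ ω ∂μ, Tendsto (fun n => (μ[fun ω =>
      Real.cos (θ + Real.sqrt n * ∑ p, c n p ω * (L p ω - M p n ω)) | ℱ n]) ω) atTop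
        (𝓝 (Real.exp (-v / 2) * Real.cos θ))) ∧
    ∀ R : ℝ, 0 < R → ∀ᵐ ω ∂μ, ∀ ε > 0, ∀ᶠ n in atTop,
      (μ[fun ω => if R + 1 < |Real.sqrt n * ∑ p, c n p ω * (L p ω - M p n ω)| then (1 : ℝ) else 0 |
        ℱ n]) ω ≤ (v + 1) / R ^ 2 + ε := by
  have hMa : ∀ p n, AEStronglyMeasurable (M p n) μ := fun p n =>
    ((hM p n).mono (ℱ.le n)).aestronglyMeasurable
  have hMi : ∀ p n, Integrable (M p n) μ := fun p n =>
    (AEBdd.of_le 1 (hMb p n)).integrable (hMa p n)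
  have hLm : ∀ p, AEStronglyMeasurable (L p) μ := fun p =>
    aestronglyMeasurable_of_tendsto_ae atTop (hMa p) (hL p)
  obtain ⟨N, hN, hrem⟩ := exists_horizon hMa hMb hL
  -- The weights converge almost surely but need not be bounded; truncation at level `n` bounds each
  -- row and is eventually inactive.
  set b : ℕ → ι → Ω → ℝ := fun n p => {ω | |c n p ω| ≤ n}.indicator (c n p) with hb
  have hbm : ∀ n p, StronglyMeasurable[ℱ n] (b n p) := fun n p =>
    (hc n p).indicator ((continuous_abs.measurable.comp (hc n p).measurable) measurableSet_Iic)
  have hble : ∀ n p ω, |b n p ω| ≤ n := fun n p ω => by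
    by_cases h : |c n p ω| ≤ n
    · simp [hb, h]
    · simp [hb, h]
  have hbc : ∀ᵐ ω ∂μ, ∀ᶠ n in atTop, ∀ p, b n p ω = c n p ω := by
    filter_upwards [ae_all_iff.2 hc'] with ω h
    refine eventually_all.2 fun p => ?_
    filter_upwards [(h p).abs.eventually (gt_mem_nhds (lt_add_one _)),
      tendsto_natCast_atTop_atTop.eventually (eventually_ge_atTop (|c' p ω| + 1))] with n h1 h2
    exact Set.indicator_of_mem (s := {ω | |c n p ω| ≤ n}) (h1.le.trans h2) _
  have hb' : ∀ p, ∀ᵐ ω ∂μ, Tendsto (fun n => b n p ω) atTop (𝓝 (c' p ω)) := fun p => by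
    filter_upwards [hbc, hc' p] with ω h1 h2
    exact h2.congr' (h1.mono fun n hn => (hn p).symm)
  have hbb : ∀ n p, AEBdd μ (b n p) := fun n p => AEBdd.of_le n (hble n p)
  set D : ι → ℕ → Ω → ℝ := fun p j ω => M p (j + 1) ω - M p j ω with hD
  have hDm : ∀ p j, StronglyMeasurable[ℱ (j + 1)] (D p j) := fun p j =>
    (hM p (j + 1)).sub ((hM p j).mono (ℱ.mono (Nat.le_succ j)))
  have hDb : ∀ p j, AEBdd μ (D p j) := fun p j =>
    (AEBdd.of_le 1 (hMb p (j + 1))).sub (AEBdd.of_le 1 (hMb p j))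
  have hD0 : ∀ p j, 1 ≤ j → μ[D p j | ℱ j] =ᵐ[μ] 0 := fun p j hj => by
    have h1 := condExp_sub (hMi p (j + 1)) (hMi p j) (ℱ j)
    rw [condExp_of_stronglyMeasurable (ℱ.le j) (hM p j) (hMi p j)] at h1
    refine EventuallyEq.trans h1 ?_
    filter_upwards [hmart p j hj] with ω k
    simp [k]
  have hclt := ae_tendsto_condExp_cos_array (μ := μ) ℱ (N := N) hv
    (stronglyMeasurable_weightedArray hDm hbm) (aebdd_weightedArray hDb hbb)
    (condExp_weightedArray hDm hDb hbm hbb hD0)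
    (by
      filter_upwards [ae_tendsto_sum_condExp_weightedArray_sq hDm hDb hbm hbb hU hb' hN, hcU]
        with ω k1 k2
      rwa [k2] at k1)
    (ae_tendsto_sum_condExp_weightedArray_pow_four hDm hDb hbm hbb h4 hb' N)
  set S : ℕ → Ω → ℝ := fun n ω => ∑ j ∈ Finset.range (N n), weightedArray D b n j ω with hS
  set Z : ℕ → Ω → ℝ := fun n ω => Real.sqrt n * ∑ p, c n p ω * (L p ω - M p n ω) with hZ
  have hSm : ∀ n, AEStronglyMeasurable (S n) μ := fun n =>
    Finset.aestronglyMeasurable_fun_sum _ fun j _ =>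
      ((stronglyMeasurable_weightedArray hDm hbm n j).mono (ℱ.le _)).aestronglyMeasurable
  have hZm : ∀ n, AEStronglyMeasurable (Z n) μ := fun n =>
    (Finset.aestronglyMeasurable_fun_sum _ fun p _ =>
      (((hc n p).mono (ℱ.le n)).aestronglyMeasurable.mul ((hLm p).sub (hMa p n)))).const_mul _
  have hSeq : ∀ n ω, S n ω = Real.sqrt n * ∑ p, b n p ω * (M p (n + N n) ω - M p n ω) := by
    intro n ω
    simp only [hS, weightedArray]
    rw [Finset.sum_comm, Finset.mul_sum]
    refine Finset.sum_congr rfl fun p _ => ?_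
    rw [← Finset.mul_sum, mul_assoc]
    congr 2
    simpa only [hD, add_assoc, add_zero] using
      Finset.sum_range_sub (fun j => M p (n + j) ω) (N n)
  have hdiff : ∀ᵐ ω ∂μ, Tendsto (fun n => Z n ω - S n ω) atTop (𝓝 0) := by
    filter_upwards [hbc, hrem] with ω k1 k2
    refine squeeze_zero_norm' ?_ k2
    filter_upwards [k1] with n hn
    have k3 : Z n ω - S n ω = Real.sqrt n * ∑ p, b n p ω * (L p ω - M p (n + N n) ω) := by
      rw [hSeq]
      simp only [hZ, ← hn]
      rw [← mul_sub, ← Finset.sum_sub_distrib]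
      congr 1
      exact Finset.sum_congr rfl fun p _ => by ring
    rw [k3, Real.norm_eq_abs, abs_mul, abs_of_nonneg (Real.sqrt_nonneg _), mul_assoc,
      Finset.mul_sum (a := (n : ℝ))]
    refine mul_le_mul_of_nonneg_left ((Finset.abs_sum_le_sum_abs _ _).trans
      (Finset.sum_le_sum fun p _ => ?_)) (Real.sqrt_nonneg _)
    rw [abs_mul]
    exact mul_le_mul_of_nonneg_right (hble n p ω) (abs_nonneg _)
  exact ⟨fun θ => ae_tendsto_condExp_cos_of_sub ℱ hSm hZm hdiff (hclt.1 θ),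
    fun R hR => ae_eventually_condExp_tail_of_sub ℱ hSm hZm hdiff (hclt.2 R hR)⟩

end Remainder

/-! ### The scaled error, its conditional laws and their Gaussian limit -/

section ScaledError

variable {Ω : Type*} {X : ℕ → Ω → ℝ} {P : ∀ n : ℕ, Kernel (Fin n → ℝ) ℝ} {k : ℕ}

/-- The weights of `F̃(t_p) - P_n(t_p)` in the scaled error in direction `u`. -/
def weight (X : ℕ → Ω → ℝ) (P : ∀ n : ℕ, Kernel (Fin n → ℝ) ℝ) (t : Fin k → ℝ)
    (u : EuclideanSpace ℝ (Fin k)) (n : ℕ) (p : Fin k) (ω : Ω) : ℝ :=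
  Matrix.vecMul u.ofLp (invSqrt (V X P t n ω)) p

lemma inner_scaledError (t : Fin k → ℝ) (u : EuclideanSpace ℝ (Fin k)) (n : ℕ) (ω : Ω) :
    inner ℝ (scaledError X P t n ω) u = Real.sqrt n * ∑ p, weight X P t u n p ω *
      (limitCDF X (t p) ω - predCDF X P n (t p) ω) := by
  rw [scaledError, real_inner_smul_left, EuclideanSpace.inner_eq_star_dotProduct]
  congr 1
  simp only [star_trivial, weight]
  rw [Matrix.dotProduct_mulVec]
  rfl

lemma norm_le_of_forall_abs_le {y : EuclideanSpace ℝ (Fin k)} {R : ℝ} (hR : 0 ≤ R)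
    (h : ∀ i, |y i| ≤ R) : ‖y‖ ≤ k * R := by
  rw [EuclideanSpace.norm_eq]
  refine Real.sqrt_le_iff.2 ⟨by positivity, ?_⟩
  have h1 : ∑ i, ‖y i‖ ^ 2 ≤ ∑ _i : Fin k, R ^ 2 :=
    Finset.sum_le_sum fun i _ => pow_le_pow_left₀ (norm_nonneg _) (h i) 2
  refine h1.trans ?_
  rw [Finset.sum_const, Finset.card_univ, Fintype.card_fin, nsmul_eq_mul, mul_pow]
  refine mul_le_mul_of_nonneg_right ?_ (by positivity)
  exact_mod_cast Nat.le_self_pow two_ne_zero k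

variable [m0 : MeasurableSpace Ω]

lemma measurable_V (hX : ∀ n, Measurable (X n)) (t : Fin k → ℝ) (n : ℕ) (i j : Fin k) :
    Measurable[pastSigma X n] fun ω => V X P t n ω i j := by
  have hupd : ∀ i, ∀ m ≤ n, Measurable[pastSigma X n] (update X P (t i) m) := fun i m hm =>
    (((stronglyMeasurable_predCDF m (t i)).mono ((pastFiltration X hX).mono hm)).sub
      ((stronglyMeasurable_predCDF (m - 1) (t i)).mono
        ((pastFiltration X hX).mono ((Nat.sub_le m 1).trans hm)))).measurable
  have h1 : (fun ω => V X P t n ω i j) = fun ω => (1 / (n : ℝ)) * ∑ m ∈ Finset.Icc 1 n,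
      (m : ℝ) ^ 2 * (update X P (t i) m ω * update X P (t j) m ω) := by
    funext ω
    simp only [V, Matrix.smul_apply, Matrix.sum_apply, smul_eq_mul, Matrix.vecMulVec_apply,
      updateVec]
  rw [h1]
  refine Measurable.const_mul (Finset.measurable_fun_sum _ fun m hm => ?_) _
  have hmn := (Finset.mem_Icc.1 hm).2
  exact ((hupd i m hmn).mul (hupd j m hmn)).const_mul _

lemma measurable_invSqrt_V (hX : ∀ n, Measurable (X n)) (t : Fin k → ℝ) (n : ℕ) (i j : Fin k) :
    Measurable[pastSigma X n] fun ω => invSqrt (V X P t n ω) i j :=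
  measurable_invSqrt (measurable_V hX t n) (posSemidef_V X P t n) i j

lemma stronglyMeasurable_weight (hX : ∀ n, Measurable (X n)) (t : Fin k → ℝ)
    (u : EuclideanSpace ℝ (Fin k)) (n : ℕ) (p : Fin k) :
    StronglyMeasurable[pastSigma X n] (weight X P t u n p) := by
  refine Measurable.stronglyMeasurable ?_
  have h1 : weight X P t u n p = fun ω => ∑ i, u i * invSqrt (V X P t n ω) i p := by
    funext ω
    rfl
  rw [h1]
  exact Finset.measurable_fun_sum _ fun i _ => (measurable_invSqrt_V hX t n i p).const_mul _

variable {μ : Measure Ω} [IsProbabilityMeasure μ] [∀ n, IsMarkovKernel (P n)]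

lemma aemeasurable_scaledError (hX : ∀ n, Measurable (X n)) (hcid : IsCID X μ)
    (hP : IsPredictiveRule X μ P) (t : Fin k → ℝ) (n : ℕ) :
    AEMeasurable (scaledError X P t n) μ := by
  have hM : ∀ (m : ℕ) p, Measurable (predCDF X P m (t p)) := fun m p =>
    (stronglyMeasurable_predCDF m (t p)).measurable.mono (measurable_firstN hX m).comap_le le_rfl
  -- `limitCDF` is built from `limUnder`; its measurability comes from being an almost sure limit of
  -- predictive probabilities.
  have hL : ∀ p, AEMeasurable (limitCDF X (t p)) μ := fun p =>
    aemeasurable_of_tendsto_metrizable_ae atTop (fun m => (hM m p).aemeasurable)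
      (ae_tendsto_predCDF hX hcid hP (t p))
  refine AEMeasurable.const_smul (g := fun ω => WithLp.toLp 2
    ((invSqrt (V X P t n ω)).mulVec fun i => limitCDF X (t i) ω - predCDF X P n (t i) ω)) ?_
      (Real.sqrt n)
  refine (WithLp.measurable_toLp 2 _).comp_aemeasurable (aemeasurable_pi_lambda _ fun i => ?_)
  simp only [Matrix.mulVec, dotProduct]
  exact Finset.aemeasurable_fun_sum _ fun j _ =>
    ((measurable_invSqrt_V hX t n i j).mono (measurable_firstN hX n).comap_le
      le_rfl).aemeasurable.mul ((hL j).sub (hM n j).aemeasurable)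

lemma condExp_ae_eq_integral_condLaw (hX : ∀ n, Measurable (X n))
    {Y : Ω → EuclideanSpace ℝ (Fin k)} (hY : AEMeasurable Y μ) (n : ℕ)
    {f : EuclideanSpace ℝ (Fin k) → ℝ} (hf : Measurable f) (hfb : ∀ y, |f y| ≤ 1) :
    μ[fun ω => f (Y ω) | pastSigma X n] =ᵐ[μ] fun ω => ∫ y, f y ∂(condLaw X μ Y n ω : Measure _) :=
  condExp_ae_eq_integral_condDistrib (measurable_firstN hX n) hY hf.stronglyMeasurable
    ((AEBdd.of_le 1 fun _ => hfb _).integrable (hf.comp_aemeasurable hY).aestronglyMeasurable)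

/-- The conditional law of the scaled error in a fixed direction is asymptotically Gaussian. -/
lemma ae_tendsto_condLaw_direction (hX : ∀ n, Measurable (X n)) (hcid : IsCID X μ)
    (hP : IsPredictiveRule X μ P) (t : Fin k → ℝ)
    (hsum : ∀ i, Summable fun n : ℕ => (n : ℝ) ^ 2 * ∫ ω, update X P (t i) n ω ^ 4 ∂μ)
    (U : Ω → Matrix (Fin k) (Fin k) ℝ) (hUpos : ∀ᵐ ω ∂μ, (U ω).PosDef)
    (hU : ∀ i j, ∀ᵐ ω ∂μ, Tendsto (fun n : ℕ => (μ[fun ω' => (n : ℝ) ^ 2 *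
      (update X P (t i) n ω' * update X P (t j) n ω') | pastSigma X (n - 1)]) ω) atTop
        (𝓝 (U ω i j))) (u : EuclideanSpace ℝ (Fin k)) :
    (∀ θ : ℝ, ∀ᵐ ω ∂μ, Tendsto (fun n => ∫ y, Real.cos (θ + inner ℝ y u)
      ∂(condLaw X μ (scaledError X P t n) n ω : Measure _)) atTop
        (𝓝 (Real.exp (-‖u‖ ^ 2 / 2) * Real.cos θ))) ∧
    ∀ R : ℝ, 0 < R → ∀ᵐ ω ∂μ, ∀ ε > 0, ∀ᶠ n in atTop,
      (condLaw X μ (scaledError X P t n) n ω : Measure _).real {y | R + 1 < |inner ℝ y u|}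
        ≤ (‖u‖ ^ 2 + 1) / R ^ 2 + ε := by
  have hV := ae_tendsto_V hX t hsum U hU
  have hYm := aemeasurable_scaledError hX hcid hP t
  have key := ae_tendsto_condExp_cos_remainder (μ := μ) (pastFiltration X hX)
    (M := fun p n => predCDF X P n (t p)) (L := fun p => limitCDF X (t p)) (U := U)
    (c := weight X P t u) (c' := fun p ω => Matrix.vecMul u.ofLp (invSqrt (U ω)) p) (v := ‖u‖ ^ 2)
    (fun p n => stronglyMeasurable_predCDF n (t p)) (fun p n => abs_predCDF_le n (t p))
    (fun p n hn => condExp_predCDF_succ hX hcid hP (t p) hn)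
    (fun p => ae_tendsto_predCDF hX hcid hP (t p))
    (fun p => by simpa [update] using (summable_nat_add_iff 1).2 (hsum p))
    (fun p q => by
      filter_upwards [hU p q] with ω h
      have h1 := (tendsto_add_atTop_iff_nat (f := fun n : ℕ => (μ[fun ω' => (n : ℝ) ^ 2 *
        (update X P (t p) n ω' * update X P (t q) n ω') | pastSigma X (n - 1)]) ω) 1).2 h
      simp only [update, Nat.add_sub_cancel, Nat.cast_add, Nat.cast_one] at h1
      exact h1)
    (stronglyMeasurable_weight hX t u)
    (fun p => by
      filter_upwards [hV, hUpos] with ω h1 h2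
      have h3 := tendsto_invSqrt (posSemidef_V X P t · ω) h2 h1
      have h4 : ∀ i, Tendsto (fun n => invSqrt (V X P t n ω) i p) atTop
          (𝓝 (invSqrt (U ω) i p)) := fun i =>
        tendsto_pi_nhds.1 (tendsto_pi_nhds.1 h3 i) p
      exact tendsto_finsetSum Finset.univ fun i _ => (h4 i).const_mul (u i))
    (sq_nonneg _)
    (by
      filter_upwards [hUpos] with ω h
      rw [EuclideanSpace.norm_sq_eq]
      have h1 := quadraticForm_invSqrt h u.ofLp
      simp only [dotProduct, Matrix.mulVec, Finset.mul_sum] at h1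
      refine Eq.trans ?_ (h1.trans ?_)
      · exact Finset.sum_congr rfl fun p _ => Finset.sum_congr rfl fun q _ => by ring
      · exact Finset.sum_congr rfl fun p _ => by rw [Real.norm_eq_abs, sq_abs, sq])
  simp only [← inner_scaledError] at key
  refine ⟨fun θ => ?_, fun R hR => ?_⟩
  · filter_upwards [key.1 θ, ae_all_iff.2 fun n => condExp_ae_eq_integral_condLaw hX (hYm n) n
      (f := fun y => Real.cos (θ + inner ℝ y u)) (by fun_prop) fun y => Real.abs_cos_le_one _]
      with ω h1 h2
    exact h1.congr h2
  · have hs : MeasurableSet {y : EuclideanSpace ℝ (Fin k) | R + 1 < |inner ℝ y u|} :=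
      measurableSet_lt measurable_const (by fun_prop)
    filter_upwards [key.2 R hR, ae_all_iff.2 fun n => condExp_ae_eq_integral_condLaw hX (hYm n) n
      (f := {y : EuclideanSpace ℝ (Fin k) | R + 1 < |inner ℝ y u|}.indicator fun _ => (1 : ℝ))
      (measurable_const.indicator hs) fun y =>
        (norm_indicator_le_norm_self (fun _ => (1 : ℝ)) y).trans (by simp)] with ω h1 h2 ε hε
    filter_upwards [h1 ε hε] with n hn
    have h3 := h2 n
    rw [integral_indicator hs] at h3
    simp only [integral_const, MeasurableSet.univ, measureReal_restrict_apply, Set.univ_inter,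
      smul_eq_mul, mul_one] at h3
    rw [← h3]
    exact hn

/-- The conditional laws of the scaled errors converge weakly to the standard Gaussian. -/
theorem ae_tendsto_condLaw (hX : ∀ n, Measurable (X n)) (hcid : IsCID X μ)
    (hP : IsPredictiveRule X μ P) (t : Fin k → ℝ)
    (hsum : ∀ i, Summable fun n : ℕ => (n : ℝ) ^ 2 * ∫ ω, update X P (t i) n ω ^ 4 ∂μ)
    (U : Ω → Matrix (Fin k) (Fin k) ℝ) (hUpos : ∀ᵐ ω ∂μ, (U ω).PosDef)
    (hU : ∀ i j, ∀ᵐ ω ∂μ, Tendsto (fun n : ℕ => (μ[fun ω' => (n : ℝ) ^ 2 *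
      (update X P (t i) n ω' * update X P (t j) n ω') | pastSigma X (n - 1)]) ω) atTop
        (𝓝 (U ω i j))) :
    ∀ᵐ ω ∂μ, Tendsto (fun n => condLaw X μ (scaledError X P t n) n ω) atTop
      (𝓝 (stdNormal k)) := by
  have key := ae_tendsto_condLaw_direction hX hcid hP t hsum U hUpos hU
  -- Countability of `D` collects the directional null sets into one; density suffices once
  -- tightness is known.
  obtain ⟨D, hDc, hDd⟩ := TopologicalSpace.exists_countable_dense (EuclideanSpace ℝ (Fin k))
  have hchar : ∀ᵐ ω ∂μ, ∀ u ∈ D, Tendsto (fun n =>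
      charFun (condLaw X μ (scaledError X P t n) n ω : Measure _) u) atTop
        (𝓝 (charFun (stdNormal k : Measure _) u)) := by
    refine (ae_ball_iff hDc).2 fun u _ => ?_
    filter_upwards [(key u).1 0, (key u).1 (-(Real.pi / 2))] with ω h0 h1
    have h2 : charFun (stdNormal k : Measure _) u
        = ((Real.exp (-‖u‖ ^ 2 / 2) * Real.cos 0 : ℝ) : ℂ)
          + ((Real.exp (-‖u‖ ^ 2 / 2) * Real.cos (-(Real.pi / 2)) : ℝ) : ℂ) * Complex.I := by
      change charFun (stdGaussian (EuclideanSpace ℝ (Fin k))) u = _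
      rw [charFun_stdGaussian]
      simp
    rw [h2]
    simp_rw [charFun_eq_integral_cos]
    exact ((Complex.continuous_ofReal.tendsto _).comp h0).add
      (((Complex.continuous_ofReal.tendsto _).comp h1).mul_const _)
  have htail : ∀ᵐ ω ∂μ, ∀ (i : Fin k) (m : ℕ), ∀ ε > 0, ∀ᶠ n in atTop,
      (condLaw X μ (scaledError X P t n) n ω : Measure (EuclideanSpace ℝ (Fin k))).real
        {y | ((m : ℝ) + 1) + 1 < |y i|}
        ≤ 2 / ((m : ℝ) + 1) ^ 2 + ε := by
    refine ae_all_iff.2 fun i => ae_all_iff.2 fun m => ?_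
    filter_upwards [(key (EuclideanSpace.single i 1)).2 ((m : ℝ) + 1) (by positivity)]
      with ω h ε hε
    simpa [EuclideanSpace.inner_single_right, one_add_one_eq_two] using h ε hε
  filter_upwards [hchar, htail] with ω h1 h2
  refine tendsto_of_tendsto_charFun_of_dense hDd h1 fun ε hε => ?_
  -- Each of the `k` coordinates contributes at most `δ` from Chebyshev and `δ` from the vanishing
  -- error, in all `k * ε / (k + 1) ≤ ε`.
  set δ : ℝ := ε / (2 * ((k : ℝ) + 1)) with hδ
  have hδ0 : 0 < δ := by positivity
  have h3 : Tendsto (fun m : ℕ => 2 / ((m : ℝ) + 1) ^ 2) atTop (𝓝 0) :=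
    tendsto_const_nhds.div_atTop ((tendsto_pow_atTop two_ne_zero).comp
      (tendsto_natCast_atTop_atTop.atTop_add tendsto_const_nhds))
  obtain ⟨m, hm⟩ := (h3.eventually (ge_mem_nhds hδ0)).exists
  refine ⟨k * (((m : ℝ) + 1) + 1), ?_⟩
  filter_upwards [eventually_all.2 fun i => h2 i m δ hδ0] with n hn
  have hsub : {y : EuclideanSpace ℝ (Fin k) | k * (((m : ℝ) + 1) + 1) < ‖y‖}
      ⊆ ⋃ i, {y | ((m : ℝ) + 1) + 1 < |y i|} := by
    intro y hy
    by_contra hcon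
    simp only [Set.mem_iUnion, not_exists] at hcon
    exact absurd (norm_le_of_forall_abs_le (by positivity) fun i => not_lt.1 (hcon i))
      (not_le.2 hy)
  refine (measureReal_mono hsub).trans ((measureReal_iUnion_fintype_le _).trans ?_)
  refine (Finset.sum_le_sum fun i _ => (hn i).trans (add_le_add_left hm δ)).trans ?_
  rw [Finset.sum_const, Finset.card_univ, Fintype.card_fin, nsmul_eq_mul, hδ]
  have hk : (0 : ℝ) ≤ k := Nat.cast_nonneg k
  rw [← add_div, mul_div_assoc', div_le_iff₀ (by positivity)]
  nlinarith

end ScaledError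

end Predictive

end

theorem mainTheorem1 {Ω : Type*} [MeasurableSpace Ω] (μ : Measure Ω) [IsProbabilityMeasure μ]
    (X : ℕ → Ω → ℝ) (hX : ∀ n, Measurable (X n)) (hcid : Predictive.IsCID X μ)
    (P : ∀ n : ℕ, Kernel (Fin n → ℝ) ℝ) [∀ n, IsMarkovKernel (P n)]
    (hP : Predictive.IsPredictiveRule X μ P)
    {k : ℕ} (t : Fin k → ℝ) (ht : μ (X 0 ⁻¹' Set.range t) = 0)
    (hsup : ∀ i, ∫⁻ ω, ⨆ n : ℕ,
      ENNReal.ofReal (Real.sqrt n * |Predictive.update X P (t i) n ω|) ∂μ < ∞)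
    (hsum : ∀ i, Summable fun n : ℕ =>
      (n : ℝ) ^ 2 * ∫ ω, Predictive.update X P (t i) n ω ^ 4 ∂μ)
    (U : Ω → Matrix (Fin k) (Fin k) ℝ) (hUpos : ∀ᵐ ω ∂μ, (U ω).PosDef)
    (hU : ∀ i j, ∀ᵐ ω ∂μ, Tendsto
      (fun n : ℕ => (μ[fun ω' => (n : ℝ) ^ 2 *
          (Predictive.update X P (t i) n ω' * Predictive.update X P (t j) n ω') |
        Predictive.pastSigma X (n - 1)]) ω) atTop (𝓝 (U ω i j))) :
    (∀ᵐ ω ∂μ, Tendsto (fun n => Predictive.empirical X n ω) atTop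
        (𝓝 (Predictive.limitDist X ω))) ∧
    (∀ᵐ ω ∂μ, Tendsto (fun n => Predictive.V X P t n ω) atTop (𝓝 (U ω))) ∧
    (∀ n, AEMeasurable (Predictive.scaledError X P t n) μ) ∧
    (∀ᵐ ω ∂μ, Tendsto
      (fun n => Predictive.condLaw X μ (Predictive.scaledError X P t n) n ω) atTop
        (𝓝 (Predictive.stdNormal k))) := by
  exact ⟨hcid.ae_tendsto_empirical hX, Predictive.ae_tendsto_V hX t hsum U hU,
    Predictive.aemeasurable_scaledError hX hcid hP t,
    Predictive.ae_tendsto_condLaw hX hcid hP t hsum U hUpos hU⟩
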